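/- \textbf{Setting.} Let $n\ge 2$ and let $j\ge 1$ be an integer with $j\not\equiv 0 \pmod n$. Let $e_{ik}$ be the elementary $n\times n$ matrices, $e_1=(1,0,\dots,0)^t$, $b=\sum_{i=1}^{n-1}e_{i+1,i}$, $J=e_{1n}\lambda+b$, and $V_n=\bigoplus_{i=1}^{n-1}\mathbb R e_{in}$. For a smooth $\gamma(x,t)\in\mathbb R^n$ with $g=(\gamma,\gamma_x,\dots,\gamma_x^{(n-1)})$ and $\det g=1$, the central affine curvature is $u=\sum_{i=1}^{n-1}u_ie_{in}$, where $u_i$ is the determinant of $g$ with its $i$-th column replaced by $\gamma_x^{(n)}$; thus $g_x=g(b+u)$. Let $Y=Y(u,\lambda)=\sum_{i\le 1}Y_i\lambda^i$, with $Y_i$ valued in $sl(n,\mathbb R)$, be the formal Laurent series in $\lambda^{-1}$ with $[\partial_x+J+u,Y]=0$, $Y^n=\lambda I$ and leading part $J$ (that is, $Y-J$ only has terms $\lambda^ie_{pq}$ with $ni+p-q\le 0$). Write $Y^j=\sum_iY_{j,i}\lambda^i$, let $\zeta_j(u)$ be the strictly upper triangular matrix with $[\partial_x+b+u,\,Y_{j,0}-\zeta_j(u)]\in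 V_n$, and put $Z_j(u,\lambda)=\sum_{i\ge0}Y_{j,i}\lambda^i-\zeta_j(u)$ and $Z_{j,0}(u)=Y_{j,0}-\zeta_j(u)$. The $j$-th central affine curve flow is $$\gamma_t=g\,Z_{j,0}(u)\,e_1,\qquad \det g=1. \tag{1}$$ A frame of $u$ is an invertible complex matrix $E(x,t,\lambda)$, smooth in $(x,t)$, with $E^{-1}E_x=J+u$, $E^{-1}E_t=Z_j(u,\lambda)$ and $\overline{E(x,t,\bar\lambda)}=E(x,t,\lambda)$. Given $u$ and a function $h(x,t)$, put $\tilde u_n=0$ and, for $i=n,n-1,\dots,2$, $$\tilde u_{i-1}=u_{i-1}+\sum_{m=i}^{n-1}\binom{m-1}{i-1}u_m h_x^{(m-i)}-\binom{n}{i-1}h_x^{(n-i+1)}-(\tilde u_i)_x-\tilde u_i h .$$ Let $f_{u,h}=J+hI+N$, where $N$ is strictly upper triangular with $N_{ik}=\binom{k-1}{i-1}h_x^{(k-i)}$ for $i<k<n$ and $N_{in}=\tilde u_i+\binom{n-1}{i-1}h_x^{(n-i)}$ for $i<n$. For a matrix $M$ let $M^\sharp$ be its (transposed) cofactor matrix,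 so that $MM^\sharp=\det(M)I$. \textbf{Theorem} (Bäcklund transformation for the $j$-th central affine curve flow with $k=0$). Let $\gamma:\mathbb R^2\to\mathbb R^n$ be a solution of (1), with $g$ and $u$ as above, and let $E(x,t,\lambda)$ be a frame of $u$, defined and holomorphic for $\lambda$ in an open set $\mathcal O\subset\mathbb C$ containing $0$, with $E(0,0,0)=g(0,0)$. Let $E_1=\partial_\lambda E|_{\lambda=0}$. Let $c_1,\dots,c_{n-1}\in\mathbb R$, $A=b+\sum_{i=1}^{n-1}c_ie_{i+1,n}$, $v=(v_1,\dots,v_n)^t=g^{-1}(c_1,\dots,c_{n-1},-1)^t$, and $h=-v_{n-1}/v_n$. Then the set $D=\{(x,t)\in\mathbb R^2: v_n(x,t)\ne0\}$ on which $h$ is defined is open and dense in $\mathbb{R}^2$, and $$\tilde\gamma=(e_{1n}g+AE_1)\,f_{u,h}^\sharp(x,t,0)\,e_1$$ is real valued and is a smooth solution of (1) on $D$. Moreover, these hypotheses hold for the vacuum $u=0$, $\gamma=\exp(bx+b^jt)e_1$, $E=\exp(xJ+tJ^j)$ (with $\mathcal O=\mathbb C$), and in that case, for all $c_1,\dots,c_{n-1}\in\mathbb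 R$, $D$ is the non-empty set where a real polynomial $Q(x,t)$ does not vanish and $\tilde\gamma=(P_1/Q,\dots,P_n/Q)^t$ on $D$ with real polynomials $P_i(x,t)$; so $\tilde\gamma$ is a rational solution of (1) on $D$. -/

import Mathlib

open scoped ContDiff

namespace CentralAffine

noncomputable section

/-- The elementary matrix `e_{ij}` of size `n`, with the indices `i, j` counted from `1`. -/
def e (n : ℕ) (R : Type*) [CommRing R] (i j : ℕ) : Matrix (Fin n) (Fin n) R :=
  Matrix.of fun p q => if p.val + 1 = i ∧ q.val + 1 = j then 1 else 0

/-- `b = ∑_{i=1}^{n-1} e_{i+1,i}`. -/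
def b (n : ℕ) (R : Type*) [CommRing R] : Matrix (Fin n) (Fin n) R :=
  ∑ i ∈ Finset.Icc 1 (n - 1), e n R (i + 1) i

/-- `J = e_{1n} l + b`, where `l` is the spectral parameter. -/
def J (n : ℕ) {R : Type*} [CommRing R] (l : R) : Matrix (Fin n) (Fin n) R :=
  l • e n R 1 n + b n R

/-- The first basis vector `e_1`. -/
def e1 (n : ℕ) (R : Type*) [CommRing R] : Fin n → R :=
  fun p => if p.val = 0 then 1 else 0

/-- The `i`-th coordinate of a vector, `1 ≤ i ≤ n`. -/
def coord {n : ℕ} (v : Fin n → ℝ) (i : ℕ) : ℝ :=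
  if h : 1 ≤ i ∧ i ≤ n then v ⟨i - 1, by omega⟩ else 0

/-- The `(i, n)` entry of a matrix, `1 ≤ i ≤ n`. -/
def coef {n : ℕ} (M : Matrix (Fin n) (Fin n) ℝ) (i : ℕ) : ℝ :=
  if h : 1 ≤ i ∧ i ≤ n then M ⟨i - 1, by omega⟩ ⟨n - 1, by omega⟩ else 0

/-- Membership in `V_n = ⨁_{i=1}^{n-1} ℝ e_{in}`. -/
def InV {n : ℕ} (M : Matrix (Fin n) (Fin n) ℝ) : Prop :=
  ∀ p q : Fin n, (q.val + 1 ≠ n ∨ p.val + 1 = n) → M p q = 0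

/-- The derivative in `x` of a matrix valued function of `(x, t)`. -/
def dx {n : ℕ} (M : ℝ → ℝ → Matrix (Fin n) (Fin n) ℝ) (x t : ℝ) : Matrix (Fin n) (Fin n) ℝ :=
  Matrix.of fun p q => deriv (fun s => M s t p q) x

/-- Smoothness, on a set `D` of pairs `(x, t)`, of a matrix valued function. -/
def SmoothMat {n : ℕ} (D : Set (ℝ × ℝ)) (M : ℝ → ℝ → Matrix (Fin n) (Fin n) ℝ) : Prop :=
  ∀ p q, ContDiffOn ℝ ∞ (fun z : ℝ × ℝ => M z.1 z.2 p q) D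

/-! Curves, moving frames and curvatures. -/

/-- The matrix `g = (γ, γ_x, …, γ_x^{(n-1)})`, given by its columns. -/
def frame {n : ℕ} (γ : ℝ → ℝ → Fin n → ℝ) (x t : ℝ) : Matrix (Fin n) (Fin n) ℝ :=
  Matrix.of fun p q => iteratedDeriv q.val (fun s => γ s t) x p

/-- `u = ∑_{i=1}^{n-1} u_i e_{in}`, where `u_i` is the determinant of the matrix which arises from
`g = (γ, γ_x, …, γ_x^{(n-1)})` if its `i`-th column is replaced by `γ_x^{(n)}`. -/
def curvature {n : ℕ} (γ : ℝ → ℝ → Fin n → ℝ) (x t : ℝ) : Matrix (Fin n) (Fin n) ℝ :=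
  Matrix.of fun p q => if q.val + 1 = n ∧ p.val + 1 ≠ n then
    ((frame γ x t).updateCol p (iteratedDeriv n (fun s => γ s t) x)).det else 0

/-! Formal Laurent series in `l⁻¹`. A matrix `∑_{i ≤ n₀} ξ_i l^i` with real `ξ_i` is a matrix with
entries in `LaurentSeries ℝ`, whose variable stands for `l⁻¹`. -/

/-- The spectral parameter as a formal Laurent series in its inverse. -/
def lam : LaurentSeries ℝ := HahnSeries.single (-1) 1

/-- The coefficient of `l^i`. -/
def lcoeff {n : ℕ} (Y : Matrix (Fin n) (Fin n) (LaurentSeries ℝ)) (i : ℤ) :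
    Matrix (Fin n) (Fin n) ℝ :=
  Y.map fun a => a.coeff (-i)

/-- `Y = Y(u, l)` on `D`: a formal series with coefficients in `sl(n, ℝ)` that depend smoothly on
`(x, t)`, with `[∂_x + J + u, Y] = 0` and `Y^n = l I`. These equations determine `Y` up to a
constant `n`-th root of unity, which is fixed by the leading term: `Y = J + ⋯`, where the dots are
terms `l^i e_{pq}` of principal degree `n i + p - q ≤ 0`. -/
structure IsY (n : ℕ) (D : Set (ℝ × ℝ)) (u : ℝ → ℝ → Matrix (Fin n) (Fin n) ℝ)
    (Y : ℝ → ℝ → Matrix (Fin n) (Fin n) (LaurentSeries ℝ)) : Prop where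
  smooth : ∀ i : ℤ, SmoothMat D fun x t => lcoeff (Y x t) i
  traceless : ∀ x t, (x, t) ∈ D → (Y x t).trace = 0
  leading : ∀ x t, (x, t) ∈ D → ∀ (i : ℤ) (p q : Fin n),
    1 ≤ (n : ℤ) * i + (p.val : ℤ) - (q.val : ℤ) →
      lcoeff (Y x t) i p q = lcoeff (J n lam) i p q
  lax : ∀ x t, (x, t) ∈ D → ∀ i : ℤ,
    dx (fun x t => lcoeff (Y x t) i) x t
      + lcoeff ⁅J n lam + (u x t).map (HahnSeries.C : ℝ →+* LaurentSeries ℝ), Y x t⁆ i = 0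
  pow : ∀ x t, (x, t) ∈ D → (Y x t) ^ n = lam • (1 : Matrix (Fin n) (Fin n) (LaurentSeries ℝ))

/-- `Z_{j,0} = Y_{j,0} - ζ`, where `Y_{j,0}` is the constant term of `Y^j`. -/
def Zzero {n : ℕ} (j : ℕ) (Y : ℝ → ℝ → Matrix (Fin n) (Fin n) (LaurentSeries ℝ))
    (ζ : ℝ → ℝ → Matrix (Fin n) (Fin n) ℝ) (x t : ℝ) : Matrix (Fin n) (Fin n) ℝ :=
  lcoeff (Y x t ^ j) 0 - ζ x t

/-- `Z_j(l) = (Y^j)_+ - ζ = ∑_{0 ≤ i ≤ [j/n]+1} Y_{j,i} l^i - ζ` at a complex number `l`. -/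
def Zeval {n : ℕ} (j : ℕ) (Y : ℝ → ℝ → Matrix (Fin n) (Fin n) (LaurentSeries ℝ))
    (ζ : ℝ → ℝ → Matrix (Fin n) (Fin n) ℝ) (x t : ℝ) (l : ℂ) : Matrix (Fin n) (Fin n) ℂ :=
  (∑ i ∈ Finset.range (j / n + 2), l ^ i • (lcoeff (Y x t ^ j) (i : ℤ)).map Complex.ofReal)
    - (ζ x t).map Complex.ofReal

/-- `Y = Y(u, l)` and `ζ = ζ_j(u)` on `D`: `ζ` is strictly upper triangular and
`[∂_x + b + u, Y_{j,0} - ζ]` has values in `V_n`. -/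
structure IsLaxData (n j : ℕ) (D : Set (ℝ × ℝ)) (u : ℝ → ℝ → Matrix (Fin n) (Fin n) ℝ)
    (Y : ℝ → ℝ → Matrix (Fin n) (Fin n) (LaurentSeries ℝ))
    (ζ : ℝ → ℝ → Matrix (Fin n) (Fin n) ℝ) : Prop where
  isY : IsY n D u Y
  smooth : SmoothMat D ζ
  upper : ∀ x t, (x, t) ∈ D → ∀ p q : Fin n, q ≤ p → ζ x t p q = 0
  inV : ∀ x t, (x, t) ∈ D →
    InV (dx (Zzero j Y ζ) x t + ⁅b n ℝ + u x t, Zzero j Y ζ x t⁆)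

/-- On the set `D`, `γ` is a smooth solution of the `j`-th central affine curve flow
`γ_t = g Z_{j,0}(u) e_1`, with `det g = 1`, where `g` is the moving frame and `u` the curvature of
`γ`, and where `Y = Y(u, l)`, `ζ = ζ_j(u)`, `Z_{j,0}(u) = Y_{j,0} - ζ`. -/
structure IsCurveFlowWith (n j : ℕ) (D : Set (ℝ × ℝ)) (γ : ℝ → ℝ → Fin n → ℝ)
    (Y : ℝ → ℝ → Matrix (Fin n) (Fin n) (LaurentSeries ℝ))
    (ζ : ℝ → ℝ → Matrix (Fin n) (Fin n) ℝ) : Prop where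
  smooth : ContDiffOn ℝ ∞ (fun z : ℝ × ℝ => γ z.1 z.2) D
  det_eq_one : ∀ x t, (x, t) ∈ D → (frame γ x t).det = 1
  laxData : IsLaxData n j D (curvature γ) Y ζ
  flow : ∀ x t, (x, t) ∈ D →
    HasDerivAt (fun s => γ x s) ((frame γ x t * Zzero j Y ζ x t).mulVec (e1 n ℝ)) t

/-- On the set `D`, `γ` is a solution of the `j`-th central affine curve flow. -/
def IsCurveFlow (n j : ℕ) (D : Set (ℝ × ℝ)) (γ : ℝ → ℝ → Fin n → ℝ) : Prop :=
  ∃ Y ζ, IsCurveFlowWith n j D γ Y ζ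

/-- `E(x, t, l)`, for `l` in `O`, is a frame of `u`: it is invertible, `E⁻¹ E_x = J + u`,
`E⁻¹ E_t = Z_j(u, l)` and `conj E(x, t, conj l) = E(x, t, l)`. Here `Y = Y(u, l)`, `ζ = ζ_j(u)`. -/
structure IsFrame (n j : ℕ) (u : ℝ → ℝ → Matrix (Fin n) (Fin n) ℝ)
    (Y : ℝ → ℝ → Matrix (Fin n) (Fin n) (LaurentSeries ℝ))
    (ζ : ℝ → ℝ → Matrix (Fin n) (Fin n) ℝ)
    (O : Set ℂ) (E : ℝ → ℝ → ℂ → Matrix (Fin n) (Fin n) ℂ) : Prop where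
  laxData : IsLaxData n j Set.univ u Y ζ
  smooth : ∀ l ∈ O, ∀ p q, ContDiff ℝ ∞ fun z : ℝ × ℝ => E z.1 z.2 l p q
  det_ne_zero : ∀ x t, ∀ l ∈ O, (E x t l).det ≠ 0
  eq_x : ∀ x t, ∀ l ∈ O, ∀ p q, HasDerivAt (fun s => E s t l p q)
    ((E x t l * (J n l + (u x t).map Complex.ofReal)) p q) x
  eq_t : ∀ x t, ∀ l ∈ O, ∀ p q, HasDerivAt (fun s => E x s l p q)
    ((E x t l * Zeval j Y ζ x t l) p q) t
  real : ∀ x t, ∀ l ∈ O, (starRingEnd ℂ) l ∈ O →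
    (E x t ((starRingEnd ℂ) l)).map (starRingEnd ℂ) = E x t l

/-- `E(x, t, l)` is holomorphic for `l` in `O`. -/
def IsHolo {n : ℕ} (O : Set ℂ) (E : ℝ → ℝ → ℂ → Matrix (Fin n) (Fin n) ℂ) : Prop :=
  ∀ x t p q, DifferentiableOn ℂ (fun l => E x t l p q) O

/-- `E_1 = ∂E/∂l` at `l = 0`. -/
def Eone {n : ℕ} (E : ℝ → ℝ → ℂ → Matrix (Fin n) (Fin n) ℂ) (x t : ℝ) :
    Matrix (Fin n) (Fin n) ℂ :=
  Matrix.of fun p q => deriv (fun l : ℂ => E x t l p q) 0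

/-! The Bäcklund transformation. -/

/-- The function `btCurv n u h k` is `ũ_{n-k} = u_{n-k} + s_{n-k}(u, h)`, for `1 ≤ k ≤ n - 1`, and
`0` for `k = 0`. For a matrix `f = J + h I + N` with `N` strictly upper triangular, the equation
`f_x = f (J + u) - (J + ũ) f` (which says that `E f⁻¹` is a frame in `x` of `ũ` if `E` is one of
`u`) determines the columns of `f` one by one, as in `btMatrix` below, and the entries
`n, n - 1, …, 2` of its last column are the recursion
`ũ_{i-1} = u_{i-1} + ∑_{m=i}^{n-1} C(m-1, i-1) u_m h^{(m-i)} - C(n, i-1) h^{(n-i+1)} - ũ_i' - ũ_i h`,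
here with `i = n - k`. -/
def btCurv (n : ℕ) (u : ℝ → ℝ → Matrix (Fin n) (Fin n) ℝ) (h : ℝ → ℝ → ℝ) : ℕ → ℝ → ℝ → ℝ
  | 0 => fun _ _ => 0
  | k + 1 => fun x t =>
      coef (u x t) (n - k - 1)
        + ∑ m ∈ Finset.Icc (n - k) (n - 1), ((m - 1).choose (n - k - 1) : ℝ) * coef (u x t) m
            * iteratedDeriv (m - (n - k)) (fun s => h s t) x
        - (n.choose (n - k - 1) : ℝ) * iteratedDeriv (k + 1) (fun s => h s t) x
        - deriv (fun s => btCurv n u h k s t) x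
        - btCurv n u h k x t * h x t

/-- `f_{u,h} = J + h I + N`, where `N` is strictly upper triangular,
`N_{ij} = C(j-1, i-1) h_x^{(j-i)}` for `i < j < n` and
`N_{in} = u_i + s_i(u, h) + C(n-1, i-1) h_x^{(n-i)}` for `i < n`. -/
def btMatrix (n : ℕ) (u : ℝ → ℝ → Matrix (Fin n) (Fin n) ℝ) (h : ℝ → ℝ → ℝ) (x t l : ℝ) :
    Matrix (Fin n) (Fin n) ℝ :=
  J n l + h x t • (1 : Matrix (Fin n) (Fin n) ℝ) + Matrix.of fun p q =>
    if p < q then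
      (q.val.choose p.val : ℝ) * iteratedDeriv (q.val - p.val) (fun s => h s t) x
        + (if q.val + 1 = n then btCurv n u h (n - (p.val + 1)) x t else 0)
    else 0

/-- The vector `(c_1, …, c_{n-1}, -1)^t`. -/
def cVec (n : ℕ) (c : ℕ → ℝ) : Fin n → ℝ :=
  fun p => if p.val + 1 = n then -1 else c (p.val + 1)

/-- `A = b + ∑_{i=1}^{n-1} c_i e_{i+1,n}`. -/
def Amat (n : ℕ) (c : ℕ → ℝ) : Matrix (Fin n) (Fin n) ℝ :=
  b n ℝ + ∑ i ∈ Finset.Icc 1 (n - 1), c i • e n ℝ (i + 1) n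

/-- `v = g⁻¹ (c_1, …, c_{n-1}, -1)^t`. -/
def vVec {n : ℕ} (γ : ℝ → ℝ → Fin n → ℝ) (c : ℕ → ℝ) (x t : ℝ) : Fin n → ℝ :=
  (frame γ x t)⁻¹.mulVec (cVec n c)

/-- The points where `h` is defined, that is, where `v_n ≠ 0`. -/
def btDomain {n : ℕ} (γ : ℝ → ℝ → Fin n → ℝ) (c : ℕ → ℝ) : Set (ℝ × ℝ) :=
  {z | coord (vVec γ c z.1 z.2) n ≠ 0}

/-- `h = -v_{n-1} / v_n`. -/
def hFun {n : ℕ} (γ : ℝ → ℝ → Fin n → ℝ) (c : ℕ → ℝ) (x t : ℝ) : ℝ :=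
  -(coord (vVec γ c x t) (n - 1) / coord (vVec γ c x t) n)

/-- `(e_{1n} g + A E_1) f_{u,h}^♯(x, t, 0) e_1`, where `♯` is the (transposed) cofactor matrix,
that is, `M M^♯ = det(M) I`. The matrix `E_1` is complex a priori. -/
def btCurve {n : ℕ} (γ : ℝ → ℝ → Fin n → ℝ) (E : ℝ → ℝ → ℂ → Matrix (Fin n) (Fin n) ℂ)
    (c : ℕ → ℝ) (x t : ℝ) : Fin n → ℂ :=
  (((e n ℝ 1 n * frame γ x t).map Complex.ofReal + (Amat n c).map Complex.ofReal * Eone E x t)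
    * ((btMatrix n (curvature γ) (hFun γ c) x t 0).adjugate).map Complex.ofReal).mulVec (e1 n ℂ)

/-! The vacuum. -/

/-- `γ = exp(b x + b^j t) e_1`. -/
def vacCurve (n j : ℕ) (x t : ℝ) : Fin n → ℝ :=
  (NormedSpace.exp (x • b n ℝ + t • b n ℝ ^ j)).mulVec (e1 n ℝ)

/-- `E = exp(x J + t J^j)`. -/
def vacFrame (n j : ℕ) (x t : ℝ) (l : ℂ) : Matrix (Fin n) (Fin n) ℂ :=
  NormedSpace.exp ((x : ℂ) • J n l + (t : ℂ) • J n l ^ j)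

end

end CentralAffine

open CentralAffine

namespace CentralAffine

noncomputable section

/-! The transformation is a Darboux dressing by f = f₀ + λe_{1n}. As f₀ is Hessenberg with unit
subdiagonal, det f = det f₀ + (-1)^{n-1}λ. The function h is chosen so that f₀ becomes singular with
kernel spanned by v = g⁻¹(c₁,…,c_{n-1},-1)ᵗ. Then f⁻¹ = B + λ⁻¹F, where F is up to sign the adjugate
of f₀ and its columns are multiples of v (`dressInv_of_det_eq_zero`, `exists_eq_mul_of_hessenberg`).

In x the required equation is f_x = f(J+u) - (J+ũ)f. The binomial coefficients and the recursion for
ũ give all its entries except the upper right one. That last defect vanishes because f₀v = 0, which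
itself follows from v_x = -(b+u)v and the choice of h (`btMatrix_mulVec_eq_zero_and_dx`).
Consequently fYf⁻¹ is the series Y(ũ) (`IsDressing.isY`).

In t put T = (fZ_j - f_t)f⁻¹. Its only possible pole is at λ = 0, with residue (f₀Z_{j,0} - ∂_t
f₀)F, and differentiating f₀v = 0 along v_t = -Z_{j,0}v shows that this is zero. Counting principal
degrees, for which J is homogeneous of degree 1, shows that the λ⁰ coefficient of (fYf⁻¹)^j - T is
strictly upper triangular. So the λ⁰ coefficient T₀ of T is a candidate for Z_{j,0}(ũ)
(`IsDressing.exists_laxData`).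

The new frame is (A + λe_{1n})Ef⁻¹. Its residue at 0 is AgF, which vanishes since A kills gv =
(c₁,…,c_{n-1},-1)ᵗ. Its value there, g̃ = (e_{1n}g + AE₁)F + AgB, satisfies g̃_x = g̃(b+ũ) and g̃_t
= g̃T₀ (`HasMatDeriv.dressed`) and has determinant 1 (`det_dressed`). As B is strictly upper
triangular, the first column of g̃ is γ̃ up to the sign (-1)^{n-1}. A matrix solving the x-equation
is the moving frame of its first column (`frame_and_curvature_of_hasMatDeriv`), and `zero_curvature`
supplies the V_n condition that pins down T₀. Only the 1-jet of E at λ = 0 enters; its equations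
come from differentiating the linear system in λ (`hasDerivAt_deriv_param`).

The set D is dense because v_n = 0 on an open set would force v = 0 there through v_x = -(b+u)v. For
the vacuum, g is the exponential of a nilpotent matrix, hence polynomial. The matrix E₁ is
polynomial since E₁g⁻¹ has polynomial partial derivatives, and polynomials divided by powers of v_n
are closed under all operations that build γ̃. -/

/-- Smoothness, on a set `D` of pairs `(x, t)`, of a real function. -/
def SmoothFun (D : Set (ℝ × ℝ)) (h : ℝ → ℝ → ℝ) : Prop :=
  ContDiffOn ℝ ∞ (fun z : ℝ × ℝ => h z.1 z.2) D

/-! ### Calculus of smooth functions of two real variables -/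

section Smooth

variable {D : Set (ℝ × ℝ)} {h k : ℝ → ℝ → ℝ}

theorem SmoothFun.congr (hh : SmoothFun D h) (e : ∀ x t, (x, t) ∈ D → k x t = h x t) :
    SmoothFun D k :=
  ContDiffOn.congr hh fun z hz => e z.1 z.2 hz

theorem SmoothFun.mono {D' : Set (ℝ × ℝ)} (hh : SmoothFun D h) (hs : D' ⊆ D) : SmoothFun D' h :=
  ContDiffOn.mono hh hs

theorem SmoothFun.const (c : ℝ) : SmoothFun D fun _ _ => c := contDiffOn_const

theorem SmoothFun.add (hh : SmoothFun D h) (hk : SmoothFun D k) :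
    SmoothFun D fun x t => h x t + k x t := ContDiffOn.add hh hk

theorem SmoothFun.sub (hh : SmoothFun D h) (hk : SmoothFun D k) :
    SmoothFun D fun x t => h x t - k x t := ContDiffOn.sub hh hk

theorem SmoothFun.neg (hh : SmoothFun D h) : SmoothFun D fun x t => -h x t := ContDiffOn.neg hh

theorem SmoothFun.mul (hh : SmoothFun D h) (hk : SmoothFun D k) :
    SmoothFun D fun x t => h x t * k x t := ContDiffOn.mul hh hk

theorem SmoothFun.div (hh : SmoothFun D h) (hk : SmoothFun D k)
    (h0 : ∀ x t, (x, t) ∈ D → k x t ≠ 0) : SmoothFun D fun x t => h x t / k x t :=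
  ContDiffOn.div hh hk fun z hz => h0 z.1 z.2 hz

theorem SmoothFun.sum {ι : Type*} {s : Finset ι} {f : ι → ℝ → ℝ → ℝ}
    (hf : ∀ i ∈ s, SmoothFun D (f i)) : SmoothFun D fun x t => ∑ i ∈ s, f i x t :=
  ContDiffOn.sum (f := fun i (z : ℝ × ℝ) => f i z.1 z.2) hf

theorem SmoothFun.prod {ι : Type*} {s : Finset ι} {f : ι → ℝ → ℝ → ℝ}
    (hf : ∀ i ∈ s, SmoothFun D (f i)) : SmoothFun D fun x t => ∏ i ∈ s, f i x t :=
  contDiffOn_prod (f := fun i (z : ℝ × ℝ) => f i z.1 z.2) hf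

theorem SmoothFun.differentiableAt (hh : SmoothFun D h) (hD : IsOpen D) {x t : ℝ}
    (hm : (x, t) ∈ D) : DifferentiableAt ℝ (fun z : ℝ × ℝ => h z.1 z.2) (x, t) :=
  (ContDiffOn.contDiffAt hh (hD.mem_nhds hm)).differentiableAt (by simp)

theorem hasDerivAt_fst_of_hasFDerivAt {f : ℝ × ℝ → ℝ} {f' : ℝ × ℝ →L[ℝ] ℝ} {x t : ℝ}
    (hf : HasFDerivAt f f' (x, t)) : HasDerivAt (fun s => f (s, t)) (f' (1, 0)) x :=
  hf.comp_hasDerivAt x ((hasDerivAt_id x).prodMk (hasDerivAt_const x t))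

theorem hasDerivAt_snd_of_hasFDerivAt {f : ℝ × ℝ → ℝ} {f' : ℝ × ℝ →L[ℝ] ℝ} {x t : ℝ}
    (hf : HasFDerivAt f f' (x, t)) : HasDerivAt (fun s => f (x, s)) (f' (0, 1)) t :=
  hf.comp_hasDerivAt t ((hasDerivAt_const t x).prodMk (hasDerivAt_id t))

theorem SmoothFun.hasDerivAt_fst (hh : SmoothFun D h) (hD : IsOpen D) {x t : ℝ}
    (hm : (x, t) ∈ D) : HasDerivAt (fun s => h s t) (deriv (fun s => h s t) x) x :=
  (hasDerivAt_fst_of_hasFDerivAt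
    (hh.differentiableAt hD hm).hasFDerivAt).differentiableAt.hasDerivAt

theorem SmoothFun.hasDerivAt_snd (hh : SmoothFun D h) (hD : IsOpen D) {x t : ℝ}
    (hm : (x, t) ∈ D) : HasDerivAt (fun s => h x s) (deriv (fun s => h x s) t) t :=
  (hasDerivAt_snd_of_hasFDerivAt
    (hh.differentiableAt hD hm).hasFDerivAt).differentiableAt.hasDerivAt

theorem SmoothFun.deriv_fst_eq (hh : SmoothFun D h) (hD : IsOpen D) {x t : ℝ}
    (hm : (x, t) ∈ D) :
    deriv (fun s => h s t) x = fderiv ℝ (fun z : ℝ × ℝ => h z.1 z.2) (x, t) (1, 0) :=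
  (hasDerivAt_fst_of_hasFDerivAt (hh.differentiableAt hD hm).hasFDerivAt).deriv

theorem SmoothFun.deriv_snd_eq (hh : SmoothFun D h) (hD : IsOpen D) {x t : ℝ}
    (hm : (x, t) ∈ D) :
    deriv (fun s => h x s) t = fderiv ℝ (fun z : ℝ × ℝ => h z.1 z.2) (x, t) (0, 1) :=
  (hasDerivAt_snd_of_hasFDerivAt (hh.differentiableAt hD hm).hasFDerivAt).deriv

theorem SmoothFun.contDiffOn_fderiv (hh : SmoothFun D h) (hD : IsOpen D) :
    ContDiffOn ℝ ∞ (fderiv ℝ (fun z : ℝ × ℝ => h z.1 z.2)) D :=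
  ContDiffOn.fderiv_of_isOpen hh hD (by simp)

theorem SmoothFun.deriv_fst (hh : SmoothFun D h) (hD : IsOpen D) :
    SmoothFun D fun x t => deriv (fun s => h s t) x :=
  ContDiffOn.congr ((hh.contDiffOn_fderiv hD).clm_apply contDiffOn_const)
    fun _ hz => hh.deriv_fst_eq hD hz

theorem SmoothFun.deriv_snd (hh : SmoothFun D h) (hD : IsOpen D) :
    SmoothFun D fun x t => deriv (fun s => h x s) t :=
  ContDiffOn.congr ((hh.contDiffOn_fderiv hD).clm_apply contDiffOn_const)
    fun _ hz => hh.deriv_snd_eq hD hz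

theorem SmoothFun.iteratedDeriv (hh : SmoothFun D h) (hD : IsOpen D) (m : ℕ) :
    SmoothFun D fun x t => iteratedDeriv m (fun s => h s t) x := by
  induction m with
  | zero => simpa using hh
  | succ m ih => simpa only [iteratedDeriv_succ] using ih.deriv_fst hD

theorem eventually_fst_mem (hD : IsOpen D) {x t : ℝ} (hm : (x, t) ∈ D) :
    ∀ᶠ s in nhds x, (s, t) ∈ D :=
  (by fun_prop : Continuous fun s : ℝ => (s, t)).continuousAt.eventually (hD.mem_nhds hm)

theorem eventually_snd_mem (hD : IsOpen D) {x t : ℝ} (hm : (x, t) ∈ D) :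
    ∀ᶠ s in nhds t, (x, s) ∈ D :=
  (by fun_prop : Continuous fun s : ℝ => (x, s)).continuousAt.eventually (hD.mem_nhds hm)

/-- Both iterated partials are values of the second Fréchet derivative on the two basis vectors, so
its symmetry suffices. -/
theorem SmoothFun.deriv_comm (hh : SmoothFun D h) (hD : IsOpen D) {x t : ℝ} (hm : (x, t) ∈ D) :
    deriv (fun s => deriv (fun r => h r s) x) t = deriv (fun r => deriv (fun s => h r s) t) x := by
  have hd : DifferentiableAt ℝ (fderiv ℝ fun z : ℝ × ℝ => h z.1 z.2) (x, t) :=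
    ((hh.contDiffOn_fderiv hD).contDiffAt (hD.mem_nhds hm)).differentiableAt (by simp)
  have hs : IsSymmSndFDerivAt ℝ (fun z : ℝ × ℝ => h z.1 z.2) (x, t) :=
    (ContDiffOn.contDiffAt hh (hD.mem_nhds hm)).isSymmSndFDerivAt
      (by simpa using ENat.LEInfty.out)
  have e1 : deriv (fun s => deriv (fun r => h r s) x) t
      = fderiv ℝ (fderiv ℝ fun z : ℝ × ℝ => h z.1 z.2) (x, t) (0, 1) (1, 0) := by
    rw [Filter.EventuallyEq.deriv_eq
      ((eventually_snd_mem hD hm).mono fun s hs => hh.deriv_fst_eq hD hs)]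
    exact (hasDerivAt_snd_of_hasFDerivAt
      (hd.hasFDerivAt.clm_apply (hasFDerivAt_const ((1 : ℝ), (0 : ℝ)) (x, t)))).deriv.trans (by simp)
  have e2 : deriv (fun r => deriv (fun s => h r s) t) x
      = fderiv ℝ (fderiv ℝ fun z : ℝ × ℝ => h z.1 z.2) (x, t) (1, 0) (0, 1) := by
    rw [Filter.EventuallyEq.deriv_eq
      ((eventually_fst_mem hD hm).mono fun s hs => hh.deriv_snd_eq hD hs)]
    exact (hasDerivAt_fst_of_hasFDerivAt
      (hd.hasFDerivAt.clm_apply (hasFDerivAt_const ((0 : ℝ), (1 : ℝ)) (x, t)))).deriv.trans (by simp)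
  rw [e1, e2, hs.eq]

/-- A function with smooth partial derivatives is smooth. -/
theorem SmoothFun.of_partial {p q : ℝ → ℝ → ℝ} (hp : SmoothFun Set.univ p)
    (hq : SmoothFun Set.univ q) (hx : ∀ x t, HasDerivAt (fun s => h s t) (p x t) x)
    (ht : ∀ x t, HasDerivAt (fun s => h x s) (q x t) t) : SmoothFun Set.univ h := by
  have hp' : ContDiff ℝ ∞ fun z : ℝ × ℝ => p z.1 z.2 := contDiffOn_univ.1 hp
  have hq' : ContDiff ℝ ∞ fun z : ℝ × ℝ => q z.1 z.2 := contDiffOn_univ.1 hq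
  have hd : ∀ z : ℝ × ℝ, HasFDerivAt (fun z : ℝ × ℝ => h z.1 z.2)
      (p z.1 z.2 • ContinuousLinearMap.fst ℝ ℝ ℝ + q z.1 z.2 • ContinuousLinearMap.snd ℝ ℝ ℝ) z := by
    intro z
    -- Continuous partial derivatives give differentiability; once the differential is known in
    -- terms of p and q, its smoothness gives that of h.
    have key := (hasStrictFDerivAt_uncurry_coprod (𝕜 := ℝ) (f := h) (u := z)
      (f₁ := fun x t => (1 : ℝ →L[ℝ] ℝ).smulRight (p x t))
      (f₂ := fun x t => (1 : ℝ →L[ℝ] ℝ).smulRight (q x t))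
      (Filter.Eventually.of_forall fun v => (hx v.1 v.2).hasFDerivAt)
      (Filter.Eventually.of_forall fun v => (ht v.1 v.2).hasFDerivAt)
      (((ContinuousLinearMap.smulRightL ℝ ℝ ℝ 1).continuous.comp hp'.continuous).continuousAt)
      (((ContinuousLinearMap.smulRightL ℝ ℝ ℝ 1).continuous.comp
        hq'.continuous).continuousAt)).hasFDerivAt
    refine key.congr_fderiv ?_
    ext <;> simp [Function.HasUncurry.uncurry]
  refine contDiffOn_univ.2 ?_
  rw [contDiff_infty_iff_fderiv]
  refine ⟨fun z => (hd z).differentiableAt, ?_⟩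
  rw [funext fun z => (hd z).fderiv]
  exact (hp'.smul contDiff_const).add (hq'.smul contDiff_const)

end Smooth

/-- `M'` is the entrywise derivative at `s` of the matrix valued function `M`. -/
def HasMatDeriv {n : ℕ} {A : Type*} [NormedRing A] [NormedAlgebra ℝ A]
    (M : ℝ → Matrix (Fin n) (Fin n) A) (M' : Matrix (Fin n) (Fin n) A) (s : ℝ) : Prop :=
  ∀ p q, HasDerivAt (fun r => M r p q) (M' p q) s

/-! ### Entrywise derivatives of matrix functions -/

section MatDeriv

variable {n : ℕ} {A : Type*} [NormedRing A] [NormedAlgebra ℝ A]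
  {M N : ℝ → Matrix (Fin n) (Fin n) A} {M' N' : Matrix (Fin n) (Fin n) A} {s : ℝ}

theorem HasMatDeriv.const (C : Matrix (Fin n) (Fin n) A) (s : ℝ) :
    HasMatDeriv (fun _ => C) 0 s := fun p q => hasDerivAt_const s (C p q)

theorem HasMatDeriv.add (hM : HasMatDeriv M M' s) (hN : HasMatDeriv N N' s) :
    HasMatDeriv (fun r => M r + N r) (M' + N') s := fun p q => (hM p q).add (hN p q)

theorem HasMatDeriv.mul (hM : HasMatDeriv M M' s) (hN : HasMatDeriv N N' s) :
    HasMatDeriv (fun r => M r * N r) (M' * N s + M s * N') s := by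
  intro p q
  simp only [Matrix.mul_apply, Matrix.add_apply, ← Finset.sum_add_distrib]
  exact HasDerivAt.fun_sum fun k _ => (hM p k).mul (hN k q)

theorem HasMatDeriv.const_mul (C : Matrix (Fin n) (Fin n) A) (hM : HasMatDeriv M M' s) :
    HasMatDeriv (fun r => C * M r) (C * M') s := by
  simpa using (HasMatDeriv.const C s).mul hM

theorem HasMatDeriv.congr (hM : HasMatDeriv M M' s) (h : ∀ᶠ r in nhds s, N r = M r) :
    HasMatDeriv N M' s := fun p q =>
  (hM p q).congr_of_eventuallyEq (h.mono fun r hr => by simp only [hr])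

theorem HasMatDeriv.unique (hM : HasMatDeriv M M' s) (hN : HasMatDeriv M N' s) : M' = N' :=
  Matrix.ext fun p q => (hM p q).unique (hN p q)

theorem HasMatDeriv.mulVec {v : ℝ → Fin n → A} {v' : Fin n → A} (hM : HasMatDeriv M M' s)
    (hv : ∀ p, HasDerivAt (fun r => v r p) (v' p) s) (p : Fin n) :
    HasDerivAt (fun r => (M r).mulVec (v r) p) ((M'.mulVec (v s) + (M s).mulVec v') p) s := by
  simp only [Matrix.mulVec, dotProduct, Pi.add_apply, ← Finset.sum_add_distrib]
  exact HasDerivAt.fun_sum fun k _ => (hM p k).mul (hv k)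

/-- The derivative of a determinant is the sum over the columns. -/
theorem HasMatDeriv.det {n : ℕ} {M : ℝ → Matrix (Fin n) (Fin n) ℝ}
    {M' : Matrix (Fin n) (Fin n) ℝ} {s : ℝ} (hM : HasMatDeriv M M' s) :
    HasDerivAt (fun r => (M r).det) (∑ k, ((M s).updateCol k fun p => M' p k).det) s := by
  simp only [Matrix.det_apply']
  rw [Finset.sum_comm]
  refine HasDerivAt.fun_sum fun σ _ => ?_
  rw [← Finset.mul_sum]
  refine HasDerivAt.const_mul _ ?_
  refine (HasDerivAt.fun_finsetProd (u := Finset.univ)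
    fun i _ => hM (σ i) i).congr_deriv ?_
  refine Finset.sum_congr rfl fun k _ => ?_
  rw [← Finset.prod_erase_mul _ _ (Finset.mem_univ k), smul_eq_mul]
  congr 1
  · refine Finset.prod_congr rfl fun i hi => ?_
    simp [(Finset.mem_erase.1 hi).1]
  · simp

/-- The derivative of an inverse. -/
theorem HasMatDeriv.inv_eq {Z : Matrix (Fin n) (Fin n) A} (h1 : ∀ r, N r * M r = 1)
    (h2 : M s * N s = 1) (hM : HasMatDeriv M (M s * Z) s) (hN : HasMatDeriv N N' s) :
    N' = -(Z * N s) := by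
  have h := (hN.mul hM).unique ((HasMatDeriv.const 1 s).congr (Filter.Eventually.of_forall h1))
  have h3 : (N' * M s + N s * (M s * Z)) * N s = 0 := by rw [h, zero_mul]
  rw [add_mul, mul_assoc, h2, mul_one, ← mul_assoc, h1, one_mul] at h3
  exact eq_neg_of_add_eq_zero_left h3

end MatDeriv

/-! ### Smooth matrix functions, partial derivatives and zero curvature -/

section SmoothMat

variable {n : ℕ} {D : Set (ℝ × ℝ)} {M N : ℝ → ℝ → Matrix (Fin n) (Fin n) ℝ}

theorem SmoothMat.entry (hM : SmoothMat D M) (p q : Fin n) :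
    SmoothFun D fun x t => M x t p q := hM p q

theorem SmoothMat.mono {D' : Set (ℝ × ℝ)} (hM : SmoothMat D M) (h : D' ⊆ D) : SmoothMat D' M :=
  fun p q => (hM.entry p q).mono h

theorem SmoothMat.congr (hM : SmoothMat D M) (h : ∀ x t, (x, t) ∈ D → N x t = M x t) :
    SmoothMat D N := fun p q =>
  ContDiffOn.congr (hM p q) fun z hz => by rw [h z.1 z.2 hz]

theorem SmoothMat.const (C : Matrix (Fin n) (Fin n) ℝ) : SmoothMat D fun _ _ => C :=
  fun p q => SmoothFun.const (C p q)

theorem SmoothMat.add (hM : SmoothMat D M) (hN : SmoothMat D N) :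
    SmoothMat D fun x t => M x t + N x t := fun p q => (hM.entry p q).add (hN.entry p q)

theorem SmoothMat.sub (hM : SmoothMat D M) (hN : SmoothMat D N) :
    SmoothMat D fun x t => M x t - N x t := fun p q => (hM.entry p q).sub (hN.entry p q)

theorem SmoothMat.mul (hM : SmoothMat D M) (hN : SmoothMat D N) :
    SmoothMat D fun x t => M x t * N x t := fun p q => by
  simp only [Matrix.mul_apply]
  exact SmoothFun.sum fun k _ => (hM.entry p k).mul (hN.entry k q)

theorem SmoothMat.const_smul (c : ℝ) (hM : SmoothMat D M) : SmoothMat D fun x t => c • M x t :=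
  fun p q => (SmoothFun.const c).mul (hM.entry p q)

theorem SmoothMat.det (hM : SmoothMat D M) : SmoothFun D fun x t => (M x t).det := by
  simp only [Matrix.det_apply']
  exact SmoothFun.sum fun σ _ => (SmoothFun.const _).mul (SmoothFun.prod fun i _ => hM.entry _ i)

theorem SmoothMat.adjugate (hM : SmoothMat D M) : SmoothMat D fun x t => (M x t).adjugate :=
  fun p q => by
  simp only [Matrix.adjugate_apply]
  refine SmoothMat.det (M := fun x t => (M x t).updateRow q (Pi.single p 1)) fun i j => ?_
  by_cases h : i = q
  · subst h
    simpa using contDiffOn_const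
  · simpa [Matrix.updateRow_apply, h] using hM i j

theorem SmoothMat.mulVec (hM : SmoothMat D M) {v : ℝ → ℝ → Fin n → ℝ}
    (hv : ∀ p, SmoothFun D fun x t => v x t p) (p : Fin n) :
    SmoothFun D fun x t => (M x t).mulVec (v x t) p := by
  simp only [Matrix.mulVec, dotProduct]
  exact SmoothFun.sum fun k _ => (hM.entry p k).mul (hv k)

/-- The derivative in `t` of a matrix valued function of `(x, t)`. -/
def dt (M : ℝ → ℝ → Matrix (Fin n) (Fin n) ℝ) (x t : ℝ) : Matrix (Fin n) (Fin n) ℝ :=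
  Matrix.of fun p q => deriv (fun s => M x s p q) t

theorem SmoothMat.hasMatDeriv_dx (hM : SmoothMat D M) (hD : IsOpen D) {x t : ℝ}
    (hm : (x, t) ∈ D) : HasMatDeriv (fun s => M s t) (dx M x t) x :=
  fun p q => (hM.entry p q).hasDerivAt_fst hD hm

theorem SmoothMat.hasMatDeriv_dt (hM : SmoothMat D M) (hD : IsOpen D) {x t : ℝ}
    (hm : (x, t) ∈ D) : HasMatDeriv (fun s => M x s) (dt M x t) t :=
  fun p q => (hM.entry p q).hasDerivAt_snd hD hm

theorem SmoothMat.dt (hM : SmoothMat D M) (hD : IsOpen D) : SmoothMat D (dt M) :=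
  fun p q => (hM.entry p q).deriv_snd hD

theorem dx_eq_of_hasMatDeriv {M' : Matrix (Fin n) (Fin n) ℝ} {x t : ℝ}
    (h : HasMatDeriv (fun s => M s t) M' x) : CentralAffine.dx M x t = M' :=
  Matrix.ext fun p q => (h p q).deriv

theorem dt_eq_of_hasMatDeriv {M' : Matrix (Fin n) (Fin n) ℝ} {x t : ℝ}
    (h : HasMatDeriv (fun s => M x s) M' t) : CentralAffine.dt M x t = M' :=
  Matrix.ext fun p q => (h p q).deriv

theorem SmoothMat.dt_dx (hM : SmoothMat D M) (hD : IsOpen D) {x t : ℝ} (hm : (x, t) ∈ D) :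
    CentralAffine.dt (CentralAffine.dx M) x t = CentralAffine.dx (CentralAffine.dt M) x t :=
  Matrix.ext fun p q => (hM.entry p q).deriv_comm hD hm

theorem dx_congr {x t : ℝ} (hD : IsOpen D) (hm : (x, t) ∈ D)
    (h : ∀ x t, (x, t) ∈ D → N x t = M x t) : CentralAffine.dx N x t = CentralAffine.dx M x t :=
  Matrix.ext fun p q => Filter.EventuallyEq.deriv_eq
    ((eventually_fst_mem hD hm).mono fun s hs => by simp only [h s t hs])

theorem dt_congr {x t : ℝ} (hD : IsOpen D) (hm : (x, t) ∈ D)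
    (h : ∀ x t, (x, t) ∈ D → N x t = M x t) : CentralAffine.dt N x t = CentralAffine.dt M x t :=
  Matrix.ext fun p q => Filter.EventuallyEq.deriv_eq
    ((eventually_snd_mem hD hm).mono fun s hs => by simp only [h x s hs])

end SmoothMat

/-- The zero curvature condition for a frame with logarithmic derivatives `X` and `T`. -/
theorem zero_curvature {n : ℕ} {D : Set (ℝ × ℝ)} (hD : IsOpen D)
    {g X T : ℝ → ℝ → Matrix (Fin n) (Fin n) ℝ} (hg : SmoothMat D g) (hX : SmoothMat D X)
    (hT : SmoothMat D T) (hdet : ∀ x t, (x, t) ∈ D → IsUnit (g x t).det)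
    (hgx : ∀ x t, (x, t) ∈ D → HasMatDeriv (fun s => g s t) (g x t * X x t) x)
    (hgt : ∀ x t, (x, t) ∈ D → HasMatDeriv (fun s => g x s) (g x t * T x t) t)
    {x t : ℝ} (hm : (x, t) ∈ D) : dx T x t + ⁅X x t, T x t⁆ = dt X x t := by
  have h1 : dt (dx g) x t = g x t * T x t * X x t + g x t * dt X x t :=
    (dt_congr hD hm fun x t h => dx_eq_of_hasMatDeriv (hgx x t h)).trans
      (dt_eq_of_hasMatDeriv ((hgt x t hm).mul (hX.hasMatDeriv_dt hD hm)))
  have h2 : dx (dt g) x t = g x t * X x t * T x t + g x t * dx T x t :=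
    (dx_congr hD hm fun x t h => dt_eq_of_hasMatDeriv (hgt x t h)).trans
      (dx_eq_of_hasMatDeriv ((hgx x t hm).mul (hT.hasMatDeriv_dx hD hm)))
  have h3 := hg.dt_dx hD hm
  rw [h1, h2] at h3
  have h4 : g x t * (dx T x t + ⁅X x t, T x t⁆) = g x t * dt X x t := by
    rw [Ring.lie_def, mul_add, mul_sub, ← mul_assoc, ← mul_assoc]
    have := sub_eq_zero.2 h3
    rw [← sub_eq_zero, ← neg_eq_zero, ← this]
    abel
  have h5 := congrArg ((g x t)⁻¹ * ·) h4
  simpa [← mul_assoc, Matrix.nonsing_inv_mul _ (hdet x t hm)] using h5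

/-! ### Multiplication by the matrices b and e_{1n} -/

section Entries

variable {n : ℕ} {R : Type*} [CommRing R]

theorem e_apply (i j : ℕ) (p q : Fin n) :
    e n R i j p q = if p.val + 1 = i ∧ q.val + 1 = j then 1 else 0 := rfl

theorem b_apply (p q : Fin n) : b n R p q = if p.val = q.val + 1 then 1 else 0 := by
  have h := p.isLt
  rw [b, Matrix.sum_apply]
  simp only [e_apply]
  rw [Finset.sum_eq_single (q.val + 1)]
  · simp
  · intro i _ hi
    rw [if_neg (by omega)]
  · intro hi
    rw [if_neg]
    rw [Finset.mem_Icc] at hi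
    omega

theorem mul_b_apply (M : Matrix (Fin n) (Fin n) R) (p q : Fin n) :
    (M * b n R) p q = if h : q.val + 1 < n then M p ⟨q.val + 1, h⟩ else 0 := by
  simp only [Matrix.mul_apply, b_apply]
  split_ifs with h
  · rw [Finset.sum_eq_single ⟨q.val + 1, h⟩]
    · simp
    · intro k _ hk
      rw [if_neg fun h => hk (Fin.ext h), mul_zero]
    · simp
  · refine Finset.sum_eq_zero fun k _ => ?_
    rw [if_neg (by omega), mul_zero]

theorem b_mul_apply (M : Matrix (Fin n) (Fin n) R) (p q : Fin n) :
    (b n R * M) p q = if h : 0 < p.val then M ⟨p.val - 1, by omega⟩ q else 0 := by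
  simp only [Matrix.mul_apply, b_apply]
  split_ifs with h
  · rw [Finset.sum_eq_single ⟨p.val - 1, by omega⟩]
    · rw [if_pos (Nat.sub_add_cancel h).symm, one_mul]
    · intro k _ hk
      rw [if_neg, zero_mul]
      contrapose! hk
      ext
      simp; omega
    · simp
  · refine Finset.sum_eq_zero fun k _ => ?_
    rw [if_neg (by omega), zero_mul]

theorem b_mulVec_apply (v : Fin n → R) (p : Fin n) :
    (b n R).mulVec v p = if h : 0 < p.val then v ⟨p.val - 1, by omega⟩ else 0 := by
  have := b_mul_apply (Matrix.of fun i _ => v i : Matrix (Fin n) (Fin n) R) p p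
  simpa [Matrix.mul_apply, Matrix.mulVec, dotProduct] using this

theorem mul_e_apply (hn : 0 < n) (M : Matrix (Fin n) (Fin n) R) (p q : Fin n) :
    (M * e n R 1 n) p q = if q.val + 1 = n then M p ⟨0, hn⟩ else 0 := by
  simp only [Matrix.mul_apply, e_apply]
  rw [Finset.sum_eq_single ⟨0, hn⟩]
  · simp
  · intro k _ hk
    rw [if_neg, mul_zero]
    rintro ⟨h, -⟩
    exact hk (Fin.ext (by simpa using h))
  · simp

theorem e_mul_apply (hn : 0 < n) (M : Matrix (Fin n) (Fin n) R) (p q : Fin n) :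
    (e n R 1 n * M) p q = if p.val = 0 then M ⟨n - 1, by omega⟩ q else 0 := by
  simp only [Matrix.mul_apply, e_apply]
  rw [Finset.sum_eq_single ⟨n - 1, by omega⟩]
  · simp [Nat.sub_add_cancel hn]
  · intro k _ hk
    rw [if_neg, zero_mul]
    rintro ⟨-, h⟩
    exact hk (Fin.ext (by simp; omega))
  · simp

theorem mulVec_e1_apply (hn : 0 < n) (M : Matrix (Fin n) (Fin n) R) (p : Fin n) :
    M.mulVec (e1 n R) p = M p ⟨0, hn⟩ := by
  simp only [Matrix.mulVec, dotProduct, e1]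
  rw [Finset.sum_eq_single ⟨0, hn⟩]
  · simp
  · intro k _ hk
    rw [if_neg, mul_zero]
    exact fun h => hk (Fin.ext h)
  · simp

/-- A matrix in `V_n` multiplied from the left. -/
theorem mul_inV_apply {n : ℕ} {U : Matrix (Fin n) (Fin n) ℝ} (hU : InV U)
    (M : Matrix (Fin n) (Fin n) ℝ) (p q : Fin n) (hq : q.val + 1 ≠ n) : (M * U) p q = 0 := by
  rw [Matrix.mul_apply]
  exact Finset.sum_eq_zero fun k _ => by rw [hU k q (Or.inl hq), mul_zero]

end Entries

/-! ### The moving frame and its equations in x and t -/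

section Frame

variable {n : ℕ} {D : Set (ℝ × ℝ)} {γ : ℝ → ℝ → Fin n → ℝ}

theorem curvature_inV (γ : ℝ → ℝ → Fin n → ℝ) (x t : ℝ) : InV (curvature γ x t) := by
  intro p q h
  rw [curvature, Matrix.of_apply, if_neg]
  rintro ⟨h1, h2⟩
  exact h.elim (fun h => h h1) h2

theorem smoothFun_coord (hγ : ContDiffOn ℝ ∞ (fun z : ℝ × ℝ => γ z.1 z.2) D) (p : Fin n) :
    SmoothFun D fun x t => γ x t p := contDiffOn_pi.1 hγ p

/-- The frame is built from derivatives of a vector-valued curve, while the smoothness calculus is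
scalar. Openness of D makes the identity hold near x, so that the induction can differentiate it. -/
theorem iteratedDeriv_coord (hγ : ContDiffOn ℝ ∞ (fun z : ℝ × ℝ => γ z.1 z.2) D)
    (hD : IsOpen D) (m : ℕ) {x t : ℝ} (hm : (x, t) ∈ D) (p : Fin n) :
      iteratedDeriv m (fun s => γ s t) x p = iteratedDeriv m (fun s => γ s t p) x := by
  induction m generalizing x p with
  | zero => simp
  | succ m ih =>
    rw [iteratedDeriv_succ, iteratedDeriv_succ]
    have hd : ∀ q, HasDerivAt (fun s => iteratedDeriv m (fun s => γ s t) s q)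
        (deriv (iteratedDeriv m fun s => γ s t q) x) x := fun q =>
      (((smoothFun_coord hγ q).iteratedDeriv hD m).hasDerivAt_fst hD hm).congr_of_eventuallyEq
        ((eventually_fst_mem hD hm).mono fun s hs => ih hs q)
    exact congrFun (hasDerivAt_pi.2 hd).deriv p

theorem frame_apply (hγ : ContDiffOn ℝ ∞ (fun z : ℝ × ℝ => γ z.1 z.2) D)
    (hD : IsOpen D) {x t : ℝ} (hm : (x, t) ∈ D) (p q : Fin n) :
    frame γ x t p q = iteratedDeriv q.val (fun s => γ s t p) x :=
  iteratedDeriv_coord hγ hD q.val hm p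

theorem smoothMat_frame (hγ : ContDiffOn ℝ ∞ (fun z : ℝ × ℝ => γ z.1 z.2) D)
    (hD : IsOpen D) : SmoothMat D (frame γ) := fun p q =>
  ((smoothFun_coord hγ p).iteratedDeriv hD q.val).congr fun _ _ hm => frame_apply hγ hD hm p q

theorem smoothMat_curvature (hγ : ContDiffOn ℝ ∞ (fun z : ℝ × ℝ => γ z.1 z.2) D)
    (hD : IsOpen D) : SmoothMat D (curvature γ) := by
  intro p q
  by_cases h : q.val + 1 = n ∧ p.val + 1 ≠ n
  · simp only [curvature, Matrix.of_apply, if_pos h]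
    refine SmoothMat.det (M := fun x t =>
      (frame γ x t).updateCol p (iteratedDeriv n (fun s => γ s t) x)) fun i k => ?_
    by_cases hk : k = p
    · subst hk
      simp only [Matrix.updateCol_self]
      exact ((smoothFun_coord hγ i).iteratedDeriv hD n).congr
        fun _ _ hm => iteratedDeriv_coord hγ hD n hm i
    · simpa [Matrix.updateCol_apply, hk] using smoothMat_frame hγ hD i k
  · simp only [curvature, Matrix.of_apply, if_neg h]
    exact SmoothFun.const 0

theorem hasMatDeriv_frame_iteratedDeriv (hγ : ContDiffOn ℝ ∞ (fun z : ℝ × ℝ => γ z.1 z.2) D)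
    (hD : IsOpen D) {x t : ℝ} (hm : (x, t) ∈ D) :
    HasMatDeriv (fun s => frame γ s t)
      (Matrix.of fun p q => iteratedDeriv (q.val + 1) (fun s => γ s t) x p) x := by
  intro p q
  rw [Matrix.of_apply, iteratedDeriv_coord hγ hD _ hm, iteratedDeriv_succ]
  exact (((smoothFun_coord hγ p).iteratedDeriv hD q.val).hasDerivAt_fst hD
    hm).congr_of_eventuallyEq
      ((eventually_fst_mem hD hm).mono fun s hs => frame_apply hγ hD hs p q)

/-- The moving frame satisfies `g_x = g (b + u)`. -/
theorem hasMatDeriv_frame_x (hγ : ContDiffOn ℝ ∞ (fun z : ℝ × ℝ => γ z.1 z.2) D)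
    (hD : IsOpen D) (hdet : ∀ x t, (x, t) ∈ D → (frame γ x t).det = 1) {x t : ℝ}
    (hm : (x, t) ∈ D) :
    HasMatDeriv (fun s => frame γ s t) (frame γ x t * (b n ℝ + curvature γ x t)) x := by
  have h := hasMatDeriv_frame_iteratedDeriv hγ hD hm
  convert h using 1
  ext p q
  rw [mul_add, Matrix.add_apply, mul_b_apply, Matrix.of_apply]
  by_cases hq : q.val + 1 < n
  · rw [dif_pos hq, mul_inV_apply (curvature_inV γ x t) _ _ _ hq.ne, add_zero]
    rfl
  rw [dif_neg hq, zero_add]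
  have hqn : q.val + 1 = n := by omega
  rw [hqn]
  -- This determinant is the derivative of det g = 1: in the column expansion, differentiating any
  -- column but the last repeats its neighbour. It is the statement that u has no (n,n) entry.
  have hz : ((frame γ x t).updateCol q (iteratedDeriv n (fun s => γ s t) x)).det = 0 := by
    have h1 := h.det.unique ((hasDerivAt_const x (1 : ℝ)).congr_of_eventuallyEq
      ((eventually_fst_mem hD hm).mono fun s hs => hdet s t hs))
    rw [Finset.sum_eq_single q] at h1
    · simpa [hqn] using h1
    · intro k _ hk
      have hk' : k.val + 1 < n := by
        have := Fin.val_ne_of_ne hk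
        omega
      refine Matrix.det_zero_of_column_eq (i := k) (j := ⟨k.val + 1, hk'⟩)
        (by simp [Fin.ext_iff]) fun i => ?_
      rw [Matrix.updateCol_self, Matrix.updateCol_ne (by simp [Fin.ext_iff])]
      rfl
    · simp
  -- Cramer's rule expresses γ_x^{(n)} in the columns of g, with the curvatures as coefficients.
  have hc := congrFun (Matrix.mulVec_cramer (frame γ x t) (iteratedDeriv n (fun s => γ s t) x)) p
  rw [hdet x t hm, one_smul] at hc
  rw [← hc, Matrix.mul_apply, Matrix.mulVec, dotProduct]
  refine Finset.sum_congr rfl fun k _ => ?_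
  rw [Matrix.cramer_apply, curvature, Matrix.of_apply]
  split_ifs with h2
  · rfl
  · have : k = q := Fin.ext (by omega)
    rw [this, hz]

/-- If `γ_t = g Z e_1` and `[∂_x + b + u, Z]` has values in `V_n`, then `g_t = g Z`. -/
theorem hasMatDeriv_frame_t (hγ : ContDiffOn ℝ ∞ (fun z : ℝ × ℝ => γ z.1 z.2) D)
    (hD : IsOpen D) (hdet : ∀ x t, (x, t) ∈ D → (frame γ x t).det = 1)
    {Z : ℝ → ℝ → Matrix (Fin n) (Fin n) ℝ} (hZ : SmoothMat D Z)
    (hV : ∀ x t, (x, t) ∈ D → InV (dx Z x t + ⁅b n ℝ + curvature γ x t, Z x t⁆))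
    (hflow : ∀ x t, (x, t) ∈ D →
      HasDerivAt (fun s => γ x s) ((frame γ x t * Z x t).mulVec (e1 n ℝ)) t)
    {x t : ℝ} (hm : (x, t) ∈ D) :
    HasMatDeriv (fun s => frame γ x s) (frame γ x t * Z x t) t := by
  have hg := smoothMat_frame hγ hD
  suffices H : ∀ (m : ℕ) (hmn : m < n) (x t : ℝ), (x, t) ∈ D → ∀ p,
      HasDerivAt (fun s => frame γ x s p ⟨m, hmn⟩) ((frame γ x t * Z x t) p ⟨m, hmn⟩) t from
    fun p q => H q.val q.isLt x t hm p
  intro m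
  induction m with
  | zero =>
    intro hmn x t hm p
    have := hasDerivAt_pi.1 (hflow x t hm) p
    rw [mulVec_e1_apply hmn] at this
    simpa [frame] using this
  | succ m ih =>
    intro hmn x t hm p
    have hmn' : m < n := by omega
    refine ((hg.entry p ⟨m + 1, hmn⟩).hasDerivAt_snd hD hm).congr_deriv ?_
    have e1 : ∀ x t, (x, t) ∈ D →
        deriv (fun r => frame γ r t p ⟨m, hmn'⟩) x = frame γ x t p ⟨m + 1, hmn⟩ := by
      intro x t hm
      rw [(hasMatDeriv_frame_x hγ hD hdet hm p ⟨m, hmn'⟩).deriv, mul_add, Matrix.add_apply,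
        mul_b_apply, mul_inV_apply (curvature_inV γ x t) _ _ _ (by simpa using hmn.ne)]
      simp [hmn]
    have e2 : deriv (fun s => frame γ x s p ⟨m + 1, hmn⟩) t
        = deriv (fun s => deriv (fun r => frame γ r s p ⟨m, hmn'⟩) x) t :=
      Filter.EventuallyEq.deriv_eq
        ((eventually_snd_mem hD hm).mono fun s hs => (e1 x s hs).symm)
    have e3 : deriv (fun r => deriv (fun s => frame γ r s p ⟨m, hmn'⟩) t) x
        = deriv (fun r => (frame γ r t * Z r t) p ⟨m, hmn'⟩) x :=
      Filter.EventuallyEq.deriv_eq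
        ((eventually_fst_mem hD hm).mono fun s hs => (ih hmn' s t hs p).deriv)
    rw [e2, (hg.entry p ⟨m, hmn'⟩).deriv_comm hD hm, e3,
      ((hasMatDeriv_frame_x hγ hD hdet hm).mul (hZ.hasMatDeriv_dx hD hm) p ⟨m, hmn'⟩).deriv]
    -- The derivative of gZ is g[∂_x + b + u, Z] + gZ(b+u). In a column before the last, the bracket
    -- and u contribute nothing and b shifts to the next column, which propagates the flow from
    -- column m to column m+1.
    have e4 : frame γ x t * (b n ℝ + curvature γ x t) * Z x t + frame γ x t * dx Z x t
        = frame γ x t * (dx Z x t + ⁅b n ℝ + curvature γ x t, Z x t⁆)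
          + (frame γ x t * Z x t * b n ℝ + frame γ x t * Z x t * curvature γ x t) := by
      rw [Ring.lie_def]
      noncomm_ring
    rw [e4, Matrix.add_apply, Matrix.add_apply,
      mul_inV_apply (hV x t hm) _ _ _ (by simpa using hmn.ne),
      mul_inV_apply (curvature_inV γ x t) _ _ _ (by simpa using hmn.ne), mul_b_apply]
    simp [hmn]

/-- A matrix `g` with `g_x = g (b + u)` and `det g = 1` is the moving frame of its first column,
and `u` is its curvature. -/
theorem frame_and_curvature_of_hasMatDeriv {g u : ℝ → ℝ → Matrix (Fin n) (Fin n) ℝ}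
    (hn : 0 < n) (hD : IsOpen D) (hu : ∀ x t, (x, t) ∈ D → InV (u x t))
    (hgx : ∀ x t, (x, t) ∈ D → HasMatDeriv (fun s => g s t) (g x t * (b n ℝ + u x t)) x)
    (hdet : ∀ x t, (x, t) ∈ D → (g x t).det = 1)
    (hγ : ContDiffOn ℝ ∞ (fun z : ℝ × ℝ => γ z.1 z.2) D)
    (h1 : ∀ x t, (x, t) ∈ D → ∀ p, γ x t p = g x t p ⟨0, hn⟩) {x t : ℝ} (hm : (x, t) ∈ D) :
    frame γ x t = g x t ∧ curvature γ x t = u x t := by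
  have H : ∀ (m : ℕ) (hmn : m < n) (x t : ℝ), (x, t) ∈ D → ∀ p,
      iteratedDeriv m (fun s => γ s t p) x = g x t p ⟨m, hmn⟩ := by
    intro m
    induction m with
    | zero => exact fun _ x t hm p => by simpa using h1 x t hm p
    | succ m ih =>
      intro hmn x t hm p
      rw [iteratedDeriv_succ, Filter.EventuallyEq.deriv_eq ((eventually_fst_mem hD hm).mono
        fun s hs => ih (by omega) s t hs p), (hgx x t hm p ⟨m, by omega⟩).deriv, mul_add,
        Matrix.add_apply, mul_b_apply, mul_inV_apply (hu x t hm) _ _ _ (by simpa using hmn.ne)]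
      simp [hmn]
  have hfr : ∀ x t, (x, t) ∈ D → frame γ x t = g x t := fun x t hm =>
    Matrix.ext fun p q => (frame_apply hγ hD hm p q).trans (H q.val q.isLt x t hm p)
  refine ⟨hfr x t hm, ?_⟩
  have hdet' : ∀ x t, (x, t) ∈ D → (frame γ x t).det = 1 := fun x t hm => by
    rw [hfr x t hm, hdet x t hm]
  have e1 := (hasMatDeriv_frame_x hγ hD hdet' hm).unique ((hgx x t hm).congr
    ((eventually_fst_mem hD hm).mono fun s hs => hfr s t hs))
  rw [hfr x t hm] at e1
  have hU : IsUnit (g x t).det := by simp [hdet x t hm]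
  have e2 := congrArg ((g x t)⁻¹ * ·) e1
  simpa [← mul_assoc, Matrix.nonsing_inv_mul _ hU] using e2

end Frame

/-! ### Differentiating a linear system in the spectral parameter -/

open MeasureTheory in
/-- The derivative in a spectral parameter of a solution of a linear differential equation. -/
theorem hasDerivAt_deriv_param {n : ℕ} {O : Set ℂ} (hO : IsOpen O) {l₀ : ℂ} (h0 : l₀ ∈ O)
    {E Z : ℝ → ℂ → Matrix (Fin n) (Fin n) ℂ}
    (hol : ∀ s p q, DifferentiableOn ℂ (fun l => E s l p q) O)
    (hE : ∀ l ∈ O, ∀ s, HasMatDeriv (fun r => E r l) (E s l * Z s l) s)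
    (hZc : ∀ p q, Continuous fun z : ℝ × ℂ => Z z.1 z.2 p q)
    (hZd : ∀ s p q, Differentiable ℂ fun l => Z s l p q) (s : ℝ) (p q : Fin n) :
    HasDerivAt (fun r => deriv (fun l => E r l p q) l₀)
      (deriv (fun l => (E s l * Z s l) p q) l₀) s := by
  obtain ⟨R, hR, hRO⟩ := Metric.nhds_basis_closedBall.mem_iff.1 (hO.mem_nhds h0)
  have hsph : ∀ θ, circleMap l₀ R θ ∈ O := fun θ =>
    hRO (Metric.sphere_subset_closedBall (circleMap_mem_sphere l₀ hR.le θ))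
  -- Cauchy's formula turns the λ-derivative into an integral over a circle, reducing the claim to
  -- differentiation under the integral sign.
  have hcau : ∀ f : ℂ → ℂ, DifferentiableOn ℂ f O →
      deriv f l₀ = (2 * Real.pi * Complex.I : ℂ)⁻¹ •
        ∮ z in C(l₀, R), (1 / (z - l₀) ^ 2) • f z := fun f hf => by
    rw [(hf.mono hRO).deriv_eq_smul_circleIntegral hR,
      inv_smul_smul₀ Complex.two_pi_I_ne_zero]
  obtain ⟨K, hK0, hK⟩ : ∃ K : ℝ, 0 ≤ K ∧ ∀ r ∈ Set.Icc (s - 1) (s + 1), ∀ l ∈ Metric.sphere l₀ R, ∀ i k,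
      ‖Z r l i k‖ ≤ K := by
    have hc : IsCompact (Set.Icc (s - 1) (s + 1) ×ˢ Metric.sphere l₀ R) :=
      isCompact_Icc.prod (isCompact_sphere _ _)
    choose K hK using fun ik : Fin n × Fin n =>
      hc.exists_bound_of_continuousOn (hZc ik.1 ik.2).continuousOn
    refine ⟨∑ ik, |K ik|, Finset.sum_nonneg fun _ _ => abs_nonneg _, fun r hr l hl i k => ?_⟩
    exact (hK (i, k) (r, l) ⟨hr, hl⟩).trans ((le_abs_self _).trans
      (Finset.single_le_sum (f := fun ik => |K ik|) (fun _ _ => abs_nonneg _)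
        (Finset.mem_univ (i, k))))
  have hEZ : ∀ r i k, DifferentiableOn ℂ (fun l => (E r l * Z r l) i k) O := by
    intro r i k
    simp only [Matrix.mul_apply]
    exact DifferentiableOn.fun_sum fun m _ => (hol r i m).mul (hZd r m k).differentiableOn
  -- Joint continuity of E is not assumed, so the dominating constant cannot come from compactness
  -- in (r, l). At the single time s - 1, E is bounded on the circle by holomorphy in l, and
  -- Grönwall's inequality carries this bound along the time interval of length 2.
  obtain ⟨C, hC⟩ : ∃ C, ∀ r ∈ Set.Ioo (s - 1) (s + 1), ∀ l ∈ Metric.sphere l₀ R,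
      ‖(E r l * Z r l) p q‖ ≤ C := by
    have hc0 : ContinuousOn (fun l => E (s - 1) l p) (Metric.sphere l₀ R) :=
      continuousOn_pi.2 fun k => ((hol (s - 1) p k).mono
        (Metric.sphere_subset_closedBall.trans hRO)).continuousOn
    obtain ⟨δ, hδ⟩ := (isCompact_sphere l₀ R).exists_bound_of_continuousOn hc0
    have hrow : ∀ r ∈ Set.Icc (s - 1) (s + 1), ∀ l ∈ Metric.sphere l₀ R, ∀ k,
        ‖(E r l * Z r l) p k‖ ≤ n * K * ‖E r l p‖ := by
      intro r hr l hl k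
      rw [Matrix.mul_apply]
      refine (norm_sum_le _ _).trans ((Finset.sum_le_card_nsmul _ _ (K * ‖E r l p‖)
        fun m _ => ?_).trans (by simp [mul_assoc]))
      rw [norm_mul, mul_comm K]
      exact mul_le_mul (norm_le_pi_norm (E r l p) m) (hK r hr l hl m k) (norm_nonneg _)
        (norm_nonneg _)
    refine ⟨n * K * (δ * Real.exp (n * K * 2)), fun r hr l hl => ?_⟩
    have hlO : l ∈ O := hRO (Metric.sphere_subset_closedBall hl)
    have hnK : 0 ≤ n * K := by positivity
    have hd : ∀ r, HasDerivAt (fun r => E r l p) (fun k => (E r l * Z r l) p k) r :=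
      fun r => hasDerivAt_pi.2 fun k => hE l hlO r p k
    have hg := norm_le_gronwallBound_of_norm_deriv_right_le (f := fun r => E r l p)
      (f' := fun r k => (E r l * Z r l) p k) (δ := δ) (K := n * K) (ε := 0)
      (a := s - 1) (b := s + 1)
      (fun r _ => (hd r).continuousAt.continuousWithinAt) (fun r _ => (hd r).hasDerivWithinAt)
      (hδ l hl) (fun r hr => by
        rw [add_zero]
        exact (pi_norm_le_iff_of_nonneg (by positivity)).2
          fun k => hrow r (Set.Ico_subset_Icc_self hr) l hl k)
      r (Set.Ioo_subset_Icc_self hr)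
    rw [gronwallBound_ε0] at hg
    have hδ0 : 0 ≤ δ := (norm_nonneg _).trans (hδ l hl)
    refine (hrow r (Set.Ioo_subset_Icc_self hr) l hl q).trans
      (mul_le_mul_of_nonneg_left (hg.trans (mul_le_mul_of_nonneg_left
        (Real.exp_le_exp.2 (mul_le_mul_of_nonneg_left ?_ hnK)) hδ0)) hnK)
    linarith [hr.2]
  have hcont : ∀ f : ℂ → ℂ, DifferentiableOn ℂ f O →
      Continuous fun θ => deriv (circleMap l₀ R) θ • ((1 / (circleMap l₀ R θ - l₀) ^ 2) •
        f (circleMap l₀ R θ)) := by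
    intro f hf
    have h1 : Continuous fun θ => f (circleMap l₀ R θ) :=
      hf.continuousOn.comp_continuous (continuous_circleMap _ _) hsph
    have h2 : Continuous fun θ => 1 / (circleMap l₀ R θ - l₀) ^ 2 :=
      continuous_const.div (((continuous_circleMap _ _).sub continuous_const).pow 2) fun θ =>
        pow_ne_zero _ (sub_ne_zero.2 (circleMap_ne_center hR.ne'))
    have h3 : Continuous fun θ => deriv (circleMap l₀ R) θ := by
      simp only [deriv_circleMap]
      exact (continuous_circleMap _ _).mul continuous_const
    exact h3.smul (h2.smul h1)
  have key := (intervalIntegral.hasDerivAt_integral_of_dominated_loc_of_deriv_le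
    (μ := volume) (a := 0) (b := 2 * Real.pi) (s := Set.Ioo (s - 1) (s + 1)) (x₀ := s)
    (F := fun r θ => deriv (circleMap l₀ R) θ • ((1 / (circleMap l₀ R θ - l₀) ^ 2) •
      E r (circleMap l₀ R θ) p q))
    (F' := fun r θ => deriv (circleMap l₀ R) θ • ((1 / (circleMap l₀ R θ - l₀) ^ 2) •
      (E r (circleMap l₀ R θ) * Z r (circleMap l₀ R θ)) p q))
    (bound := fun _ => R * (1 / R ^ 2 * C))
    (Ioo_mem_nhds (by linarith) (by linarith))
    (Filter.Eventually.of_forall fun r => (hcont _ (hol r p q)).aestronglyMeasurable)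
    ((hcont _ (hol s p q)).intervalIntegrable _ _)
    (hcont _ (hEZ s p q)).aestronglyMeasurable
    (Filter.Eventually.of_forall fun θ _ r hr => by
      rw [norm_smul, norm_smul, deriv_circleMap]
      simp only [norm_mul, norm_circleMap_zero, Complex.norm_I, mul_one, norm_div, norm_one,
        norm_pow, circleMap_sub_center, abs_of_pos hR]
      exact mul_le_mul_of_nonneg_left (mul_le_mul_of_nonneg_left
        (hC r hr _ (circleMap_mem_sphere l₀ hR.le θ)) (by positivity)) hR.le)
    intervalIntegrable_const
    (Filter.Eventually.of_forall fun θ _ r _ =>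
      ((hE _ (hsph θ) r p q).fun_const_smul _).fun_const_smul _)).2
  have h1 := key.const_smul (2 * Real.pi * Complex.I : ℂ)⁻¹
  rw [hcau _ (hEZ s p q)]
  exact h1.congr_of_eventuallyEq (Filter.Eventually.of_forall fun r => hcau _ (hol r p q))

/-! ### Matrices of Laurent series and the principal grading -/

section Laurent

variable {n : ℕ}

/-- A constant matrix, as a matrix of Laurent series. -/
def cmat (M : Matrix (Fin n) (Fin n) ℝ) : Matrix (Fin n) (Fin n) (LaurentSeries ℝ) :=
  M.map (HahnSeries.C : ℝ →+* LaurentSeries ℝ)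

/-- The inverse of the spectral parameter. -/
def lamInv : LaurentSeries ℝ := HahnSeries.single 1 1

theorem lam_mul_lamInv : lam * lamInv = 1 := by
  rw [lam, lamInv, HahnSeries.single_mul_single]
  simp

variable {M N : Matrix (Fin n) (Fin n) ℝ} {A B : Matrix (Fin n) (Fin n) (LaurentSeries ℝ)}

theorem lcoeff_apply (A : Matrix (Fin n) (Fin n) (LaurentSeries ℝ)) (i : ℤ) (p q : Fin n) :
    lcoeff A i p q = (A p q).coeff (-i) := rfl

theorem lcoeff_ext (h : ∀ i, lcoeff A i = lcoeff B i) : A = B := by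
  ext p q k
  simpa [lcoeff_apply] using congrFun (congrFun (h (-k)) p) q

theorem lcoeff_add (A B : Matrix (Fin n) (Fin n) (LaurentSeries ℝ)) (i : ℤ) :
    lcoeff (A + B) i = lcoeff A i + lcoeff B i := by ext; simp [lcoeff_apply]

theorem lcoeff_sub (A B : Matrix (Fin n) (Fin n) (LaurentSeries ℝ)) (i : ℤ) :
    lcoeff (A - B) i = lcoeff A i - lcoeff B i := by ext; simp [lcoeff_apply]

theorem lcoeff_neg (A : Matrix (Fin n) (Fin n) (LaurentSeries ℝ)) (i : ℤ) :
    lcoeff (-A) i = -lcoeff A i := by ext; simp [lcoeff_apply]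

theorem lcoeff_zero (i : ℤ) :
    lcoeff (0 : Matrix (Fin n) (Fin n) (LaurentSeries ℝ)) i = 0 := by ext; simp [lcoeff_apply]

theorem coeff_sum {ι : Type*} (s : Finset ι) (f : ι → LaurentSeries ℝ) (k : ℤ) :
    (∑ i ∈ s, f i).coeff k = ∑ i ∈ s, (f i).coeff k := by
  classical
  induction s using Finset.induction_on with
  | empty => simp
  | insert a s ha ih => rw [Finset.sum_insert ha, Finset.sum_insert ha, HahnSeries.coeff_add, ih]

theorem lcoeff_sum {ι : Type*} (s : Finset ι)
    (f : ι → Matrix (Fin n) (Fin n) (LaurentSeries ℝ)) (i : ℤ) :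
    lcoeff (∑ k ∈ s, f k) i = ∑ k ∈ s, lcoeff (f k) i := by
  ext p q
  simp only [lcoeff_apply, Matrix.sum_apply, coeff_sum]

theorem lcoeff_cmat (M : Matrix (Fin n) (Fin n) ℝ) (i : ℤ) :
    lcoeff (cmat M) i = if i = 0 then M else 0 := by
  ext p q
  rw [lcoeff_apply, cmat, Matrix.map_apply, HahnSeries.C_apply, HahnSeries.coeff_single]
  by_cases h : i = 0 <;> simp [h]

theorem lcoeff_cmat_mul (M : Matrix (Fin n) (Fin n) ℝ)
    (A : Matrix (Fin n) (Fin n) (LaurentSeries ℝ)) (i : ℤ) :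
    lcoeff (cmat M * A) i = M * lcoeff A i := by
  ext p q
  simp only [lcoeff_apply, Matrix.mul_apply, coeff_sum, cmat, Matrix.map_apply,
    HahnSeries.C_apply, HahnSeries.coeff_single_zero_mul]

theorem lcoeff_mul_cmat (A : Matrix (Fin n) (Fin n) (LaurentSeries ℝ))
    (M : Matrix (Fin n) (Fin n) ℝ) (i : ℤ) :
    lcoeff (A * cmat M) i = lcoeff A i * M := by
  ext p q
  simp only [lcoeff_apply, Matrix.mul_apply, coeff_sum, cmat, Matrix.map_apply,
    HahnSeries.C_apply, HahnSeries.coeff_mul_single_zero]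

theorem lcoeff_lam_smul (A : Matrix (Fin n) (Fin n) (LaurentSeries ℝ)) (i : ℤ) :
    lcoeff (lam • A) i = lcoeff A (i - 1) := by
  ext p q
  simp only [lcoeff_apply, Matrix.smul_apply, smul_eq_mul, lam, HahnSeries.coeff_single_mul,
    one_mul]
  congr 1
  ring

theorem lcoeff_lamInv_smul (A : Matrix (Fin n) (Fin n) (LaurentSeries ℝ)) (i : ℤ) :
    lcoeff (lamInv • A) i = lcoeff A (i + 1) := by
  ext p q
  simp only [lcoeff_apply, Matrix.smul_apply, smul_eq_mul, lamInv, HahnSeries.coeff_single_mul,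
    one_mul]
  congr 1
  ring

theorem lcoeff_lam_pow_smul (k : ℕ) (A : Matrix (Fin n) (Fin n) (LaurentSeries ℝ)) (i : ℤ) :
    lcoeff (lam ^ k • A) i = lcoeff A (i - k) := by
  induction k generalizing i with
  | zero => simp
  | succ k ih =>
    have h : lam ^ (k + 1) • A = lam • (lam ^ k • A) := by
      ext p q : 2
      simp only [Matrix.smul_apply, smul_eq_mul, pow_succ', mul_assoc]
    rw [h, lcoeff_lam_smul, ih]
    congr 1
    push_cast
    ring

theorem cmat_add (M N : Matrix (Fin n) (Fin n) ℝ) : cmat (M + N) = cmat M + cmat N :=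
  Matrix.map_add _ (map_add _) _ _

theorem cmat_mul (M N : Matrix (Fin n) (Fin n) ℝ) : cmat (M * N) = cmat M * cmat N :=
  Matrix.map_mul

theorem cmat_one : cmat (1 : Matrix (Fin n) (Fin n) ℝ) = 1 :=
  Matrix.map_one _ (map_zero _) (map_one _)

theorem cmat_zero : cmat (0 : Matrix (Fin n) (Fin n) ℝ) = 0 :=
  Matrix.map_zero _ (map_zero _)

theorem map_e {R S : Type*} [CommRing R] [CommRing S] (f : R →+* S) (i j : ℕ) :
    (e n R i j).map f = e n S i j := by
  ext p q
  simp only [Matrix.map_apply, e_apply]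
  split_ifs <;> simp

theorem map_b {R S : Type*} [CommRing R] [CommRing S] (f : R →+* S) :
    (b n R).map f = b n S := by
  ext p q
  simp only [Matrix.map_apply, b_apply]
  split_ifs <;> simp

theorem J_lam_eq : J n lam = cmat (b n ℝ) + lam • cmat (e n ℝ 1 n) := by
  rw [J, cmat, cmat, map_b, map_e, add_comm]

/-- `A` only has terms `l^i e_{pq}` of principal degree `n i + p - q ≤ d`. -/
def PDeg (d : ℤ) (A : Matrix (Fin n) (Fin n) (LaurentSeries ℝ)) : Prop :=
  ∀ (i : ℤ) (p q : Fin n), d < (n : ℤ) * i + (p.val : ℤ) - (q.val : ℤ) → lcoeff A i p q = 0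

theorem PDeg.mono {c d : ℤ} (hA : PDeg c A) (h : c ≤ d) : PDeg d A :=
  fun i p q hi => hA i p q (h.trans_lt hi)

theorem PDeg.add {d : ℤ} (hA : PDeg d A) (hB : PDeg d B) : PDeg d (A + B) := fun i p q h => by
  rw [lcoeff_add, Matrix.add_apply, hA i p q h, hB i p q h, add_zero]

theorem PDeg.sub {d : ℤ} (hA : PDeg d A) (hB : PDeg d B) : PDeg d (A - B) := fun i p q h => by
  rw [lcoeff_sub, Matrix.sub_apply, hA i p q h, hB i p q h, sub_zero]

/-- The principal degree n i + p - q is additive along a product of entries: the middle index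
cancels. Hence a nonzero term requires both factors to respect their bounds. -/
theorem PDeg.mul {c d : ℤ} (hA : PDeg c A) (hB : PDeg d B) : PDeg (c + d) (A * B) := by
  intro i p q h
  rw [lcoeff_apply, Matrix.mul_apply, coeff_sum]
  refine Finset.sum_eq_zero fun r _ => ?_
  rw [HahnSeries.coeff_mul]
  refine Finset.sum_eq_zero fun ij hij => ?_
  have hsum : ij.1 + ij.2 = -i := (Finset.mem_antidiagonal.1 hij).2.2
  by_cases h1 : c < (n : ℤ) * (-ij.1) + p.val - r.val
  · have := hA (-ij.1) p r h1
    rw [lcoeff_apply, neg_neg] at this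
    rw [this, zero_mul]
  · have h2 : d < (n : ℤ) * (-ij.2) + r.val - q.val := by
      have : i = -ij.1 + -ij.2 := by linarith
      rw [this, mul_add] at h
      linarith
    have := hB (-ij.2) r q h2
    rw [lcoeff_apply, neg_neg] at this
    rw [this, mul_zero]

theorem PDeg.pow {A : Matrix (Fin n) (Fin n) (LaurentSeries ℝ)} (hA : PDeg 1 A) (j : ℕ) :
    PDeg j (A ^ j) := by
  induction j with
  | zero =>
    intro i p q h
    rw [pow_zero, ← cmat_one, lcoeff_cmat]
    split_ifs with h0
    · subst h0
      rw [Matrix.one_apply_ne]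
      rintro rfl
      simp at h
    · rfl
  | succ j ih =>
    rw [pow_succ]
    exact (ih.mul hA).mono (by push_cast; exact le_rfl)

theorem pdeg_cmat {d : ℤ} (h : ∀ p q : Fin n, d < (p.val : ℤ) - q.val → M p q = 0) :
    PDeg d (cmat M) := by
  intro i p q hi
  rw [lcoeff_cmat]
  split_ifs with h0
  · subst h0
    exact h p q (by simpa using hi)
  · rfl

theorem PDeg.lam_smul {d : ℤ} (hA : PDeg d A) : PDeg (d + n) (lam • A) := by
  intro i p q h
  rw [lcoeff_lam_smul]
  exact hA _ p q (by rw [mul_sub]; linarith)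

theorem PDeg.lamInv_smul {d : ℤ} (hA : PDeg d A) : PDeg (d - n) (lamInv • A) := by
  intro i p q h
  rw [lcoeff_lamInv_smul]
  exact hA _ p q (by rw [mul_add]; linarith)

theorem pdeg_cmat_all (M : Matrix (Fin n) (Fin n) ℝ) : PDeg (n - 1) (cmat M) :=
  pdeg_cmat fun p q h => by
    have := p.isLt
    omega

theorem pdeg_cmat_e : PDeg (1 - n) (cmat (e n ℝ 1 n)) := by
  refine pdeg_cmat fun p q h => ?_
  have := q.isLt
  rw [e_apply, if_neg]
  omega

/-- The index range depends only on the order bounds, not on the supports. For families in (x,t) the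
coefficients of a product are thus sums over one fixed finite set, which makes their smoothness
visible. -/
theorem coeff_mul_eq_sum {x y : LaurentSeries ℝ} {a c : ℤ} (hx : ∀ k < a, x.coeff k = 0)
    (hy : ∀ k < c, y.coeff k = 0) (k : ℤ) :
    (x * y).coeff k = ∑ i ∈ Finset.Icc a (k - c), x.coeff i * y.coeff (k - i) := by
  rw [HahnSeries.coeff_mul]
  refine Finset.sum_of_injOn (fun ij : ℤ × ℤ => ij.1) ?_ ?_ ?_ ?_
  · intro u hu v hv huv
    have h1 := (Finset.mem_antidiagonal.1 hu).2.2
    have h2 := (Finset.mem_antidiagonal.1 hv).2.2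
    simp only at huv
    exact Prod.ext huv (by linarith)
  · intro u hu
    obtain ⟨h1, h2, h3⟩ := Finset.mem_antidiagonal.1 hu
    have h4 : a ≤ u.1 := by
      by_contra h
      exact h1 (hx _ (not_le.1 h))
    have h5 : c ≤ u.2 := by
      by_contra h
      exact h2 (hy _ (not_le.1 h))
    simp only [Finset.coe_Icc, Set.mem_Icc]
    omega
  · intro i _ hi
    by_contra h
    refine hi ⟨(i, k - i), ?_, rfl⟩
    exact Finset.mem_coe.2 (Finset.mem_antidiagonal.2
      ⟨left_ne_zero_of_mul h, right_ne_zero_of_mul h, by ring⟩)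
  · intro u hu
    have h3 := (Finset.mem_antidiagonal.1 hu).2.2
    rw [show k - u.1 = u.2 by linarith]

/-- A crude order bound for the entries; only its dependence on d and n alone matters. -/
theorem PDeg.coeff_eq_zero {d : ℤ} (hA : PDeg d A) (p q : Fin n) :
    ∀ k < -(|d| + n), (A p q).coeff k = 0 := by
  intro k hk
  have := hA (-k) p q ?_
  · rwa [lcoeff_apply, neg_neg] at this
  · have h1 := q.isLt
    have h2 : (1 : ℤ) ≤ n := by omega
    have h3 : |d| + n ≤ -k := by linarith
    have h5 : 0 ≤ |d| := abs_nonneg d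
    have h4 : -k ≤ n * -k := by nlinarith
    have := le_abs_self d
    omega

/-- Smoothness, on `D`, of the coefficients of a family of matrices of Laurent series of bounded
principal degree. -/
structure SmoothLaurent (D : Set (ℝ × ℝ)) (d : ℤ)
    (A : ℝ → ℝ → Matrix (Fin n) (Fin n) (LaurentSeries ℝ)) : Prop where
  pdeg : ∀ x t, (x, t) ∈ D → PDeg d (A x t)
  smooth : ∀ i, SmoothMat D fun x t => lcoeff (A x t) i

theorem SmoothLaurent.mul {D : Set (ℝ × ℝ)} {c d : ℤ}
    {A B : ℝ → ℝ → Matrix (Fin n) (Fin n) (LaurentSeries ℝ)} (hA : SmoothLaurent D c A)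
    (hB : SmoothLaurent D d B) : SmoothLaurent D (c + d) fun x t => A x t * B x t := by
  refine ⟨fun x t hm => (hA.pdeg x t hm).mul (hB.pdeg x t hm), fun i p q => ?_⟩
  have h : SmoothFun D fun x t => ∑ r, ∑ k ∈ Finset.Icc (-(|c| + n)) (-i - -(|d| + n)),
      lcoeff (A x t) (-k) p r * lcoeff (B x t) (-(-i - k)) r q :=
    SmoothFun.sum fun r _ => SmoothFun.sum fun k _ =>
      ((hA.smooth _).entry p r).mul ((hB.smooth _).entry r q)
  refine SmoothFun.congr (k := fun x t => lcoeff (A x t * B x t) i p q) h fun x t hm => ?_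
  rw [lcoeff_apply, Matrix.mul_apply, coeff_sum]
  refine Finset.sum_congr rfl fun r _ => ?_
  rw [coeff_mul_eq_sum ((hA.pdeg x t hm).coeff_eq_zero p r)
    ((hB.pdeg x t hm).coeff_eq_zero r q)]
  simp only [lcoeff_apply, neg_neg]

theorem SmoothLaurent.pow {D : Set (ℝ × ℝ)}
    {A : ℝ → ℝ → Matrix (Fin n) (Fin n) (LaurentSeries ℝ)} (hA : SmoothLaurent D 1 A) (j : ℕ) :
    SmoothLaurent D j fun x t => A x t ^ j := by
  induction j with
  | zero =>
    refine ⟨fun x t hm => (hA.pdeg x t hm).pow 0, fun i => ?_⟩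
    simp only [pow_zero]
    exact SmoothMat.const _
  | succ j ih =>
    simp only [pow_succ]
    exact_mod_cast ih.mul hA

/-- `A'` is the coefficientwise derivative at `s` of `A`. -/
def HasLaurentDeriv (A : ℝ → Matrix (Fin n) (Fin n) (LaurentSeries ℝ))
    (A' : Matrix (Fin n) (Fin n) (LaurentSeries ℝ)) (s : ℝ) : Prop :=
  ∀ i, HasMatDeriv (fun r => lcoeff (A r) i) (lcoeff A' i) s

section Deriv

variable {A B : ℝ → Matrix (Fin n) (Fin n) (LaurentSeries ℝ)}
  {A' B' : Matrix (Fin n) (Fin n) (LaurentSeries ℝ)} {M : ℝ → Matrix (Fin n) (Fin n) ℝ}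
  {M' : Matrix (Fin n) (Fin n) ℝ} {s : ℝ}

theorem HasLaurentDeriv.add (hA : HasLaurentDeriv A A' s) (hB : HasLaurentDeriv B B' s) :
    HasLaurentDeriv (fun r => A r + B r) (A' + B') s := fun i => by
  simpa only [lcoeff_add] using (hA i).add (hB i)

theorem HasLaurentDeriv.lam_smul (hA : HasLaurentDeriv A A' s) :
    HasLaurentDeriv (fun r => lam • A r) (lam • A') s := fun i => by
  simpa only [lcoeff_lam_smul] using hA (i - 1)

theorem HasLaurentDeriv.lamInv_smul (hA : HasLaurentDeriv A A' s) :
    HasLaurentDeriv (fun r => lamInv • A r) (lamInv • A') s := fun i => by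
  simpa only [lcoeff_lamInv_smul] using hA (i + 1)

theorem HasLaurentDeriv.cmat_mul (hM : HasMatDeriv M M' s) (hA : HasLaurentDeriv A A' s) :
    HasLaurentDeriv (fun r => cmat (M r) * A r) (cmat M' * A s + cmat (M s) * A') s := fun i => by
  simpa only [lcoeff_cmat_mul, lcoeff_add] using hM.mul (hA i)

theorem HasLaurentDeriv.mul_cmat (hA : HasLaurentDeriv A A' s) (hM : HasMatDeriv M M' s) :
    HasLaurentDeriv (fun r => A r * cmat (M r)) (A' * cmat (M s) + A s * cmat M') s := fun i => by
  simpa only [lcoeff_mul_cmat, lcoeff_add] using (hA i).mul hM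

theorem HasLaurentDeriv.const (C : Matrix (Fin n) (Fin n) (LaurentSeries ℝ)) (s : ℝ) :
    HasLaurentDeriv (fun _ => C) 0 s := fun i => by
  simpa only [lcoeff_zero] using HasMatDeriv.const (lcoeff C i) s

theorem HasLaurentDeriv.congr (hA : HasLaurentDeriv A A' s) (h : ∀ᶠ r in nhds s, B r = A r) :
    HasLaurentDeriv B A' s := fun i => (hA i).congr (h.mono fun r hr => by rw [hr])

theorem HasLaurentDeriv.unique (hA : HasLaurentDeriv A A' s) (hB : HasLaurentDeriv A B' s) :
    A' = B' := lcoeff_ext fun i => (hA i).unique (hB i)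

end Deriv

end Laurent

/-! ### Noncommutative algebra of dressing -/

/-- The polynomial `f = f₀ + l e` has the inverse `B + l⁻¹ F`. -/
structure DressInv {R : Type*} [Ring R] (f₀ e F B : R) : Prop where
  fF : f₀ * F = 0
  Ff : F * f₀ = 0
  eB : e * B = 0
  Be : B * e = 0
  right : f₀ * B + e * F = 1
  left : B * f₀ + F * e = 1

/-- Think of the frame (a₀ + la + ⋯)(B + l⁻¹F), where `ha` removes the pole and aF + a₀B is the
value at l = 0. If the left factor is multiplied by Z₀ + lZ₁ + ⋯ when differentiated and f' = fZ -
Tf, then the frame is multiplied by T. This is the l⁰ coefficient of that identity; `hf` and `h1`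
are the equation of f in degrees 0 and 1. -/
theorem DressInv.deriv_mul {R : Type*} [Ring R] {f₀ e F B : R} (h : DressInv f₀ e F B)
    {a a₀ Z₀ Z₁ T₀ T₁ f' F' B' : R} (hf : f' = f₀ * Z₀ - T₀ * f₀)
    (h1 : e * Z₀ + f₀ * Z₁ = T₀ * e + T₁ * f₀) (hF : f' * F + f₀ * F' = 0)
    (hB : f' * B + f₀ * B' + e * F' = 0) (heB : e * B' = 0) (ha : a₀ * F = 0) :
    (a * Z₀ + a₀ * Z₁) * F + a * F' + (a₀ * Z₀ * B + a₀ * B') = (a * F + a₀ * B) * T₀ := by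
  obtain ⟨fF, Ff, eB, Be, right, left⟩ := h
  -- This and the next identity are the l⁰ and l⁻¹ coefficients of (f⁻¹)' = -f⁻¹f'f⁻¹.
  have hB' : B' = -(B * f' * B) := by
    linear_combination (norm := noncomm_ring) B * hB + F * heB - Be * F' - left * B'
  have hF' : F' = -(B * f' * F) - F * f' * B := by
    linear_combination (norm := noncomm_ring) B * hF + F * hB - Ff * B' - left * F'
  have k1 : F' = -(Z₀ * F) + F * T₀ := by
    linear_combination (norm := noncomm_ring) hF' - B * hf * F - F * hf * B + B * T₀ * fF
      - Ff * Z₀ * B - left * Z₀ * F + F * T₀ * right + F * h1 * F - Ff * Z₁ * F + F * T₁ * fF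
  have k2 : a₀ * B' = -(a₀ * Z₀ * B) + a₀ * B * T₀ - a₀ * Z₁ * F := by
    linear_combination (norm := noncomm_ring) a₀ * hB' - a₀ * B * hf * B - a₀ * left * Z₀ * B
      + ha * e * Z₀ * B + a₀ * B * T₀ * right + a₀ * B * h1 * F - a₀ * Be * Z₀ * F
      + a₀ * B * T₁ * fF - a₀ * left * Z₁ * F + ha * e * Z₁ * F
  linear_combination (norm := noncomm_ring) a * k1 + k2

/-- Conjugation of a Lax equation. -/
theorem lax_conj {R : Type*} [Ring R] {f fi f' fi' X T Y Y' : R} (hfi : fi * f = 1)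
    (hffi : f * fi = 1) (hi : f' * fi + f * fi' = 0) (hf : f' = f * X - T * f) (hY : Y' + (X * Y - Y * X) = 0) :
    f' * Y * fi + f * Y' * fi + f * Y * fi' + (T * (f * Y * fi) - f * Y * fi * T) = 0 := by
  have h1 : fi' = -(fi * f' * fi) := by
    linear_combination (norm := noncomm_ring) fi * hi - hfi * fi'
  linear_combination (norm := noncomm_ring) hf * Y * fi + f * hY * fi + f * Y * h1
    - f * Y * fi * hf * fi - f * Y * hfi * X * fi + f * Y * fi * T * hffi

/-! ### The dressing matrix and its inverse as Laurent series -/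

section Dressing

variable {n : ℕ}

/-- The matrix `f = f₀ + l e_{1n}` of Laurent series. -/
def dressMat (f₀ : Matrix (Fin n) (Fin n) ℝ) : Matrix (Fin n) (Fin n) (LaurentSeries ℝ) :=
  cmat f₀ + lam • cmat (e n ℝ 1 n)

/-- The matrix `B + l⁻¹ F` of Laurent series. -/
def dressInvMat (F B : Matrix (Fin n) (Fin n) ℝ) : Matrix (Fin n) (Fin n) (LaurentSeries ℝ) :=
  cmat B + lamInv • cmat F

variable {f₀ F B : Matrix (Fin n) (Fin n) ℝ}

theorem laurent_smul_mul (l : LaurentSeries ℝ)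
    (A C : Matrix (Fin n) (Fin n) (LaurentSeries ℝ)) : (l • A) * C = l • (A * C) :=
  Matrix.smul_mul l A C

theorem laurent_mul_smul (l : LaurentSeries ℝ)
    (A C : Matrix (Fin n) (Fin n) (LaurentSeries ℝ)) : A * (l • C) = l • (A * C) :=
  Matrix.mul_smul A l C

theorem laurent_smul_smul (l k : LaurentSeries ℝ)
    (A : Matrix (Fin n) (Fin n) (LaurentSeries ℝ)) : l • k • A = (l * k) • A :=
  smul_smul l k A

theorem laurent_one_smul (A : Matrix (Fin n) (Fin n) (LaurentSeries ℝ)) :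
    (1 : LaurentSeries ℝ) • A = A := one_smul _ A

theorem laurent_smul_zero (l : LaurentSeries ℝ) :
    l • (0 : Matrix (Fin n) (Fin n) (LaurentSeries ℝ)) = 0 := by
  ext p q : 2
  simp only [Matrix.smul_apply, Matrix.zero_apply, smul_eq_mul, mul_zero]

theorem smul_mul_smul_lamInv (A C : Matrix (Fin n) (Fin n) (LaurentSeries ℝ)) :
    (lam • A) * (lamInv • C) = A * C := by
  rw [laurent_smul_mul, laurent_mul_smul, laurent_smul_smul, lam_mul_lamInv, laurent_one_smul]

theorem smul_lamInv_mul_smul (A C : Matrix (Fin n) (Fin n) (LaurentSeries ℝ)) :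
    (lamInv • A) * (lam • C) = A * C := by
  rw [laurent_smul_mul, laurent_mul_smul, laurent_smul_smul, mul_comm lamInv, lam_mul_lamInv,
    laurent_one_smul]

theorem DressInv.mul_inv (h : DressInv f₀ (e n ℝ 1 n) F B) :
    dressMat f₀ * dressInvMat F B = 1 := by
  rw [dressMat, dressInvMat, add_mul, mul_add, mul_add, smul_mul_smul_lamInv, laurent_mul_smul,
    laurent_smul_mul, ← cmat_mul, ← cmat_mul, ← cmat_mul, ← cmat_mul, h.fF, h.eB, cmat_zero,
    laurent_smul_zero, laurent_smul_zero, add_zero, zero_add, ← cmat_add, h.right, cmat_one]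

theorem DressInv.inv_mul (h : DressInv f₀ (e n ℝ 1 n) F B) :
    dressInvMat F B * dressMat f₀ = 1 := by
  rw [dressMat, dressInvMat, add_mul, mul_add, mul_add, smul_lamInv_mul_smul, laurent_mul_smul,
    laurent_smul_mul, ← cmat_mul, ← cmat_mul, ← cmat_mul, ← cmat_mul, h.Ff, h.Be, cmat_zero,
    laurent_smul_zero, laurent_smul_zero, zero_add, add_zero, ← cmat_add, h.left, cmat_one]

theorem lcoeff_dressMat_mul (f₀ : Matrix (Fin n) (Fin n) ℝ)
    (A : Matrix (Fin n) (Fin n) (LaurentSeries ℝ)) (i : ℤ) :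
    lcoeff (dressMat f₀ * A) i = f₀ * lcoeff A i + e n ℝ 1 n * lcoeff A (i - 1) := by
  rw [dressMat, add_mul, lcoeff_add, lcoeff_cmat_mul, laurent_smul_mul, lcoeff_lam_smul,
    lcoeff_cmat_mul]

theorem lcoeff_mul_dressMat (f₀ : Matrix (Fin n) (Fin n) ℝ)
    (A : Matrix (Fin n) (Fin n) (LaurentSeries ℝ)) (i : ℤ) :
    lcoeff (A * dressMat f₀) i = lcoeff A i * f₀ + lcoeff A (i - 1) * e n ℝ 1 n := by
  rw [dressMat, mul_add, lcoeff_add, lcoeff_mul_cmat, laurent_mul_smul, lcoeff_lam_smul,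
    lcoeff_mul_cmat]

theorem lcoeff_mul_dressInvMat (F B : Matrix (Fin n) (Fin n) ℝ)
    (A : Matrix (Fin n) (Fin n) (LaurentSeries ℝ)) (i : ℤ) :
    lcoeff (A * dressInvMat F B) i = lcoeff A i * B + lcoeff A (i + 1) * F := by
  rw [dressInvMat, mul_add, lcoeff_add, lcoeff_mul_cmat, laurent_mul_smul, lcoeff_lamInv_smul,
    lcoeff_mul_cmat]

theorem pdeg_dressMat (hf : ∀ p q : Fin n, q.val + 1 < p.val → f₀ p q = 0) :
    PDeg 1 (dressMat f₀) := by
  refine (pdeg_cmat fun p q h => hf p q (by omega)).add ?_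
  exact pdeg_cmat_e.lam_smul.mono (by simp)

/-- The pole part costs nothing: l⁻¹ lowers the degree by n, while an arbitrary constant matrix has
degree at most n - 1. Only B needs to be strictly upper triangular. -/
theorem pdeg_dressInvMat (hB : ∀ p q : Fin n, q ≤ p → B p q = 0) :
    PDeg (-1) (dressInvMat F B) := by
  refine (pdeg_cmat fun p q h => hB p q ?_).add ((pdeg_cmat_all F).lamInv_smul.mono (by simp))
  rw [Fin.le_def]
  omega

theorem SmoothLaurent.dressMat {D : Set (ℝ × ℝ)} {f₀ : ℝ → ℝ → Matrix (Fin n) (Fin n) ℝ}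
    (hf : SmoothMat D f₀) (h : ∀ x t, (x, t) ∈ D → ∀ p q : Fin n, q.val + 1 < p.val →
      f₀ x t p q = 0) : SmoothLaurent D 1 fun x t => dressMat (f₀ x t) := by
  refine ⟨fun x t hm => pdeg_dressMat (h x t hm), fun i => ?_⟩
  have e1 : ∀ x t, lcoeff (CentralAffine.dressMat (f₀ x t)) i
      = (if i = 0 then f₀ x t else 0) + if i - 1 = 0 then e n ℝ 1 n else 0 := fun x t => by
    rw [CentralAffine.dressMat, lcoeff_add, lcoeff_lam_smul, lcoeff_cmat, lcoeff_cmat]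
  simp only [e1]
  refine SmoothMat.add ?_ (SmoothMat.const _)
  split_ifs
  · exact hf
  · exact SmoothMat.const 0

theorem SmoothLaurent.dressInvMat {D : Set (ℝ × ℝ)} {F B : ℝ → ℝ → Matrix (Fin n) (Fin n) ℝ}
    (hF : SmoothMat D F) (hB : SmoothMat D B)
    (h : ∀ x t, (x, t) ∈ D → ∀ p q : Fin n, q ≤ p → B x t p q = 0) :
    SmoothLaurent D (-1) fun x t => dressInvMat (F x t) (B x t) := by
  refine ⟨fun x t hm => pdeg_dressInvMat (h x t hm), fun i => ?_⟩
  have e1 : ∀ x t, lcoeff (CentralAffine.dressInvMat (F x t) (B x t)) i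
      = (if i = 0 then B x t else 0) + if i + 1 = 0 then F x t else 0 := fun x t => by
    rw [CentralAffine.dressInvMat, lcoeff_add, lcoeff_lamInv_smul, lcoeff_cmat, lcoeff_cmat]
  simp only [e1]
  refine SmoothMat.add ?_ ?_
  · split_ifs
    · exact hB
    · exact SmoothMat.const 0
  · split_ifs
    · exact hF
    · exact SmoothMat.const 0

end Dressing

/-! ### Dressing transforms the Lax data of u into those of ũ -/

section LaxData

variable {n : ℕ}

theorem J_lam_add_eq (u : Matrix (Fin n) (Fin n) ℝ) :
    J n lam + u.map (HahnSeries.C : ℝ →+* LaurentSeries ℝ) = dressMat (b n ℝ + u) := by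
  rw [J_lam_eq, dressMat, cmat_add, cmat, cmat, cmat]
  abel

theorem J_lam_eq_dressMat : J n lam = dressMat (b n ℝ) := J_lam_eq

theorem lcoeff_dressMat (M : Matrix (Fin n) (Fin n) ℝ) (i : ℤ) :
    lcoeff (dressMat M) i = (if i = 0 then M else 0) + if i - 1 = 0 then e n ℝ 1 n else 0 := by
  rw [dressMat, lcoeff_add, lcoeff_lam_smul, lcoeff_cmat, lcoeff_cmat]

/-- Comparison of powers of l: the hypotheses are degrees 0 and 1, and in degree 2 both products
contribute the same square of e_{1n}. -/
theorem dressMat_mul_sub_mul {f₀ X T f' : Matrix (Fin n) (Fin n) ℝ} (h0 : f' = f₀ * X - T * f₀)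
    (h1 : e n ℝ 1 n * X + f₀ * e n ℝ 1 n = T * e n ℝ 1 n + e n ℝ 1 n * f₀) :
    cmat f' = dressMat f₀ * dressMat X - dressMat T * dressMat f₀ := by
  refine lcoeff_ext fun i => ?_
  rw [lcoeff_sub, lcoeff_dressMat_mul, lcoeff_dressMat_mul, lcoeff_cmat]
  simp only [lcoeff_dressMat]
  by_cases hi0 : i = 0
  · subst hi0
    simpa using h0
  by_cases hi1 : i = 1
  · subst hi1
    simpa [add_comm] using (sub_eq_zero.2 h1).symm
  by_cases hi2 : i = 2
  · subst hi2
    simp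
  have a1 : i - 1 ≠ 0 := by omega
  have a2 : i - 1 - 1 ≠ 0 := by omega
  simp [hi0, a1, a2]

theorem IsY.smoothLaurent {D : Set (ℝ × ℝ)} {u : ℝ → ℝ → Matrix (Fin n) (Fin n) ℝ}
    {Y : ℝ → ℝ → Matrix (Fin n) (Fin n) (LaurentSeries ℝ)} (hY : IsY n D u Y) :
    SmoothLaurent D 1 Y := by
  refine ⟨fun x t hm i p q h => ?_, hY.smooth⟩
  rw [hY.leading x t hm i p q h.le, J_lam_eq_dressMat]
  refine pdeg_dressMat (fun p q h => ?_) i p q h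
  rw [b_apply, if_neg (by omega)]

theorem conj_pow {R : Type*} [Ring R] {f fi : R} (h : fi * f = 1) (h' : f * fi = 1) (Y : R)
    (j : ℕ) : (f * Y * fi) ^ j = f * Y ^ j * fi := by
  induction j with
  | zero => simp [h']
  | succ j ih =>
    rw [pow_succ, ih, pow_succ]
    linear_combination (norm := noncomm_ring) f * Y ^ j * h * Y * fi

/-- With A = J this isolates the commutator of f and J, whose degree is one lower than that of the
product fJ. -/
theorem conj_sub {R : Type*} [Ring R] {f fi : R} (h : f * fi = 1) (Y A : R) :
    f * Y * fi - A = (f * (Y - A) + (f * A - A * f)) * fi := by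
  linear_combination (norm := noncomm_ring) A * h

/-- The polynomial part of `Y^j`, minus `ζ`. -/
def Zpol (j : ℕ) (Y : Matrix (Fin n) (Fin n) (LaurentSeries ℝ)) (ζ : Matrix (Fin n) (Fin n) ℝ) :
    Matrix (Fin n) (Fin n) (LaurentSeries ℝ) :=
  (∑ i ∈ Finset.range (j / n + 2), lam ^ i • cmat (lcoeff (Y ^ j) (i : ℤ))) - cmat ζ

theorem lcoeff_Zpol (j : ℕ) (Y : Matrix (Fin n) (Fin n) (LaurentSeries ℝ))
    (ζ : Matrix (Fin n) (Fin n) ℝ) (i : ℤ) :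
    lcoeff (Zpol j Y ζ) i = (if 0 ≤ i ∧ i < (j / n + 2 : ℕ) then lcoeff (Y ^ j) i else 0)
      - if i = 0 then ζ else 0 := by
  rw [Zpol, lcoeff_sub, lcoeff_sum, lcoeff_cmat]
  congr 1
  simp only [lcoeff_lam_pow_smul, lcoeff_cmat, sub_eq_zero]
  split_ifs with h
  · lift i to ℕ using h.1
    rw [Finset.sum_eq_single i]
    · simp
    · intro k _ hk
      rw [if_neg (by exact_mod_cast hk.symm)]
    · intro hi
      exact absurd (Finset.mem_range.2 (by exact_mod_cast h.2)) hi
  · refine Finset.sum_eq_zero fun k hk => ?_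
    rw [if_neg]
    rintro rfl
    exact h ⟨by positivity, by exact_mod_cast Finset.mem_range.1 hk⟩

/-- Negative powers of l have degree at most -n + (n-1) = -1, and ζ is strictly upper triangular.
The cutoff [j/n] + 1 loses nothing, as every entry at a higher power of l would have degree above j.
-/
theorem pdeg_pow_sub_Zpol (j : ℕ) {Y : Matrix (Fin n) (Fin n) (LaurentSeries ℝ)}
    {ζ : Matrix (Fin n) (Fin n) ℝ} (hY : PDeg 1 Y) (hζ : ∀ p q : Fin n, q ≤ p → ζ p q = 0) :
    PDeg (-1) (Y ^ j - Zpol j Y ζ) := by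
  intro i p q h
  have hp := p.isLt
  have hi : 0 ≤ i := by
    by_contra hi
    have : (n : ℤ) * i ≤ n * (-1) := mul_le_mul_of_nonneg_left (by omega) (by positivity)
    omega
  have h0 : (if i = 0 then ζ else 0) p q = 0 := by
    split_ifs with h0
    · subst h0
      exact hζ p q (by rw [Fin.le_def]; omega)
    · rfl
  rw [lcoeff_sub, lcoeff_Zpol, Matrix.sub_apply, Matrix.sub_apply, h0, sub_zero]
  by_cases hj : i < (j / n + 2 : ℕ)
  · rw [if_pos ⟨hi, hj⟩, sub_self]
  · rw [if_neg (by tauto), Matrix.zero_apply, sub_zero]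
    refine hY.pow j i p q ?_
    have h1 : (n : ℤ) * (j / n + 2 : ℕ) ≤ n * i :=
      mul_le_mul_of_nonneg_left (by omega) (by positivity)
    have h2 : j < n * (j / n) + n := by
      have := Nat.div_add_mod j n
      have := Nat.mod_lt j (show 0 < n by omega)
      omega
    have h3 : (n : ℤ) * (j / n + 2 : ℕ) = (n * (j / n) : ℕ) + 2 * n := by push_cast; ring
    have := q.isLt
    omega

/-- The dressing data `f = f₀ + l e_{1n}`, `f⁻¹ = B + l⁻¹ F` between `u` and `ũ`. -/
structure IsDressing (D : Set (ℝ × ℝ)) (u ut f₀ F B : ℝ → ℝ → Matrix (Fin n) (Fin n) ℝ) :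
    Prop where
  isOpen : IsOpen D
  smooth : SmoothMat D f₀
  smoothF : SmoothMat D F
  smoothB : SmoothMat D B
  inv : ∀ x t, (x, t) ∈ D → DressInv (f₀ x t) (e n ℝ 1 n) (F x t) (B x t)
  lower : ∀ x t, (x, t) ∈ D → ∀ p q : Fin n, q < p → f₀ x t p q = b n ℝ p q
  upper : ∀ x t, (x, t) ∈ D → ∀ p q : Fin n, q ≤ p → B x t p q = 0
  eq_x : ∀ x t, (x, t) ∈ D → dx f₀ x t
    = f₀ x t * (b n ℝ + u x t) - (b n ℝ + ut x t) * f₀ x t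
  eq_e : ∀ x t, (x, t) ∈ D → e n ℝ 1 n * (b n ℝ + u x t) + f₀ x t * e n ℝ 1 n
    = (b n ℝ + ut x t) * e n ℝ 1 n + e n ℝ 1 n * f₀ x t

namespace IsDressing

variable {D : Set (ℝ × ℝ)} {u ut f₀ F B : ℝ → ℝ → Matrix (Fin n) (Fin n) ℝ}

theorem hessenberg (h : IsDressing D u ut f₀ F B) {x t : ℝ} (hm : (x, t) ∈ D) (p q : Fin n)
    (hpq : q.val + 1 < p.val) : f₀ x t p q = 0 := by
  rw [h.lower x t hm p q (Fin.lt_def.2 (by omega)), b_apply, if_neg (by omega)]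

theorem smoothLaurent (h : IsDressing D u ut f₀ F B) :
    SmoothLaurent D 1 fun x t => dressMat (f₀ x t) :=
  SmoothLaurent.dressMat h.smooth fun _ _ hm => h.hessenberg hm

theorem smoothLaurentInv (h : IsDressing D u ut f₀ F B) :
    SmoothLaurent D (-1) fun x t => dressInvMat (F x t) (B x t) :=
  SmoothLaurent.dressInvMat h.smoothF h.smoothB h.upper

/-- Trace, n-th power and the Lax equation are preserved by conjugation. For the leading part write
f = J + N with N of degree at most 0: then f(Y-J) + [N,J] has degree at most 1, and f⁻¹ has degree
at most -1. -/
theorem isY (h : IsDressing D u ut f₀ F B)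
    {Y : ℝ → ℝ → Matrix (Fin n) (Fin n) (LaurentSeries ℝ)} (hY : IsY n D u Y) :
    IsY n D ut fun x t => dressMat (f₀ x t) * Y x t * dressInvMat (F x t) (B x t) where
  smooth := ((h.smoothLaurent.mul hY.smoothLaurent).mul h.smoothLaurentInv).smooth
  traceless x t hm := by
    rw [Matrix.trace_mul_comm, ← mul_assoc, (h.inv x t hm).inv_mul, one_mul,
      hY.traceless x t hm]
  leading x t hm := by
    have hd : PDeg 0 (Y x t - J n lam) := fun i p q hi => by
      rw [lcoeff_sub, Matrix.sub_apply, hY.leading x t hm i p q hi, sub_self]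
    have hN : PDeg 0 (cmat (f₀ x t - b n ℝ)) := pdeg_cmat fun p q hpq => by
      rw [Matrix.sub_apply, h.lower x t hm p q (Fin.lt_def.2 (by omega)), sub_self]
    have hJ : PDeg 1 (J n lam : Matrix (Fin n) (Fin n) (LaurentSeries ℝ)) := by
      rw [J_lam_eq_dressMat]
      refine pdeg_dressMat fun p q hpq => ?_
      rw [b_apply, if_neg (by omega)]
    have hfJ : dressMat (f₀ x t) = J n lam + cmat (f₀ x t - b n ℝ) := by
      rw [J_lam_eq_dressMat, dressMat, dressMat, add_right_comm, ← cmat_add, add_sub_cancel]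
    have hcomm : PDeg 1 (dressMat (f₀ x t) * J n lam - J n lam * dressMat (f₀ x t)) := by
      rw [hfJ, add_mul, mul_add, add_sub_add_left_eq_sub]
      exact ((hN.mul hJ).mono (by simp)).sub ((hJ.mul hN).mono (by simp))
    have hall : PDeg 0 (dressMat (f₀ x t) * Y x t * dressInvMat (F x t) (B x t) - J n lam) := by
      have h1 := (((h.smoothLaurent.pdeg x t hm).mul hd).add (hcomm.mono (by simp))).mul
        (h.smoothLaurentInv.pdeg x t hm)
      have h2 : dressMat (f₀ x t) * Y x t * dressInvMat (F x t) (B x t) - J n lam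
          = (dressMat (f₀ x t) * (Y x t - J n lam)
            + (dressMat (f₀ x t) * J n lam - J n lam * dressMat (f₀ x t)))
              * dressInvMat (F x t) (B x t) := by
        exact conj_sub (h.inv x t hm).mul_inv _ _
      rw [h2]
      exact h1.mono (by simp)
    intro i p q hi
    have := hall i p q (by omega)
    rwa [lcoeff_sub, Matrix.sub_apply, sub_eq_zero] at this
  lax x t hm := by
    rw [J_lam_add_eq]
    have hf : HasLaurentDeriv (fun s => dressMat (f₀ s t)) (cmat (dx f₀ x t)) x := by
      intro i
      simp only [lcoeff_dressMat, lcoeff_cmat]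
      by_cases hi : i = 0
      · subst hi
        simpa using h.smooth.hasMatDeriv_dx h.isOpen hm
      · simpa only [if_neg hi, zero_add] using HasMatDeriv.const _ x
    have hmulL : ∀ {A : ℝ → Matrix (Fin n) (Fin n) (LaurentSeries ℝ)} {A'},
        HasLaurentDeriv A A' x → HasLaurentDeriv (fun s => dressMat (f₀ s t) * A s)
          (cmat (dx f₀ x t) * A x + dressMat (f₀ x t) * A') x := by
      intro A A' hA
      have h1 := (HasLaurentDeriv.cmat_mul (h.smooth.hasMatDeriv_dx h.isOpen hm) hA).add
        ((HasLaurentDeriv.cmat_mul (HasMatDeriv.const (e n ℝ 1 n) x) hA).lam_smul)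
      simp only [cmat_zero, zero_mul, zero_add] at h1
      simp only [dressMat, add_mul, laurent_smul_mul]
      rwa [← add_assoc]
    have hmulR : ∀ {A : ℝ → Matrix (Fin n) (Fin n) (LaurentSeries ℝ)} {A'},
        HasLaurentDeriv A A' x →
          HasLaurentDeriv (fun s => A s * dressInvMat (F s t) (B s t))
          (A' * dressInvMat (F x t) (B x t) + A x * dressInvMat (dx F x t) (dx B x t)) x := by
      intro A A' hA
      have h1 := (hA.mul_cmat (h.smoothB.hasMatDeriv_dx h.isOpen hm)).add
        ((hA.mul_cmat (h.smoothF.hasMatDeriv_dx h.isOpen hm)).lamInv_smul)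
      simp only [dressInvMat, mul_add, laurent_mul_smul]
      convert h1 using 1
      have : ∀ (P Q : Matrix (Fin n) (Fin n) (LaurentSeries ℝ)),
          lamInv • (P + Q) = lamInv • P + lamInv • Q := fun P Q => by
        ext p q : 2
        simp only [Matrix.smul_apply, Matrix.add_apply, smul_eq_mul, mul_add]
      rw [this]
      abel
    have hYd : HasLaurentDeriv (fun s => Y s t)
        (-(dressMat (b n ℝ + u x t) * Y x t - Y x t * dressMat (b n ℝ + u x t))) x := by
      intro i
      have := hY.lax x t hm i
      rw [J_lam_add_eq, Ring.lie_def] at this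
      rw [lcoeff_neg, ← eq_neg_of_add_eq_zero_left this]
      exact (hY.smooth i).hasMatDeriv_dx h.isOpen hm
    have hinv := hmulR hf
    have hzero := hinv.unique ((HasLaurentDeriv.const 1 x).congr
      ((eventually_fst_mem h.isOpen hm).mono fun s hs => (h.inv s t hs).mul_inv))
    have key := lax_conj (h.inv x t hm).inv_mul (h.inv x t hm).mul_inv hzero
      (dressMat_mul_sub_mul (h.eq_x x t hm) (h.eq_e x t hm))
      (neg_add_cancel (dressMat (b n ℝ + u x t) * Y x t - Y x t * dressMat (b n ℝ + u x t)))
    intro i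
    rw [dx_eq_of_hasMatDeriv (hmulR (hmulL hYd) i), ← lcoeff_add, Ring.lie_def]
    rw [add_mul, key, lcoeff_zero]
  pow x t hm := by
    rw [conj_pow (h.inv x t hm).inv_mul (h.inv x t hm).mul_inv, hY.pow x t hm,
      laurent_mul_smul, mul_one, laurent_smul_mul, (h.inv x t hm).mul_inv]

/-- `hker` states that T = (fZ_j - f_t)f⁻¹ has no l⁻¹ term. Comparing coefficients in Tf = fZ_j -
f_t then gives the equations for f₀ in t. The V_n condition is left out here, since it will come
from zero curvature of the new frame. -/
theorem exists_laxData (h : IsDressing D u ut f₀ F B) {j : ℕ}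
    {Y : ℝ → ℝ → Matrix (Fin n) (Fin n) (LaurentSeries ℝ)}
    {ζ : ℝ → ℝ → Matrix (Fin n) (Fin n) ℝ} (hY : IsLaxData n j D u Y ζ)
    (hker : ∀ x t, (x, t) ∈ D → (f₀ x t * Zzero j Y ζ x t - dt f₀ x t) * F x t = 0) :
    ∃ Yt ζt, IsY n D ut Yt ∧ SmoothMat D ζt ∧ SmoothMat D (Zzero j Yt ζt) ∧
      (∀ x t, (x, t) ∈ D → ∀ p q : Fin n, q ≤ p → ζt x t p q = 0) ∧
      ∀ x t, (x, t) ∈ D → dt f₀ x t = f₀ x t * Zzero j Y ζ x t - Zzero j Yt ζt x t * f₀ x t ∧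
        ∃ T₁, e n ℝ 1 n * Zzero j Y ζ x t + f₀ x t * lcoeff (Y x t ^ j) 1
          = Zzero j Yt ζt x t * e n ℝ 1 n + T₁ * f₀ x t := by
  have hZneg : ∀ x t, lcoeff (Zpol j (Y x t) (ζ x t)) (-1) = 0 := fun x t => by
    simp [lcoeff_Zpol]
  have hZneg2 : ∀ x t, lcoeff (Zpol j (Y x t) (ζ x t)) (-1 - 1) = 0 := fun x t => by
    simp [lcoeff_Zpol]
  have hZ0 : ∀ x t, lcoeff (Zpol j (Y x t) (ζ x t)) 0 = Zzero j Y ζ x t := fun x t => by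
    rw [lcoeff_Zpol, if_pos ⟨le_rfl, by positivity⟩, if_pos rfl, Zzero]
  have hZ1 : ∀ x t, lcoeff (Zpol j (Y x t) (ζ x t)) 1 = lcoeff (Y x t ^ j) 1 := fun x t => by
    rw [lcoeff_Zpol, if_pos ⟨by simp, by push_cast; linarith [show 0 ≤ (j / n : ℤ) by positivity]⟩,
      if_neg one_ne_zero, sub_zero]
  let T : ℝ → ℝ → Matrix (Fin n) (Fin n) (LaurentSeries ℝ) := fun x t =>
    (dressMat (f₀ x t) * Zpol j (Y x t) (ζ x t) - cmat (dt f₀ x t))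
      * dressInvMat (F x t) (B x t)
  let Yt : ℝ → ℝ → Matrix (Fin n) (Fin n) (LaurentSeries ℝ) := fun x t =>
    dressMat (f₀ x t) * Y x t * dressInvMat (F x t) (B x t)
  -- Chosen so that the new Z_{j,0} is T₀ by definition; what remains to be proved is that this
  -- difference is strictly upper triangular.
  let ζt : ℝ → ℝ → Matrix (Fin n) (Fin n) ℝ := fun x t =>
    lcoeff (Yt x t ^ j) 0 - lcoeff (T x t) 0
  have hZt : ∀ x t, Zzero j Yt ζt x t = lcoeff (T x t) 0 := fun x t => sub_sub_cancel _ _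
  have hYs := hY.isY.smoothLaurent.pow j
  have hZs : SmoothMat D (Zzero j Y ζ) := (hYs.smooth 0).sub hY.smooth
  have hTs : SmoothMat D fun x t => lcoeff (T x t) 0 := by
    simp only [T, lcoeff_mul_dressInvMat, lcoeff_sub, lcoeff_dressMat_mul, zero_sub, zero_add,
      sub_self, hZneg, hZ0, hZ1, lcoeff_cmat, if_pos, one_ne_zero, if_false, mul_zero, add_zero,
      sub_zero]
    exact (((h.smooth.mul hZs).sub (h.smooth.dt h.isOpen)).mul h.smoothB).add
      (((h.smooth.mul (hYs.smooth 1)).add ((SmoothMat.const _).mul hZs)).mul h.smoothF)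
  have hTneg : ∀ x t, (x, t) ∈ D → lcoeff (T x t) (-1) = 0 := fun x t hm => by
    simp only [T, lcoeff_mul_dressInvMat, lcoeff_sub, lcoeff_dressMat_mul, neg_add_cancel, zero_sub,
      hZneg, hZneg2, hZ0, lcoeff_cmat, if_true, mul_zero, add_zero, neg_eq_zero, one_ne_zero,
      if_false, sub_zero, zero_mul, zero_add]
    exact hker x t hm
  have hTf : ∀ x t, (x, t) ∈ D → T x t * dressMat (f₀ x t)
      = dressMat (f₀ x t) * Zpol j (Y x t) (ζ x t) - cmat (dt f₀ x t) := fun x t hm => by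
    simp only [T]
    rw [mul_assoc, (h.inv x t hm).inv_mul, mul_one]
  refine ⟨Yt, ζt, h.isY hY.isY, (((h.isY hY.isY).smoothLaurent.pow j).smooth 0).sub hTs,
    hTs.congr fun x t _ => hZt x t, ?_, ?_⟩
  · intro x t hm p q hpq
    -- Below the diagonal f₀ is constant, so f_t has degree at most 0. Therefore (f(Y^j - Z_j) +
    -- f_t)f⁻¹ has degree at most -1, which at l⁰ means strictly upper triangular.
    have hlow : ∀ p q : Fin n, 0 < (p.val : ℤ) - q.val → dt f₀ x t p q = 0 := fun p q hpq => by
      refine (Filter.EventuallyEq.deriv_eq (f := fun _ => b n ℝ p q)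
        ((eventually_snd_mem h.isOpen hm).mono fun s hs => ?_)).trans (deriv_const _ _)
      exact h.lower x s hs p q (Fin.lt_def.2 (by omega))
    have hW : PDeg (-1) (Yt x t ^ j - T x t) := by
      have e1 : Yt x t ^ j - T x t = (dressMat (f₀ x t) * (Y x t ^ j - Zpol j (Y x t) (ζ x t))
          + cmat (dt f₀ x t)) * dressInvMat (F x t) (B x t) := by
        simp only [Yt, T]
        rw [conj_pow (h.inv x t hm).inv_mul (h.inv x t hm).mul_inv]
        simp only [sub_mul, mul_sub, add_mul]
        abel
      rw [e1]
      refine PDeg.mono ((((h.smoothLaurent.pdeg x t hm).mul (pdeg_pow_sub_Zpol j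
        (hY.isY.smoothLaurent.pdeg x t hm) (hY.upper x t hm))).add
          ((pdeg_cmat hlow).mono (by simp))).mul (h.smoothLaurentInv.pdeg x t hm)) (by simp)
    have := hW 0 p q (by rw [Fin.le_def] at hpq; omega)
    rwa [lcoeff_sub] at this
  · intro x t hm
    have c0 := congrArg (lcoeff · 0) (hTf x t hm)
    have c1 := congrArg (lcoeff · 1) (hTf x t hm)
    simp only [lcoeff_mul_dressMat, lcoeff_sub, lcoeff_dressMat_mul, zero_sub, sub_self,
      hZneg, hZ0, hZ1, lcoeff_cmat, if_true, one_ne_zero, if_false, mul_zero, add_zero, sub_zero,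
      hTneg x t hm, zero_mul, ← hZt] at c0 c1
    refine ⟨by rw [c0]; abel, lcoeff (T x t) 1, ?_⟩
    rw [add_comm, ← c1, add_comm]

end IsDressing

end LaxData

/-! ### Hessenberg matrices with unit subdiagonal -/

section Hessenberg

variable {n : ℕ} {M F B : Matrix (Fin n) (Fin n) ℝ}

/-- The parameter enters through the first row only, so multilinearity makes determinants and
cofactors affine in l. -/
theorem add_smul_e_eq_updateRow (hn : 0 < n) (M : Matrix (Fin n) (Fin n) ℝ) (l : ℝ) :
    M + l • e n ℝ 1 n = M.updateRow ⟨0, hn⟩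
      (M ⟨0, hn⟩ + l • Pi.single (⟨n - 1, by omega⟩ : Fin n) (1 : ℝ)) := by
  ext p q
  simp only [Matrix.add_apply, Matrix.smul_apply, e_apply, Matrix.updateRow_apply, Pi.add_apply,
    Pi.smul_apply, Pi.single_apply, Fin.ext_iff]
  by_cases hp : p.val = 0
  · have : p = ⟨0, hn⟩ := Fin.ext hp
    subst this
    by_cases hq : q.val + 1 = n
    · simp [show q.val = n - 1 by omega, Nat.sub_add_cancel hn]
    · simp [hq, show q.val ≠ n - 1 by omega]
  · simp [hp]

theorem det_updateRow_zero_single (hn : 0 < n) (hM : ∀ p q : Fin n, q < p → M p q = b n ℝ p q) :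
    (M.updateRow ⟨0, hn⟩ (Pi.single (⟨n - 1, by omega⟩ : Fin n) (1 : ℝ))).det
      = (-1) ^ (n - 1) := by
  obtain ⟨m, rfl⟩ : ∃ m, n = m + 1 := ⟨n - 1, by omega⟩
  rw [Matrix.det_succ_row_zero, Finset.sum_eq_single (Fin.last m)]
  · have h1 : ((M.updateRow ⟨0, hn⟩ (Pi.single (⟨m + 1 - 1, by omega⟩ : Fin (m + 1))
        (1 : ℝ))).submatrix Fin.succ (Fin.last m).succAbove).det = 1 := by
      rw [Matrix.det_of_isUpperTriangular]
      · refine Finset.prod_eq_one fun i _ => ?_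
        rw [Matrix.submatrix_apply, Matrix.updateRow_ne (by simp [Fin.ext_iff]),
          Fin.succAbove_last, hM _ _ (by simp [Fin.lt_def]), b_apply, if_pos (by simp)]
      · intro i k hik
        have hik' : k.val < i.val := hik
        rw [Matrix.submatrix_apply, Matrix.updateRow_ne (by simp [Fin.ext_iff]),
          Fin.succAbove_last, hM _ _ (by simp [Fin.lt_def]; omega), b_apply,
          if_neg (by simp; omega)]
    rw [h1, mul_one, show (0 : Fin (m + 1)) = ⟨0, hn⟩ from rfl, Matrix.updateRow_self]
    simp [Pi.single_apply, Fin.ext_iff]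
  · intro k _ hk
    rw [show (0 : Fin (m + 1)) = ⟨0, hn⟩ from rfl, Matrix.updateRow_self, Pi.single_eq_of_ne,
      mul_zero, zero_mul]
    exact fun h => hk (h.trans (Fin.ext (by simp)))
  · simp

theorem det_add_smul_e (hn : 0 < n) (hM : ∀ p q : Fin n, q < p → M p q = b n ℝ p q) (l : ℝ) :
    (M + l • e n ℝ 1 n).det = M.det + l * (-1) ^ (n - 1) := by
  rw [add_smul_e_eq_updateRow hn, Matrix.det_updateRow_add, Matrix.det_updateRow_smul,
    Matrix.updateRow_eq_self, det_updateRow_zero_single hn hM]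

/-- A cofactor either has the first row replaced, and is then independent of l, or is linear in that
row. The slope is expressed as the difference of the values at l = 1 and l = 0. -/
theorem adjugate_add_smul_e (hn : 0 < n) (M : Matrix (Fin n) (Fin n) ℝ) (l : ℝ) :
    (M + l • e n ℝ 1 n).adjugate
      = M.adjugate + l • ((M + e n ℝ 1 n).adjugate - M.adjugate) := by
  have key : ∀ l : ℝ, ∀ i k, (M + l • e n ℝ 1 n).adjugate i k = M.adjugate i k
      + l * if k = ⟨0, hn⟩ then 0 else
        ((M.updateRow ⟨0, hn⟩ (Pi.single (⟨n - 1, by omega⟩ : Fin n) (1 : ℝ))).updateRow k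
          (Pi.single i 1)).det := by
    intro l i k
    rw [Matrix.adjugate_apply, Matrix.adjugate_apply, add_smul_e_eq_updateRow hn]
    split_ifs with hk
    · subst hk
      rw [Matrix.updateRow_idem, mul_zero, add_zero]
    · rw [Matrix.updateRow_comm _ (Ne.symm hk), Matrix.det_updateRow_add,
        Matrix.det_updateRow_smul, ← Matrix.updateRow_comm _ (Ne.symm hk),
        ← Matrix.updateRow_comm _ (Ne.symm hk), Matrix.updateRow_eq_self]
  ext i k
  have h1 := key 1 i k
  rw [one_smul] at h1
  rw [key l i k, Matrix.add_apply, Matrix.smul_apply, Matrix.sub_apply, h1]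
  simp

theorem neg_one_pow_mul_self (m : ℕ) : ((-1 : ℝ) ^ m) * (-1) ^ m = 1 := by
  rw [← mul_pow]
  simp

/-- The inverse of `f₀ + l e_{1n}` for a singular Hessenberg matrix `f₀`. -/
theorem dressInv_of_det_eq_zero (hn : 0 < n) (hM : ∀ p q : Fin n, q < p → M p q = b n ℝ p q)
    (hdet : M.det = 0) :
    DressInv M (e n ℝ 1 n) ((-1 : ℝ) ^ (n - 1) • M.adjugate)
      ((-1 : ℝ) ^ (n - 1) • ((M + e n ℝ 1 n).adjugate - M.adjugate)) := by
  have hs := neg_one_pow_mul_self (n - 1)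
  -- Product with the adjugate is the determinant (-1)^{n-1}l. Both sides are quadratic in l, so the
  -- values at l = 0, 1, -1 separate the coefficients, up to a factor 2 that `two` removes.
  have hr : ∀ l : ℝ, (M + l • e n ℝ 1 n) * (M.adjugate
      + l • ((M + e n ℝ 1 n).adjugate - M.adjugate))
        = (l * (-1) ^ (n - 1)) • (1 : Matrix (Fin n) (Fin n) ℝ) := fun l => by
    rw [← adjugate_add_smul_e hn, Matrix.mul_adjugate, det_add_smul_e hn hM, hdet, zero_add]
  have hl : ∀ l : ℝ, (M.adjugate + l • ((M + e n ℝ 1 n).adjugate - M.adjugate))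
      * (M + l • e n ℝ 1 n) = (l * (-1) ^ (n - 1)) • (1 : Matrix (Fin n) (Fin n) ℝ) := fun l => by
    rw [← adjugate_add_smul_e hn, Matrix.adjugate_mul, det_add_smul_e hn hM, hdet, zero_add]
  generalize (M + e n ℝ 1 n).adjugate - M.adjugate = C at hr hl ⊢
  generalize (-1 : ℝ) ^ (n - 1) = σ at hs hr hl ⊢
  generalize e n ℝ 1 n = E at hr hl ⊢
  generalize M.adjugate = A at hr hl ⊢
  have two : ∀ X : Matrix (Fin n) (Fin n) ℝ, X + X = 0 → X = 0 := fun X h => by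
    ext p q
    have := congrFun (congrFun h p) q
    simp only [Matrix.add_apply, Matrix.zero_apply] at this ⊢
    linarith
  have r0 := hr 0
  have r1 := hr 1
  have r2 := hr (-1)
  have l0 := hl 0
  have l1 := hl 1
  have l2 := hl (-1)
  simp only [zero_smul, one_smul, neg_smul, add_zero, zero_mul, one_mul, neg_mul] at *
  have s1 : E * C = 0 := two _ (by linear_combination (norm := noncomm_ring) r1 + r2 - 2 * r0)
  have s2 : C * E = 0 := two _ (by linear_combination (norm := noncomm_ring) l1 + l2 - 2 * l0)
  have s3 : M * C + E * A = σ • (1 : Matrix (Fin n) (Fin n) ℝ) := by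
    rw [← sub_eq_zero]
    refine two _ ?_
    linear_combination (norm := noncomm_ring) r1 - r2
  have s4 : C * M + A * E = σ • (1 : Matrix (Fin n) (Fin n) ℝ) := by
    rw [← sub_eq_zero]
    refine two _ ?_
    linear_combination (norm := noncomm_ring) l1 - l2
  constructor
  · rw [Matrix.mul_smul, r0, smul_zero]
  · rw [Matrix.smul_mul, l0, smul_zero]
  · rw [Matrix.mul_smul, s1, smul_zero]
  · rw [Matrix.smul_mul, s2, smul_zero]
  · rw [Matrix.mul_smul, Matrix.mul_smul, ← smul_add, s3, smul_smul, hs, one_smul]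
  · rw [Matrix.smul_mul, Matrix.smul_mul, ← smul_add, s4, smul_smul, hs, one_smul]

/-- The engine of the descending inductions: row p+1 reads off coordinate p once the later
coordinates vanish. -/
theorem hessenberg_mulVec_eq (hM : ∀ p q : Fin n, q < p → M p q = b n ℝ p q) {y : Fin n → ℝ}
    {p p' : Fin n} (hp : p'.val = p.val + 1) (hy : ∀ k, p < k → y k = 0) :
    M.mulVec y p' = y p := by
  rw [Matrix.mulVec, dotProduct, Finset.sum_eq_single p]
  · rw [hM p' p (Fin.lt_def.2 (by omega)), b_apply, if_pos hp, one_mul]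
  · intro k _ hk
    rcases lt_or_gt_of_ne hk with h | h
    · rw [hM p' k (Fin.lt_def.2 (by rw [Fin.lt_def] at h; omega)), b_apply,
        if_neg (by rw [Fin.lt_def] at h; omega), zero_mul]
    · rw [hy k h, mul_zero]
  · simp

theorem eq_zero_of_descending {P : Fin n → Prop} (hlast : ∀ p : Fin n, p.val + 1 = n → P p)
    (hstep : ∀ p p' : Fin n, p'.val = p.val + 1 → (∀ k, p < k → P k) → P p) (p : Fin n) : P p := by
  induction hk : n - 1 - p.val using Nat.strong_induction_on generalizing p with
  | _ k ih =>
    by_cases hp : p.val + 1 = n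
    · exact hlast p hp
    · refine hstep p ⟨p.val + 1, by omega⟩ rfl fun k' hk' => ih (n - 1 - k'.val) ?_ k' rfl
      rw [Fin.lt_def] at hk'
      omega

theorem hessenberg_ker (hM : ∀ p q : Fin n, q < p → M p q = b n ℝ p q) {y : Fin n → ℝ}
    (hy : ∀ p : Fin n, M.mulVec y p = 0) (hlast : ∀ p : Fin n, p.val + 1 = n → y p = 0) :
    y = 0 := by
  refine funext fun p => eq_zero_of_descending (P := fun p => y p = 0) hlast ?_ p
  intro p p' hp h
  rw [← hessenberg_mulVec_eq hM hp h, hy]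

/-- eB = 0 kills the last row of B. Row p+1 of f₀B + eF = 1 is free of F, and its entries in columns
q ≤ p are off the diagonal, so the vanishing climbs row by row. -/
theorem DressInv.upper (hn : 0 < n) (hM : ∀ p q : Fin n, q < p → M p q = b n ℝ p q)
    (h : DressInv M (e n ℝ 1 n) F B) (p q : Fin n) (hqp : q ≤ p) : B p q = 0 := by
  revert q
  refine eq_zero_of_descending (P := fun p => ∀ q, q ≤ p → B p q = 0) ?_ ?_ p
  · intro p hp q _
    have := congrFun (congrFun h.eB ⟨0, hn⟩) q
    rw [e_mul_apply hn, if_pos rfl] at this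
    rwa [show p = ⟨n - 1, by omega⟩ from Fin.ext (by simp; omega)]
  · intro p p' hp ih q hq
    have h1 := congrFun (congrFun h.right p') q
    rw [Matrix.add_apply, e_mul_apply hn, if_neg (by omega), add_zero, Matrix.one_apply_ne] at h1
    · rw [← h1]
      exact (hessenberg_mulVec_eq hM (y := fun k => B k q) hp
        fun k hk => ih k hk q (hq.trans hk.le)).symm
    · rintro rfl
      rw [Fin.le_def] at hq
      omega

/-- The columns of the adjugate lie in the kernel, which is spanned by `v`. -/
theorem exists_eq_mul_of_hessenberg (hM : ∀ p q : Fin n, q < p → M p q = b n ℝ p q)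
    {v : Fin n → ℝ} (hv : M.mulVec v = 0) {m : Fin n} (hm : m.val + 1 = n) (hvm : v m ≠ 0)
    (hF : M * F = 0) (q : Fin n) : ∃ c : ℝ, ∀ p, F p q = c * v p := by
  refine ⟨F m q / v m, fun p => ?_⟩
  have h := hessenberg_ker hM (y := (fun p => F p q) - (F m q / v m) • v) ?_ ?_
  · have := congrFun h p
    simpa [sub_eq_zero] using this
  · intro p
    rw [Matrix.mulVec_sub, Matrix.mulVec_smul, hv, smul_zero, sub_zero]
    exact congrFun (congrFun hF p) q
  · intro p hp
    have : p = m := Fin.ext (by omega)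
    subst this
    simp [hvm]

/-- Reduces the vanishing of each residue CF to the vector identity Cv = 0, since the columns of F
are multiples of v. -/
theorem mul_eq_zero_of_mulVec (hM : ∀ p q : Fin n, q < p → M p q = b n ℝ p q)
    {v : Fin n → ℝ} (hv : M.mulVec v = 0) {m : Fin n} (hm : m.val + 1 = n) (hvm : v m ≠ 0)
    (hF : M * F = 0) {C : Matrix (Fin n) (Fin n) ℝ} (hC : C.mulVec v = 0) : C * F = 0 := by
  ext p q
  obtain ⟨c, hc⟩ := exists_eq_mul_of_hessenberg hM hv hm hvm hF q
  have h1 : (C * F) p q = c * C.mulVec v p := by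
    simp only [Matrix.mul_apply, Matrix.mulVec, dotProduct, hc, Finset.mul_sum]
    exact Finset.sum_congr rfl fun k _ => by ring
  rw [h1, hC]
  simp

end Hessenberg

/-! ### The matrix f_{u,h} and its equation in x -/

section BT

variable {n : ℕ} {D : Set (ℝ × ℝ)} {u : ℝ → ℝ → Matrix (Fin n) (Fin n) ℝ} {h : ℝ → ℝ → ℝ}

theorem coef_eq (M : Matrix (Fin n) (Fin n) ℝ) (p q : Fin n) (hq : q.val + 1 = n) :
    coef M (p.val + 1) = M p q := by
  rw [coef, dif_pos ⟨by omega, by omega⟩]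
  congr 1
  exact Fin.ext (by simp; omega)

theorem coef_top {M : Matrix (Fin n) (Fin n) ℝ} (hM : InV M) (hn : 0 < n) : coef M n = 0 := by
  rw [coef, dif_pos ⟨hn, le_rfl⟩]
  exact hM _ _ (Or.inr (by simp; omega))

theorem SmoothMat.coef (hu : SmoothMat D u) (i : ℕ) : SmoothFun D fun x t => coef (u x t) i := by
  unfold CentralAffine.coef
  split_ifs
  · exact hu _ _
  · exact SmoothFun.const 0

theorem smoothFun_btCurv (hD : IsOpen D) (hu : SmoothMat D u) (hh : SmoothFun D h) (k : ℕ) :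
    SmoothFun D (btCurv n u h k) := by
  induction k with
  | zero => exact SmoothFun.const 0
  | succ k ih =>
    unfold btCurv
    exact ((((hu.coef _).add (SmoothFun.sum fun m _ => ((SmoothFun.const _).mul (hu.coef m)).mul
      (hh.iteratedDeriv hD _))).sub ((SmoothFun.const _).mul (hh.iteratedDeriv hD _))).sub
        (ih.deriv_fst hD)).sub (ih.mul hh)

/-- The transformed curvature `ũ`. -/
def btCurvature (n : ℕ) (u : ℝ → ℝ → Matrix (Fin n) (Fin n) ℝ) (h : ℝ → ℝ → ℝ) (x t : ℝ) :
    Matrix (Fin n) (Fin n) ℝ :=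
  Matrix.of fun p q => if q.val + 1 = n then btCurv n u h (n - (p.val + 1)) x t else 0

theorem btCurvature_inV (n : ℕ) (u : ℝ → ℝ → Matrix (Fin n) (Fin n) ℝ) (h : ℝ → ℝ → ℝ) (x t : ℝ) :
    InV (btCurvature n u h x t) := by
  intro p q hpq
  rw [btCurvature, Matrix.of_apply]
  split_ifs with hq
  · rw [hpq.resolve_left (fun h => h hq), Nat.sub_self, btCurv]
  · rfl

theorem smoothMat_btCurvature (hD : IsOpen D) (hu : SmoothMat D u) (hh : SmoothFun D h) :
    SmoothMat D (btCurvature n u h) := by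
  intro p q
  simp only [btCurvature, Matrix.of_apply]
  split_ifs
  · exact smoothFun_btCurv hD hu hh _
  · exact SmoothFun.const 0

theorem btMatrix_of_le (x t : ℝ) {p q : Fin n} (hpq : p.val ≤ q.val) :
    btMatrix n u h x t 0 p q
      = (q.val.choose p.val : ℝ) * iteratedDeriv (q.val - p.val) (fun s => h s t) x
        + if q.val + 1 = n then btCurv n u h (n - (p.val + 1)) x t else 0 := by
  rw [btMatrix, Matrix.add_apply, Matrix.add_apply, J, zero_smul, zero_add, b_apply,
    Matrix.smul_apply, Matrix.of_apply, if_neg (by omega)]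
  rcases hpq.lt_or_eq with hlt | heq
  · rw [Matrix.one_apply_ne (fun h => by rw [h] at hlt; omega), if_pos (Fin.lt_def.2 hlt)]
    simp
  · have : p = q := Fin.ext heq
    subst this
    rw [Matrix.one_apply_eq, if_neg (lt_irrefl p)]
    split_ifs with hp
    · simp [hp, btCurv]
    · simp

theorem btMatrix_lower (x t : ℝ) (p q : Fin n) (hqp : q < p) :
    btMatrix n u h x t 0 p q = b n ℝ p q := by
  rw [btMatrix, Matrix.add_apply, Matrix.add_apply, J, zero_smul, zero_add,
    Matrix.smul_apply, Matrix.of_apply, Matrix.one_apply_ne hqp.ne', if_neg hqp.asymm]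
  simp

theorem btMatrix_of_gt (x t : ℝ) {p q : Fin n} (hqp : q.val < p.val) :
    btMatrix n u h x t 0 p q = if p.val = q.val + 1 then 1 else 0 := by
  rw [btMatrix_lower x t p q (Fin.lt_def.2 hqp), b_apply]

theorem smoothMat_btMatrix (hD : IsOpen D) (hu : SmoothMat D u) (hh : SmoothFun D h) :
    SmoothMat D fun x t => btMatrix n u h x t 0 := by
  intro p q
  rcases Nat.lt_or_ge q.val p.val with hqp | hpq
  · simp only [btMatrix_of_gt _ _ hqp]
    exact SmoothFun.const _
  · simp only [btMatrix_of_le _ _ hpq]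
    refine SmoothFun.add ((SmoothFun.const _).mul (hh.iteratedDeriv hD _))
      (k := fun x t => if q.val + 1 = n then btCurv n u h (n - (p.val + 1)) x t else 0) ?_
    split_ifs
    · exact smoothFun_btCurv hD hu hh _
    · exact SmoothFun.const 0

theorem btMatrix_mul_last {x t : ℝ} {u₀ : Matrix (Fin n) (Fin n) ℝ} (hu : InV u₀) (p q : Fin n)
    (hq : q.val + 1 = n) :
    (btMatrix n u h x t 0 * u₀) p q = (if 1 ≤ p.val then coef u₀ p.val else 0)
      + ∑ m ∈ Finset.Icc (p.val + 1) (n - 1), ((m - 1).choose p.val : ℝ) * coef u₀ m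
          * iteratedDeriv (m - (p.val + 1)) (fun s => h s t) x := by
  have hn : 0 < n := by omega
  rw [Matrix.mul_apply]
  have e1 : ∀ k : Fin n, btMatrix n u h x t 0 p k * u₀ k q
      = (if p.val = k.val + 1 then coef u₀ (k.val + 1) else 0)
        + if p.val ≤ k.val ∧ k.val + 1 < n then (k.val.choose p.val : ℝ) * coef u₀ (k.val + 1)
          * iteratedDeriv (k.val - p.val) (fun s => h s t) x else 0 := by
    intro k
    rw [← coef_eq u₀ k q hq]
    rcases Nat.lt_or_ge k.val p.val with hkp | hpk
    · rw [btMatrix_of_gt _ _ hkp,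
        if_neg (by omega : ¬ (p.val ≤ k.val ∧ k.val + 1 < n)), add_zero]
      split_ifs <;> simp
    · rw [btMatrix_of_le _ _ hpk, if_neg (by omega : p.val ≠ k.val + 1), zero_add]
      by_cases h3 : k.val + 1 = n
      · rw [h3, coef_top hu hn, if_neg (by omega : ¬ (p.val ≤ k.val ∧ n < n)), mul_zero]
      · rw [if_neg h3, if_pos ⟨hpk, by omega⟩]
        ring
  rw [Finset.sum_congr rfl fun k _ => e1 k, Finset.sum_add_distrib]
  congr 1
  · split_ifs with hp
    · rw [Finset.sum_eq_single ⟨p.val - 1, by omega⟩]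
      · simp [Nat.sub_add_cancel hp]
      · intro k _ hk
        rw [if_neg]
        exact fun h => hk (Fin.ext (by simp; omega))
      · simp
    · exact Finset.sum_eq_zero fun k _ => if_neg (by omega)
  · rw [Fin.sum_univ_eq_sum_range (fun k => if p.val ≤ k ∧ k + 1 < n then
      (k.choose p.val : ℝ) * coef u₀ (k + 1)
        * iteratedDeriv (k - p.val) (fun s => h s t) x else 0) n, ← Finset.sum_filter]
    refine Finset.sum_nbij' (fun k => k + 1) (fun m => m - 1) ?_ ?_ ?_ ?_ ?_
    · intro k hk
      simp only [Finset.mem_filter, Finset.mem_range] at hk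
      simp only [Finset.mem_Icc]
      omega
    · intro m hm
      simp only [Finset.mem_Icc] at hm
      simp only [Finset.mem_filter, Finset.mem_range]
      omega
    · intro k _
      rfl
    · intro m hm
      simp only [Finset.mem_Icc] at hm
      show m - 1 + 1 = m
      omega
    · intro k _
      simp [Nat.add_sub_add_right]

/-- The first-order equation of `f`, up to its entry in the upper right corner. -/
theorem dx_btMatrix_apply (hD : IsOpen D) (hu : SmoothMat D u) (huV : ∀ x t, (x, t) ∈ D →
    InV (u x t)) (hh : SmoothFun D h) {x t : ℝ} (hm : (x, t) ∈ D) (p q : Fin n)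
    (hpq : 0 < p.val ∨ q.val + 1 ≠ n) :
    dx (fun x t => btMatrix n u h x t 0) x t p q
      = (btMatrix n u h x t 0 * (b n ℝ + u x t)
        - (b n ℝ + btCurvature n u h x t) * btMatrix n u h x t 0) p q := by
  have hp := p.isLt
  have hlast : (btCurvature n u h x t * btMatrix n u h x t 0) p q
      = btCurv n u h (n - (p.val + 1)) x t * btMatrix n u h x t 0 ⟨n - 1, by omega⟩ q := by
    rw [Matrix.mul_apply, Finset.sum_eq_single ⟨n - 1, by omega⟩]
    · rw [btCurvature, Matrix.of_apply, if_pos (by simp; omega)]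
    · intro k _ hk
      rw [btCurvature, Matrix.of_apply, if_neg, zero_mul]
      exact fun h => hk (Fin.ext (by simp; omega))
    · simp
  rw [mul_add, add_mul, Matrix.sub_apply, Matrix.add_apply, Matrix.add_apply, hlast, mul_b_apply,
    b_mul_apply]
  have hI : ∀ m, HasDerivAt (fun s => iteratedDeriv m (fun s => h s t) s)
      (iteratedDeriv (m + 1) (fun s => h s t) x) x := fun m => by
    rw [iteratedDeriv_succ]
    exact (hh.iteratedDeriv hD m).hasDerivAt_fst hD hm
  have hC : ∀ k, HasDerivAt (fun s => btCurv n u h k s t)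
      (deriv (fun s => btCurv n u h k s t) x) x := fun k =>
    (smoothFun_btCurv hD hu hh k).hasDerivAt_fst hD hm
  rw [show dx (fun x t => btMatrix n u h x t 0) x t p q
    = deriv (fun s => btMatrix n u h s t 0 p q) x from rfl]
  by_cases hq : q.val + 1 < n
  · rw [dif_pos hq, mul_inV_apply (huV x t hm) _ _ _ hq.ne, add_zero,
      btMatrix_of_gt (p := ⟨n - 1, _⟩) _ _ (by simp; omega)]
    rcases Nat.lt_or_ge q.val p.val with hqp | hpq
    · simp only [btMatrix_of_gt _ _ hqp, deriv_const]
      rw [dif_pos (by omega)]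
      by_cases h1 : p.val = q.val + 1
      · rw [btMatrix_of_le _ _ (by simp; omega), btMatrix_of_le _ _ (by simp; omega)]
        simp only [h1]
        by_cases h2 : n - 1 = q.val + 1
        · simp [show n - (q.val + 1 + 1) = 0 by omega, btCurv, hq.ne]
        · simp [h2, show q.val + 1 + 1 ≠ n by omega, hq.ne]
      · rw [btMatrix_of_gt _ _ (by simp; omega), btMatrix_of_gt _ _ (by simp; omega)]
        by_cases h2 : p.val = q.val + 1 + 1
        · simp [h2, show n - 1 ≠ q.val + 1 by omega]
        · simp [h2, show p.val - 1 ≠ q.val + 1 by omega, show n - 1 ≠ q.val + 1 by omega]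
    · simp only [btMatrix_of_le _ _ hpq, if_neg hq.ne]
      rw [btMatrix_of_le _ _ (by simp; omega)]
      have hL : deriv (fun s => (q.val.choose p.val : ℝ)
          * iteratedDeriv (q.val - p.val) (fun s => h s t) s + 0) x
            = (q.val.choose p.val : ℝ) * iteratedDeriv (q.val - p.val + 1) (fun s => h s t) x := by
        simpa using ((hI (q.val - p.val)).const_mul (q.val.choose p.val : ℝ)).deriv
      -- In the column before the last, the term ũ_i in the last column of f, shifted by b, is
      -- matched by ũf through the subdiagonal entry 1 of the last row.
      have hcorner : (if q.val + 1 + 1 = n then btCurv n u h (n - (p.val + 1)) x t else 0)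
          = btCurv n u h (n - (p.val + 1)) x t * if n - 1 = q.val + 1 then 1 else 0 := by
        by_cases h2 : n - 1 = q.val + 1
        · rw [if_pos h2, if_pos (by omega), mul_one]
        · rw [if_neg h2, if_neg (by omega), mul_zero]
      rw [hL]
      simp only [hcorner]
      rw [show q.val + 1 - p.val = q.val - p.val + 1 by omega]
      by_cases h0 : 0 < p.val
      -- On and above the diagonal, before the last column, the equation is Pascal's rule.
      · obtain ⟨r, hr⟩ : ∃ r, p.val = r + 1 := ⟨p.val - 1, by omega⟩
        rw [dif_pos h0, btMatrix_of_le _ _ (by simp; omega), if_neg hq.ne]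
        simp only
        rw [show q.val - (p.val - 1) = q.val - p.val + 1 by omega,
          hr, Nat.add_sub_cancel, Nat.choose_succ_succ' q.val r]
        push_cast
        ring
      · rw [dif_neg h0]
        simp [show p.val = 0 by omega]
  · have hqn : q.val + 1 = n := by omega
    have h0 : 0 < p.val := hpq.resolve_right (fun h => h hqn)
    obtain ⟨r, hr⟩ : ∃ r, p.val = r + 1 := ⟨p.val - 1, by omega⟩
    obtain ⟨k, hk⟩ : ∃ k, n = k + 1 + p.val := ⟨n - 1 - p.val, by omega⟩
    simp only [btMatrix_of_le _ _ (show p.val ≤ q.val by omega), if_pos hqn]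
    rw [dif_neg hq, zero_add, btMatrix_mul_last (huV x t hm) p q hqn, dif_pos h0,
      btMatrix_of_le _ _ (by simp; omega), btMatrix_of_le (p := ⟨n - 1, _⟩) _ _ (by simp; omega)]
    simp only [if_pos hqn]
    rw [if_pos (by omega : 1 ≤ p.val), show n - (p.val + 1) = k by omega,
      show n - (p.val - 1 + 1) = k + 1 by omega,
      show q.val - p.val = k by omega, show q.val - (p.val - 1) = k + 1 by omega,
      show q.val - (n - 1) = 0 by omega, show n - (n - 1 + 1) = 0 by omega,
      show n - 1 = q.val by omega, Nat.choose_self, iteratedDeriv_zero]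
    have hL := (((hI k).const_mul (q.val.choose p.val : ℝ)).add (hC k)).deriv
    refine hL.trans ?_
    -- In the last column the equation is the recursion defining ũ; row p+1, counted from 1,
    -- determines ũ_p.
    have e1 : btCurv n u h (k + 1) x t = coef (u x t) p.val
        + ∑ m ∈ Finset.Icc (p.val + 1) q.val, ((m - 1).choose p.val : ℝ) * coef (u x t) m
          * iteratedDeriv (m - (p.val + 1)) (fun s => h s t) x
        - (n.choose p.val : ℝ) * iteratedDeriv (k + 1) (fun s => h s t) x
        - deriv (fun s => btCurv n u h k s t) x - btCurv n u h k x t * h x t := by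
      rw [btCurv, show n - k - 1 = p.val by omega, show n - k = p.val + 1 by omega,
        show n - 1 = q.val by omega]
    have e2 : (n.choose p.val : ℝ) = q.val.choose (p.val - 1) + q.val.choose p.val := by
      rw [hr, Nat.add_sub_cancel, ← Nat.cast_add, ← Nat.choose_succ_succ' q.val r]
      simp only [hqn]
    rw [e1, e2]
    simp only [btCurv]
    push_cast
    ring

/-- If `v_x = -(b + u) v` and `h = -v_{n-1} / v_n`, then `v` lies in the kernel of `f` at `l = 0`,
and `f` satisfies its first-order equation. -/
theorem btMatrix_mulVec_eq_zero_and_dx (hn : 2 ≤ n) (hD : IsOpen D) (hu : SmoothMat D u)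
    (huV : ∀ x t, (x, t) ∈ D → InV (u x t)) (hh : SmoothFun D h) {v : ℝ → ℝ → Fin n → ℝ}
    (hv : ∀ x t, (x, t) ∈ D → ∀ p, HasDerivAt (fun s => v s t p)
      ((-((b n ℝ + u x t).mulVec (v x t))) p) x)
    (hv0 : ∀ x t, (x, t) ∈ D → v x t ⟨n - 1, by omega⟩ ≠ 0)
    (hhv : ∀ x t, (x, t) ∈ D → v x t ⟨n - 2, by omega⟩ + h x t * v x t ⟨n - 1, by omega⟩ = 0)
    {x t : ℝ} (hm : (x, t) ∈ D) :
    (btMatrix n u h x t 0).mulVec (v x t) = 0 ∧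
      dx (fun x t => btMatrix n u h x t 0) x t = btMatrix n u h x t 0 * (b n ℝ + u x t)
        - (b n ℝ + btCurvature n u h x t) * btMatrix n u h x t 0 := by
  have hn0 : 0 < n := by omega
  let f : ℝ → ℝ → Matrix (Fin n) (Fin n) ℝ := fun x t => btMatrix n u h x t 0
  have hf : SmoothMat D f := smoothMat_btMatrix hD hu hh
  let w : ℝ → ℝ → Fin n → ℝ := fun x t => (f x t).mulVec (v x t)
  -- The recursion does not cover the entry (1,n): r is the unknown defect there. It appears as an
  -- inhomogeneous term, in the first row only, of the equation for w = fv.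
  let r : ℝ → ℝ → ℝ := fun x t => dx f x t ⟨0, hn0⟩ ⟨n - 1, by omega⟩
    - (f x t * (b n ℝ + u x t) - (b n ℝ + btCurvature n u h x t) * f x t)
      ⟨0, hn0⟩ ⟨n - 1, by omega⟩
  have hdx : ∀ x t, (x, t) ∈ D → dx f x t = f x t * (b n ℝ + u x t)
      - (b n ℝ + btCurvature n u h x t) * f x t + r x t • e n ℝ 1 n := by
    intro x t hm
    ext p q
    by_cases hpq : 0 < p.val ∨ q.val + 1 ≠ n
    · rw [dx_btMatrix_apply hD hu huV hh hm p q hpq, Matrix.add_apply, Matrix.smul_apply, e_apply,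
        if_neg (by omega), smul_zero, add_zero]
    · have hp : p = ⟨0, hn0⟩ := Fin.ext (by simp; omega)
      have hq : q = ⟨n - 1, by omega⟩ := Fin.ext (by simp; omega)
      rw [Matrix.add_apply, Matrix.smul_apply, e_apply, if_pos (by omega), hp, hq]
      simp [r]
  have hwx : ∀ x t, (x, t) ∈ D → ∀ p, HasDerivAt (fun s => w s t p)
      (-((b n ℝ + btCurvature n u h x t).mulVec (w x t) p)
        + if p.val = 0 then r x t * v x t ⟨n - 1, by omega⟩ else 0) x := by
    intro x t hm p
    refine ((hf.hasMatDeriv_dx hD hm).mulVec (hv x t hm) p).congr_deriv ?_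
    have he : (e n ℝ 1 n).mulVec (v x t) p
        = if p.val = 0 then v x t ⟨n - 1, by omega⟩ else 0 := by
      have := e_mul_apply hn0 (Matrix.of fun i _ => v x t i : Matrix (Fin n) (Fin n) ℝ) p p
      simpa [Matrix.mul_apply, Matrix.mulVec, dotProduct] using this
    rw [hdx x t hm, Matrix.add_mulVec, Matrix.sub_mulVec, Matrix.mulVec_neg, Matrix.mulVec_mulVec,
      Matrix.smul_mulVec, ← Matrix.mulVec_mulVec (v x t) (b n ℝ + btCurvature n u h x t)]
    simp only [Pi.add_apply, Pi.sub_apply, Pi.neg_apply, Pi.smul_apply, he, smul_eq_mul, mul_ite,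
      mul_zero]
    ring
  -- The last row of f₀ is (0,…,0,1,h), so this is the definition of h. It also disposes of ũw,
  -- since ũ is supported in the last column.
  have hwlast : ∀ x t, (x, t) ∈ D → w x t ⟨n - 1, by omega⟩ = 0 := by
    intro x t hm
    show (f x t).mulVec (v x t) ⟨n - 1, by omega⟩ = 0
    rw [Matrix.mulVec, dotProduct, ← Finset.sum_subset (Finset.subset_univ
      {⟨n - 2, by omega⟩, ⟨n - 1, by omega⟩}), Finset.sum_pair (by simp [Fin.ext_iff]; omega)]
    · rw [← hhv x t hm]
      congr 2
      · rw [show f x t = btMatrix n u h x t 0 from rfl, btMatrix_of_gt _ _ (by simp; omega),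
          if_pos (by simp; omega), one_mul]
      · rw [show f x t = btMatrix n u h x t 0 from rfl, btMatrix_of_le _ _ le_rfl]
        simp [show n - (n - 1 + 1) = 0 by omega, btCurv]
    · intro k _ hk
      simp only [Finset.mem_insert, Finset.mem_singleton, Fin.ext_iff, not_or] at hk
      have := k.isLt
      rw [show f x t = btMatrix n u h x t 0 from rfl, btMatrix_of_gt _ _ (by simp; omega),
        if_neg (by simp; omega), zero_mul]
  have hut : ∀ x t, (x, t) ∈ D → (btCurvature n u h x t).mulVec (w x t) = 0 := by
    intro x t hm
    ext p
    rw [Matrix.mulVec, dotProduct, Pi.zero_apply]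
    refine Finset.sum_eq_zero fun k _ => ?_
    by_cases hk : k.val + 1 = n
    · rw [show k = ⟨n - 1, by omega⟩ from Fin.ext (by simp; omega), hwlast x t hm, mul_zero]
    · rw [btCurvature_inV n u h x t p k (Or.inl hk), zero_mul]
  have hw : ∀ p : Fin n, ∀ x t, (x, t) ∈ D → w x t p = 0 := by
    intro p
    refine eq_zero_of_descending (P := fun p => ∀ x t, (x, t) ∈ D → w x t p = 0) ?_ ?_ p
    · intro p hp x t hm
      rw [show p = ⟨n - 1, by omega⟩ from Fin.ext (by simp; omega), hwlast x t hm]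
    -- Row p+1 ≥ 2 of the equation reads ∂_x w_{p+1} = -w_p (indices from 1), so vanishing on the
    -- open set D descends.
    · intro p p' hp ih x t hm
      have h1 := (hwx x t hm p').unique ((hasDerivAt_const x (0 : ℝ)).congr_of_eventuallyEq
        ((eventually_fst_mem hD hm).mono fun s hs => ih p' (Fin.lt_def.2 (by omega)) s t hs))
      rw [Matrix.add_mulVec, hut x t hm, add_zero, if_neg (by omega), add_zero, b_mulVec_apply,
        dif_pos (by omega), neg_eq_zero] at h1
      rw [← h1]
      congr 1
      exact Fin.ext (by simp; omega)
  -- With w = 0 the first row leaves r v_n = 0, and v_n does not vanish on D.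
  have hr : r x t = 0 := by
    have h1 := (hwx x t hm ⟨0, hn0⟩).unique ((hasDerivAt_const x (0 : ℝ)).congr_of_eventuallyEq
        ((eventually_fst_mem hD hm).mono fun s hs => hw ⟨0, hn0⟩ s t hs))
    rw [Matrix.add_mulVec, hut x t hm, add_zero, if_pos rfl, b_mulVec_apply, dif_neg (by simp),
      neg_zero, zero_add] at h1
    exact (mul_eq_zero.1 h1).resolve_right (hv0 x t hm)
  refine ⟨funext fun p => hw p x t hm, ?_⟩
  have := hdx x t hm
  rwa [hr, zero_smul, add_zero] at this

/-- The coefficient of λ in f_x = f(J+u) - (J+ũ)f, whose left side has none. Both corners of f₀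
involved carry the same h, and u, ũ have no (n,n) entry and vanish in the first column. -/
theorem btMatrix_eq_e (hn : 2 ≤ n) {x t : ℝ} (hu : InV (u x t)) :
    e n ℝ 1 n * (b n ℝ + u x t) + btMatrix n u h x t 0 * e n ℝ 1 n
      = (b n ℝ + btCurvature n u h x t) * e n ℝ 1 n + e n ℝ 1 n * btMatrix n u h x t 0 := by
  have hn0 : 0 < n := by omega
  ext p q
  have hp := p.isLt
  have hq := q.isLt
  rw [Matrix.add_apply, Matrix.add_apply, e_mul_apply hn0, e_mul_apply hn0, mul_e_apply hn0,
    mul_e_apply hn0, Matrix.add_apply, Matrix.add_apply, hu _ _ (Or.inr (by simp; omega)),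
    btCurvature_inV n u h x t _ _ (Or.inl (by simp; omega)), b_apply, b_apply]
  have h1 : btMatrix n u h x t 0 p ⟨0, hn0⟩
      = if p.val = 0 then h x t else if p.val = 1 then 1 else 0 := by
    rcases Nat.eq_zero_or_pos p.val with h0 | h0
    · rw [btMatrix_of_le _ _ (by simp [h0])]
      simp [h0, show 1 ≠ n by omega]
    · rw [btMatrix_of_gt _ _ (by simpa using h0)]
      simp [h0.ne']
  have h2 : btMatrix n u h x t 0 ⟨n - 1, by omega⟩ q
      = if q.val + 1 = n then h x t else if q.val + 2 = n then 1 else 0 := by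
    by_cases h0 : q.val + 1 = n
    · rw [btMatrix_of_le _ _ (by simp; omega)]
      simp [show n - 1 = q.val by omega, btCurv, h0]
    · rw [btMatrix_of_gt _ _ (by simp; omega), if_neg h0]
      simp only [show n - 1 = q.val + 1 ↔ q.val + 2 = n by omega]
  rw [h1, h2]
  simp only [show n - 1 = q.val + 1 ↔ q.val + 2 = n by omega]
  by_cases a1 : p.val = 0 <;> by_cases a2 : q.val + 1 = n <;> by_cases a3 : q.val + 2 = n <;>
    simp [a1, a2, a3]
  all_goals omega

end BT

/-! ### The frame E to first order at λ = 0 -/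

section Jet

variable {n : ℕ}

theorem HasMatDeriv.ofReal {M : ℝ → Matrix (Fin n) (Fin n) ℝ} {M' : Matrix (Fin n) (Fin n) ℝ}
    {s : ℝ} (h : HasMatDeriv M M' s) :
    HasMatDeriv (fun r => (M r).map Complex.ofReal) (M'.map Complex.ofReal) s :=
  fun p q => (h p q).ofReal_comp

theorem HasMatDeriv.re {M : ℝ → Matrix (Fin n) (Fin n) ℂ} {M' : Matrix (Fin n) (Fin n) ℂ}
    {s : ℝ} (h : HasMatDeriv M M' s) :
    HasMatDeriv (fun r => (M r).map Complex.re) (M'.map Complex.re) s :=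
  fun p q => Complex.reCLM.hasFDerivAt.comp_hasDerivAt s (h p q)

theorem map_ofReal_mul (A B : Matrix (Fin n) (Fin n) ℝ) :
    (A * B).map Complex.ofReal = A.map Complex.ofReal * B.map Complex.ofReal :=
  Matrix.map_mul (f := Complex.ofRealHom)

theorem map_ofReal_add (A B : Matrix (Fin n) (Fin n) ℝ) :
    (A + B).map Complex.ofReal = A.map Complex.ofReal + B.map Complex.ofReal :=
  Matrix.map_add _ Complex.ofReal_add _ _

theorem map_ofReal_neg (A : Matrix (Fin n) (Fin n) ℝ) :
    (-A).map Complex.ofReal = -A.map Complex.ofReal := by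
  ext
  simp

theorem map_ofReal_one : (1 : Matrix (Fin n) (Fin n) ℝ).map Complex.ofReal = 1 :=
  Matrix.map_one _ Complex.ofReal_zero Complex.ofReal_one

theorem map_ofReal_b : (b n ℝ).map Complex.ofReal = b n ℂ := map_b Complex.ofRealHom

theorem map_ofReal_e (i j : ℕ) : (e n ℝ i j).map Complex.ofReal = e n ℂ i j :=
  map_e Complex.ofRealHom i j

theorem map_re_ofReal (A : Matrix (Fin n) (Fin n) ℝ) :
    (A.map Complex.ofReal).map Complex.re = A := by
  ext
  simp

theorem eq_of_hasMatDeriv_zero {A : Type*} [NormedRing A] [NormedAlgebra ℝ A]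
    {M : ℝ → Matrix (Fin n) (Fin n) A} (h : ∀ s, HasMatDeriv M 0 s) (r s : ℝ) : M r = M s :=
  Matrix.ext fun p q => is_const_of_deriv_eq_zero (fun s => (h s p q).differentiableAt)
    (fun s => (h s p q).deriv) r s

/-- Two solutions of a linear differential equation. -/
theorem mul_inv_eq_of_hasMatDeriv {A : Type*} [NormedRing A] [NormedAlgebra ℝ A]
    {M N X : ℝ → Matrix (Fin n) (Fin n) A} (hM : ∀ s, HasMatDeriv M (M s * X s) s)
    (hN : ∀ s, HasMatDeriv N (-(X s * N s)) s) (r s : ℝ) : M r * N r = M s * N s := by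
  refine eq_of_hasMatDeriv_zero (M := fun s => M s * N s) (fun s => ?_) r s
  have := (hM s).mul (hN s)
  rwa [mul_neg, mul_assoc, add_neg_cancel] at this

theorem deriv_matrix_mul {E Z : ℂ → Matrix (Fin n) (Fin n) ℂ} {E' Z' : Matrix (Fin n) (Fin n) ℂ}
    {l : ℂ} (hE : ∀ p q, HasDerivAt (fun l => E l p q) (E' p q) l)
    (hZ : ∀ p q, HasDerivAt (fun l => Z l p q) (Z' p q) l) (p q : Fin n) :
    HasDerivAt (fun l => (E l * Z l) p q) ((E' * Z l + E l * Z') p q) l := by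
  simp only [Matrix.mul_apply, Matrix.add_apply, ← Finset.sum_add_distrib]
  exact HasDerivAt.fun_sum fun k _ => (hE p k).mul (hZ k q)

theorem J_apply {R : Type*} [CommRing R] (l : R) (p q : Fin n) :
    J n l p q = l * e n R 1 n p q + b n R p q := rfl

theorem hasDerivAt_J (l : ℂ) (p q : Fin n) :
    HasDerivAt (fun l => J n l p q) (e n ℂ 1 n p q) l := by
  simp only [J_apply]
  simpa using ((hasDerivAt_id l).mul_const (e n ℂ 1 n p q)).add_const (b n ℂ p q)

variable {j : ℕ} {Y : ℝ → ℝ → Matrix (Fin n) (Fin n) (LaurentSeries ℝ)}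
  {ζ : ℝ → ℝ → Matrix (Fin n) (Fin n) ℝ}

theorem Zeval_apply (x t : ℝ) (l : ℂ) (p q : Fin n) :
    Zeval j Y ζ x t l p q = (∑ i ∈ Finset.range (j / n + 2),
      l ^ i * (lcoeff (Y x t ^ j) (i : ℤ) p q : ℂ)) - (ζ x t p q : ℂ) := by
  rw [Zeval, Matrix.sub_apply, Matrix.sum_apply]
  rfl

theorem Zeval_zero (x t : ℝ) :
    Zeval j Y ζ x t 0 = (Zzero j Y ζ x t).map Complex.ofReal := by
  ext p q
  rw [Zeval_apply, Finset.sum_range_succ', Finset.sum_eq_zero]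
  · simp [Zzero]
  · intro i _
    simp

theorem hasDerivAt_Zeval (x t : ℝ) (p q : Fin n) :
    HasDerivAt (fun l => Zeval j Y ζ x t l p q)
      ((lcoeff (Y x t ^ j) 1 p q : ℝ) : ℂ) 0 := by
  simp only [Zeval_apply]
  have h : HasDerivAt (fun l : ℂ => (∑ i ∈ Finset.range (j / n + 2),
      l ^ i * (lcoeff (Y x t ^ j) (i : ℤ) p q : ℂ)) - (ζ x t p q : ℂ))
      (∑ i ∈ Finset.range (j / n + 2), ((i : ℂ) * 0 ^ (i - 1))
        * (lcoeff (Y x t ^ j) (i : ℤ) p q : ℂ)) 0 :=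
    (HasDerivAt.fun_sum fun i _ => (hasDerivAt_pow i (0 : ℂ)).mul_const _).sub_const _
  refine h.congr_deriv ?_
  rw [Finset.sum_eq_single 1]
  · simp
  · intro i _ hi
    rcases Nat.eq_zero_or_pos i with h0 | h0
    · simp [h0]
    · rw [zero_pow (by omega), mul_zero, zero_mul]
  · simp

theorem differentiable_Zeval (x t : ℝ) (p q : Fin n) :
    Differentiable ℂ fun l => Zeval j Y ζ x t l p q := by
  simp only [Zeval_apply]
  fun_prop

variable {γ : ℝ → ℝ → Fin n → ℝ} {O : Set ℂ} {E : ℝ → ℝ → ℂ → Matrix (Fin n) (Fin n) ℂ}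

namespace IsCurveFlowWith

theorem smoothMat_frame (h : IsCurveFlowWith n j Set.univ γ Y ζ) :
    SmoothMat Set.univ (frame γ) := CentralAffine.smoothMat_frame h.smooth isOpen_univ

theorem smoothMat_curvature (h : IsCurveFlowWith n j Set.univ γ Y ζ) :
    SmoothMat Set.univ (curvature γ) := CentralAffine.smoothMat_curvature h.smooth isOpen_univ

theorem smoothMat_lcoeff (h : IsCurveFlowWith n j Set.univ γ Y ζ) (i : ℤ) :
    SmoothMat Set.univ fun x t => lcoeff (Y x t ^ j) i :=
  (h.laxData.isY.smoothLaurent.pow j).smooth i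

theorem smoothMat_Zzero (h : IsCurveFlowWith n j Set.univ γ Y ζ) :
    SmoothMat Set.univ (Zzero j Y ζ) := (h.smoothMat_lcoeff 0).sub h.laxData.smooth

theorem frame_x (h : IsCurveFlowWith n j Set.univ γ Y ζ) (x t : ℝ) :
    HasMatDeriv (fun s => frame γ s t) (frame γ x t * (b n ℝ + curvature γ x t)) x :=
  hasMatDeriv_frame_x h.smooth isOpen_univ h.det_eq_one (Set.mem_univ _)

theorem frame_t (h : IsCurveFlowWith n j Set.univ γ Y ζ) (x t : ℝ) :
    HasMatDeriv (fun s => frame γ x s) (frame γ x t * Zzero j Y ζ x t) t :=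
  hasMatDeriv_frame_t h.smooth isOpen_univ h.det_eq_one h.smoothMat_Zzero h.laxData.inV h.flow
    (Set.mem_univ _)

theorem det_frame (h : IsCurveFlowWith n j Set.univ γ Y ζ) (x t : ℝ) : (frame γ x t).det = 1 :=
  h.det_eq_one x t (Set.mem_univ _)

theorem mul_adj (h : IsCurveFlowWith n j Set.univ γ Y ζ) (x t : ℝ) :
    frame γ x t * (frame γ x t).adjugate = 1 := by
  rw [Matrix.mul_adjugate, h.det_frame, one_smul]

theorem adj_mul (h : IsCurveFlowWith n j Set.univ γ Y ζ) (x t : ℝ) :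
    (frame γ x t).adjugate * frame γ x t = 1 := by
  rw [Matrix.adjugate_mul, h.det_frame, one_smul]

theorem adj_x (h : IsCurveFlowWith n j Set.univ γ Y ζ) (x t : ℝ) :
    HasMatDeriv (fun s => (frame γ s t).adjugate)
      (-((b n ℝ + curvature γ x t) * (frame γ x t).adjugate)) x := by
  have h1 := h.smoothMat_frame.adjugate.hasMatDeriv_dx isOpen_univ (Set.mem_univ (x, t))
  rwa [HasMatDeriv.inv_eq (fun r => h.adj_mul r t) (h.mul_adj x t) (h.frame_x x t) h1] at h1

theorem adj_t (h : IsCurveFlowWith n j Set.univ γ Y ζ) (x t : ℝ) :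
    HasMatDeriv (fun s => (frame γ x s).adjugate)
      (-(Zzero j Y ζ x t * (frame γ x t).adjugate)) t := by
  have h1 := h.smoothMat_frame.adjugate.hasMatDeriv_dt isOpen_univ (Set.mem_univ (x, t))
  rwa [HasMatDeriv.inv_eq (fun r => h.adj_mul x r) (h.mul_adj x t) (h.frame_t x t) h1] at h1

/-- At `l = 0` the frame of `u` is the moving frame of `γ`. -/
theorem frame_zero_eq (h : IsCurveFlowWith n j Set.univ γ Y ζ) (h0 : (0 : ℂ) ∈ O)
    (hE : IsFrame n j (curvature γ) Y ζ O E)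
    (hi : E 0 0 0 = (frame γ 0 0).map Complex.ofReal) (x t : ℝ) :
    E x t 0 = (frame γ x t).map Complex.ofReal := by
  have hx : ∀ x t, HasMatDeriv (fun s => E s t 0)
      (E x t 0 * (b n ℝ + curvature γ x t).map Complex.ofReal) x := fun x t p q => by
    have := hE.eq_x x t 0 h0 p q
    rwa [J, zero_smul, zero_add, ← map_ofReal_b, ← map_ofReal_add] at this
  have ht : ∀ x t, HasMatDeriv (fun s => E x s 0)
      (E x t 0 * (Zzero j Y ζ x t).map Complex.ofReal) t := fun x t p q => by
    have := hE.eq_t x t 0 h0 p q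
    rwa [Zeval_zero] at this
  have hax : ∀ s, HasMatDeriv (fun s => ((frame γ s t).adjugate).map Complex.ofReal)
      (-((b n ℝ + curvature γ s t).map Complex.ofReal
        * ((frame γ s t).adjugate).map Complex.ofReal)) s := fun s => by
    have := (h.adj_x s t).ofReal
    rwa [map_ofReal_neg, map_ofReal_mul] at this
  have hat : ∀ s, HasMatDeriv (fun s => ((frame γ 0 s).adjugate).map Complex.ofReal)
      (-((Zzero j Y ζ 0 s).map Complex.ofReal
        * ((frame γ 0 s).adjugate).map Complex.ofReal)) s := fun s => by
    have := (h.adj_t 0 s).ofReal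
    rwa [map_ofReal_neg, map_ofReal_mul] at this
  -- E(·,·,0) and g solve the same linear systems, so E(x,t,0)g⁻¹ is constant; move first in x to
  -- (0,t), then in t to the origin, where the two agree.
  have h1 := mul_inv_eq_of_hasMatDeriv (fun s => hx s t) hax x 0
  have h2 := mul_inv_eq_of_hasMatDeriv (fun s => ht 0 s) hat t 0
  rw [h2, hi, ← map_ofReal_mul, h.mul_adj, map_ofReal_one] at h1
  have h3 := congrArg (· * (frame γ x t).map Complex.ofReal) h1
  simpa [mul_assoc, ← map_ofReal_mul, h.adj_mul, map_ofReal_one] using h3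

/-- The reality condition is usable only where both l and its conjugate lie in O. Near the fixed
point 0 this is automatic, and conjugation symmetry makes the derivative there real. -/
theorem Eone_real (h0 : (0 : ℂ) ∈ O) (hO : IsOpen O) (hE : IsFrame n j (curvature γ) Y ζ O E)
    (x t : ℝ) : Eone E x t = ((Eone E x t).map Complex.re).map Complex.ofReal := by
  ext p q
  rw [Matrix.map_apply, Matrix.map_apply]
  refine (Complex.conj_eq_iff_re.1 ?_).symm
  have hconj : ((starRingEnd ℂ) ∘ (fun l => E x t l p q) ∘ (starRingEnd ℂ))
      =ᶠ[nhds 0] fun l => E x t l p q := by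
    have h1 : ∀ᶠ l in nhds (0 : ℂ), (starRingEnd ℂ) l ∈ O :=
      Complex.continuous_conj.continuousAt.eventually (by simpa using hO.mem_nhds h0)
    filter_upwards [hO.mem_nhds h0, h1] with l hl hl'
    exact congrFun (congrFun (hE.real x t l hl hl') p) q
  have h2 := congrFun (deriv_conj_conj (f := fun l => E x t l p q)) 0
  rw [hconj.deriv_eq] at h2
  simp only [Function.comp_apply, map_zero] at h2
  exact h2.symm

theorem hasDerivAt_Eone (h0 : (0 : ℂ) ∈ O) (hO : IsOpen O) (hol : IsHolo O E) (x t : ℝ)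
    (p q : Fin n) : HasDerivAt (fun l => E x t l p q) (Eone E x t p q) 0 :=
  ((hol x t p q).differentiableAt (hO.mem_nhds h0)).hasDerivAt

theorem Eone_x (h : IsCurveFlowWith n j Set.univ γ Y ζ) (hO : IsOpen O) (h0 : (0 : ℂ) ∈ O)
    (hE : IsFrame n j (curvature γ) Y ζ O E) (hol : IsHolo O E) (x t : ℝ) :
    HasMatDeriv (fun s => Eone E s t) (Eone E x t * (b n ℝ
        + curvature γ x t).map Complex.ofReal + E x t 0 * e n ℂ 1 n) x := by
  have hc : ∀ p q, Continuous fun z : ℝ × ℂ =>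
      (J n z.2 + (curvature γ z.1 t).map Complex.ofReal) p q := by
    intro p q
    have : Continuous fun s => curvature γ s t p q :=
      (contDiffOn_univ.1 (h.smoothMat_curvature p q)).continuous.comp
        (by fun_prop : Continuous fun s : ℝ => (s, t))
    simp only [Matrix.add_apply, Matrix.map_apply, J_apply]
    fun_prop
  have hZ : ∀ s p q, Differentiable ℂ fun l : ℂ =>
      (J n l + (curvature γ s t).map Complex.ofReal) p q := by
    intro s p q
    simp only [Matrix.add_apply, Matrix.map_apply, J_apply]
    fun_prop
  intro p q
  have h1 := hasDerivAt_deriv_param hO h0 (E := fun s l => E s t l)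
    (Z := fun s l => J n l + (curvature γ s t).map Complex.ofReal)
    (fun s p q => hol s t p q) (fun l hl s p q => hE.eq_x s t l hl p q) hc hZ x p q
  have hu : ∀ p q : Fin n, HasDerivAt
      (fun l : ℂ => (J n l + (curvature γ x t).map Complex.ofReal) p q) (e n ℂ 1 n p q) 0 :=
    fun p q => (hasDerivAt_J 0 p q).add_const _
  have h2 := (deriv_matrix_mul (hasDerivAt_Eone h0 hO hol x t) hu p q).deriv
  rw [J, zero_smul, zero_add, ← map_ofReal_b, ← map_ofReal_add] at h2
  exact h1.congr_deriv h2

theorem Eone_t (h : IsCurveFlowWith n j Set.univ γ Y ζ) (hO : IsOpen O) (h0 : (0 : ℂ) ∈ O)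
    (hE : IsFrame n j (curvature γ) Y ζ O E) (hol : IsHolo O E) (x t : ℝ) :
    HasMatDeriv (fun s => Eone E x s) (Eone E x t * (Zzero j Y ζ x t).map Complex.ofReal
        + E x t 0 * (lcoeff (Y x t ^ j) 1).map Complex.ofReal) t := by
  have hcont : ∀ p q, Continuous fun z : ℝ × ℂ => Zeval j Y ζ x z.1 z.2 p q := by
    intro p q
    have hc : ∀ i : ℤ, Continuous fun s => lcoeff (Y x s ^ j) i p q := fun i =>
      (contDiffOn_univ.1 (h.smoothMat_lcoeff i p q)).continuous.comp
        (by fun_prop : Continuous fun s : ℝ => (x, s))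
    have hζ : Continuous fun s => ζ x s p q :=
      (contDiffOn_univ.1 (h.laxData.smooth p q)).continuous.comp
        (by fun_prop : Continuous fun s : ℝ => (x, s))
    simp only [Zeval_apply]
    refine (continuous_finsetSum _ fun i _ => ?_).sub ?_
    · exact (continuous_snd.pow i).mul (Complex.continuous_ofReal.comp ((hc i).comp continuous_fst))
    · exact Complex.continuous_ofReal.comp (hζ.comp continuous_fst)
  intro p q
  have h1 := hasDerivAt_deriv_param hO h0 (E := fun s l => E x s l)
    (Z := fun s l => Zeval j Y ζ x s l)
    (fun s p q => hol x s p q) (fun l hl s p q => hE.eq_t x s l hl p q) hcont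
    (fun s p q => differentiable_Zeval x s p q) t p q
  have h2 := (deriv_matrix_mul (hasDerivAt_Eone h0 hO hol x t)
    (Z := fun l => Zeval j Y ζ x t l) (Z' := (lcoeff (Y x t ^ j) 1).map Complex.ofReal)
    (fun p q => hasDerivAt_Zeval x t p q) p q).deriv
  rw [Zeval_zero] at h2
  exact h1.congr_deriv h2

/-- The first-order jet of the frame at `l = 0`. -/
theorem exists_jet (h : IsCurveFlowWith n j Set.univ γ Y ζ) (hO : IsOpen O) (h0 : (0 : ℂ) ∈ O)
    (hE : IsFrame n j (curvature γ) Y ζ O E) (hol : IsHolo O E)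
    (hi : E 0 0 0 = (frame γ 0 0).map Complex.ofReal) :
    ∃ E₁ : ℝ → ℝ → Matrix (Fin n) (Fin n) ℝ,
      (∀ x t, Eone E x t = (E₁ x t).map Complex.ofReal) ∧
      (∀ x t, HasMatDeriv (fun s => E₁ s t)
        (E₁ x t * (b n ℝ + curvature γ x t) + frame γ x t * e n ℝ 1 n) x) ∧
      ∀ x t, HasMatDeriv (fun s => E₁ x s)
        (E₁ x t * Zzero j Y ζ x t + frame γ x t * lcoeff (Y x t ^ j) 1) t := by
  obtain ⟨E₁, hE₁⟩ : ∃ E₁ : ℝ → ℝ → Matrix (Fin n) (Fin n) ℝ,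
      ∀ x t, Eone E x t = (E₁ x t).map Complex.ofReal := ⟨_, Eone_real h0 hO hE⟩
  refine ⟨E₁, hE₁, fun x t => ?_, fun x t => ?_⟩
  · have h2 := (h.Eone_x hO h0 hE hol x t).re
    rw [h.frame_zero_eq h0 hE hi] at h2
    simpa only [hE₁, ← map_ofReal_e, ← map_ofReal_mul, ← map_ofReal_add, map_re_ofReal] using h2
  · have h2 := (h.Eone_t hO h0 hE hol x t).re
    rw [h.frame_zero_eq h0 hE hi] at h2
    simpa only [hE₁, ← map_ofReal_mul, ← map_ofReal_add, map_re_ofReal] using h2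

theorem jet_mul_adj_x (h : IsCurveFlowWith n j Set.univ γ Y ζ)
    {E₁ : ℝ → ℝ → Matrix (Fin n) (Fin n) ℝ} (hx : ∀ x t, HasMatDeriv (fun s => E₁ s t)
      (E₁ x t * (b n ℝ + curvature γ x t) + frame γ x t * e n ℝ 1 n) x) (x t : ℝ) :
    HasMatDeriv (fun s => E₁ s t * (frame γ s t).adjugate)
      (frame γ x t * e n ℝ 1 n * (frame γ x t).adjugate) x := by
  convert (hx x t).mul (h.adj_x x t) using 1
  rw [add_mul, mul_neg, mul_assoc (E₁ x t)]
  abel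

theorem jet_mul_adj_t (h : IsCurveFlowWith n j Set.univ γ Y ζ)
    {E₁ : ℝ → ℝ → Matrix (Fin n) (Fin n) ℝ} (ht : ∀ x t, HasMatDeriv (fun s => E₁ x s)
        (E₁ x t * Zzero j Y ζ x t + frame γ x t * lcoeff (Y x t ^ j) 1) t) (x t : ℝ) :
    HasMatDeriv (fun s => E₁ x s * (frame γ x s).adjugate)
      (frame γ x t * lcoeff (Y x t ^ j) 1 * (frame γ x t).adjugate) t := by
  convert (ht x t).mul (h.adj_t x t) using 1
  rw [add_mul, mul_neg, mul_assoc (E₁ x t)]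
  abel

/-- The equations for E₁ contain E₁ itself. Passing to E₁g⁻¹ cancels those terms, and the remaining
partial derivatives are visibly smooth. -/
theorem smoothMat_jet (h : IsCurveFlowWith n j Set.univ γ Y ζ)
    {E₁ : ℝ → ℝ → Matrix (Fin n) (Fin n) ℝ} (hx : ∀ x t, HasMatDeriv (fun s => E₁ s t)
      (E₁ x t * (b n ℝ + curvature γ x t) + frame γ x t * e n ℝ 1 n) x)
    (ht : ∀ x t, HasMatDeriv (fun s => E₁ x s)
        (E₁ x t * Zzero j Y ζ x t + frame γ x t * lcoeff (Y x t ^ j) 1) t) :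
    SmoothMat Set.univ E₁ := by
  have hg := h.smoothMat_frame
  have h1 : SmoothMat Set.univ fun x t => E₁ x t * (frame γ x t).adjugate := fun p q =>
    SmoothFun.of_partial (h := fun x t => (E₁ x t * (frame γ x t).adjugate) p q)
      (((hg.mul (SmoothMat.const _)).mul hg.adjugate).entry p q)
      (((hg.mul (h.smoothMat_lcoeff 1)).mul hg.adjugate).entry p q)
      (fun x t => h.jet_mul_adj_x hx x t p q) (fun x t => h.jet_mul_adj_t ht x t p q)
  refine (h1.mul hg).congr fun x t _ => ?_
  rw [mul_assoc, h.adj_mul, mul_one]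

end IsCurveFlowWith

end Jet

/-! ### The transformed moving frame solves the flow -/

section Baecklund

variable {n : ℕ}

theorem coord_of_le (v : Fin n → ℝ) {i : ℕ} (h1 : 1 ≤ i) (h2 : i ≤ n) :
    coord v i = v ⟨i - 1, by omega⟩ := dif_pos ⟨h1, h2⟩

theorem Amat_apply (hn : 0 < n) (c : ℕ → ℝ) (p q : Fin n) : Amat n c p q
    = b n ℝ p q + if q.val + 1 = n ∧ 0 < p.val then c p.val else 0 := by
  have hp := p.isLt
  rw [Amat, Matrix.add_apply, Matrix.sum_apply]
  simp only [Matrix.smul_apply, e_apply, smul_eq_mul]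
  congr 1
  split_ifs with h
  · rw [Finset.sum_eq_single p.val]
    · simp [h.1]
    · intro i _ hi
      rw [if_neg (by omega), mul_zero]
    · intro h'
      exact absurd (Finset.mem_Icc.2 ⟨h.2, by omega⟩) h'
  · refine Finset.sum_eq_zero fun i hi => ?_
    rw [Finset.mem_Icc] at hi
    rw [if_neg (by omega), mul_zero]

theorem Amat_lower (hn : 0 < n) (c : ℕ → ℝ) (p q : Fin n) (hqp : q < p) :
    Amat n c p q = b n ℝ p q := by
  have hp := p.isLt
  rw [Fin.lt_def] at hqp
  rw [Amat_apply hn, if_neg (by omega), add_zero]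

theorem Amat_mulVec_cVec (hn : 0 < n) (c : ℕ → ℝ) : (Amat n c).mulVec (cVec n c) = 0 := by
  funext p
  have h1 : (Amat n c).mulVec (cVec n c) p = (b n ℝ).mulVec (cVec n c) p
      + ∑ q : Fin n, (if q.val + 1 = n ∧ 0 < p.val then c p.val else 0) * cVec n c q := by
    simp only [Matrix.mulVec, dotProduct, Amat_apply hn, add_mul, Finset.sum_add_distrib]
  rw [h1, b_mulVec_apply, Finset.sum_eq_single ⟨n - 1, by omega⟩]
  · have hp := p.isLt
    by_cases h0 : 0 < p.val
    · rw [dif_pos h0, if_pos ⟨by simp; omega, h0⟩, cVec, cVec, if_neg (by simp; omega),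
        if_pos (by simp; omega), Nat.sub_add_cancel h0]
      simp
    · rw [dif_neg h0, if_neg (fun h => h0 h.2)]
      simp
  · intro q _ hq
    rw [if_neg, zero_mul]
    rintro ⟨h, -⟩
    exact hq (Fin.ext (by simp; omega))
  · simp

theorem Amat_det (hn : 0 < n) (c : ℕ → ℝ) : (Amat n c).det = 0 := by
  refine Matrix.det_eq_zero_of_row_eq_zero ⟨0, hn⟩ fun q => ?_
  rw [Amat_apply hn, b_apply]
  simp

/-- Used once in x and once in t, with a₀ = Ag and a = e_{1n}g + AE₁. The derivatives of F and B are
constrained by differentiating the relations of the inverse. -/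
theorem HasMatDeriv.dressed {f F B a a₀ : ℝ → Matrix (Fin n) (Fin n) ℝ}
    {F' B' E Z₀ Z₁ T₀ T₁ : Matrix (Fin n) (Fin n) ℝ} {s : ℝ}
    (hinv : ∀ᶠ r in nhds s, DressInv (f r) E (F r) (B r))
    (hf : HasMatDeriv f (f s * Z₀ - T₀ * f s) s) (hF : HasMatDeriv F F' s)
    (hB : HasMatDeriv B B' s) (h1 : E * Z₀ + f s * Z₁ = T₀ * E + T₁ * f s)
    (ha : HasMatDeriv a (a s * Z₀ + a₀ s * Z₁) s) (ha₀ : HasMatDeriv a₀ (a₀ s * Z₀) s)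
    (h0 : a₀ s * F s = 0) :
    HasMatDeriv (fun r => a r * F r + a₀ r * B r) ((a s * F s + a₀ s * B s) * T₀) s := by
  have k1 := (hf.mul hF).unique ((HasMatDeriv.const 0 s).congr (hinv.mono fun r hr => hr.fF))
  have k2 := ((hf.mul hB).add (hF.const_mul E)).unique
    ((HasMatDeriv.const 1 s).congr (hinv.mono fun r hr => hr.right))
  have k3 := (hB.const_mul E).unique
    ((HasMatDeriv.const 0 s).congr (hinv.mono fun r hr => hr.eB))
  have := (ha.mul hF).add (ha₀.mul hB)
  rwa [hinv.self_of_nhds.deriv_mul rfl h1 k1 k2 k3 h0] at this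

/-- The determinant of the transformed moving frame. -/
theorem det_dressed (hn : 0 < n) {f F B A g X : Matrix (Fin n) (Fin n) ℝ}
    (hf : ∀ p q : Fin n, q < p → f p q = b n ℝ p q) (hfdet : f.det = 0)
    (hA : ∀ p q : Fin n, q < p → A p q = b n ℝ p q) (hAdet : A.det = 0)
    (h : DressInv f (e n ℝ 1 n) F B) (h0 : A * g * F = 0) :
    ((e n ℝ 1 n * g + A * X) * F + A * g * B).det = g.det := by
  have hσ := neg_one_pow_mul_self (n - 1)
  -- F + lB is l f⁻¹, and A + l e_{1n} has the same determinant (-1)^{n-1}l as f, so for l ≠ 0 the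
  -- two cancel. The factor l is available because AgF = 0; the value at l = 0 follows by
  -- continuity.
  have hE : ∀ l : ℝ, (A + l • e n ℝ 1 n) * (g + l • X) * (F + l • B)
      = l • (((e n ℝ 1 n * g + A * X) * F + A * g * B)
        + l • (e n ℝ 1 n * X * F + (e n ℝ 1 n * g + A * X) * B)
        + l ^ 2 • (e n ℝ 1 n * X * B)) := fun l => by
    simp only [add_mul, mul_add, smul_add, smul_mul_assoc, mul_smul_comm, h0, zero_add, smul_smul]
    simp only [← add_assoc, pow_two]
    abel
  have hI : ∀ l : ℝ, (f + l • e n ℝ 1 n) * (F + l • B) = l • 1 := fun l => by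
    rw [← h.right]
    simp only [add_mul, mul_add, smul_add, smul_mul_assoc, mul_smul_comm, h.fF, h.eB, zero_add,
      smul_zero, add_zero]
    exact add_comm _ _
  have key : ∀ l : ℝ, l ≠ 0 → (((e n ℝ 1 n * g + A * X) * F + A * g * B)
        + l • (e n ℝ 1 n * X * F + (e n ℝ 1 n * g + A * X) * B)
        + l ^ 2 • (e n ℝ 1 n * X * B)).det = (g + l • X).det := fun l hl => by
    have e1 := congrArg Matrix.det (hE l)
    have e2 := congrArg Matrix.det (hI l)
    rw [Matrix.det_mul, Matrix.det_mul, det_add_smul_e hn hA, hAdet, zero_add,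
      Matrix.det_smul] at e1
    rw [Matrix.det_mul, det_add_smul_e hn hf, hfdet, zero_add, Matrix.det_smul, Matrix.det_one,
      mul_one] at e2
    rw [Fintype.card_fin] at e1 e2
    refine mul_left_cancel₀ (pow_ne_zero n hl) ?_
    rw [← e1, ← e2]
    ring
  have hc1 : Continuous fun l : ℝ => (((e n ℝ 1 n * g + A * X) * F + A * g * B)
        + l • (e n ℝ 1 n * X * F + (e n ℝ 1 n * g + A * X) * B)
        + l ^ 2 • (e n ℝ 1 n * X * B)).det := Continuous.matrix_det (by fun_prop)
  have hc2 : Continuous fun l : ℝ => (g + l • X).det := Continuous.matrix_det (by fun_prop)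
  have := congrFun (hc1.ext_on (dense_compl_singleton (0 : ℝ)) hc2 fun l hl => key l hl) 0
  simpa using this

variable {j : ℕ} {Y : ℝ → ℝ → Matrix (Fin n) (Fin n) (LaurentSeries ℝ)}
  {ζ : ℝ → ℝ → Matrix (Fin n) (Fin n) ℝ} {γ : ℝ → ℝ → Fin n → ℝ}
  {O : Set ℂ} {E : ℝ → ℝ → ℂ → Matrix (Fin n) (Fin n) ℂ} {c : ℕ → ℝ}

theorem IsLaxData.mono {D D' : Set (ℝ × ℝ)} {u : ℝ → ℝ → Matrix (Fin n) (Fin n) ℝ}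
    (h : IsLaxData n j D u Y ζ) (hD : D' ⊆ D) : IsLaxData n j D' u Y ζ where
  isY :=
    { smooth := fun i => (h.isY.smooth i).mono hD
      traceless := fun x t hm => h.isY.traceless x t (hD hm)
      leading := fun x t hm => h.isY.leading x t (hD hm)
      lax := fun x t hm => h.isY.lax x t (hD hm)
      pow := fun x t hm => h.isY.pow x t (hD hm) }
  smooth := h.smooth.mono hD
  upper := fun x t hm => h.upper x t (hD hm)
  inV := fun x t hm => h.inV x t (hD hm)

theorem IsY.congr {D : Set (ℝ × ℝ)} {u u' : ℝ → ℝ → Matrix (Fin n) (Fin n) ℝ}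
    (h : IsY n D u Y) (hu : ∀ x t, (x, t) ∈ D → u' x t = u x t) : IsY n D u' Y where
  smooth := h.smooth
  traceless := h.traceless
  leading := h.leading
  lax := fun x t hm => by
    rw [hu x t hm]
    exact h.lax x t hm
  pow := h.pow

namespace IsCurveFlowWith

theorem vVec_eq (h : IsCurveFlowWith n j Set.univ γ Y ζ) (x t : ℝ) :
    vVec γ c x t = ((frame γ x t).adjugate).mulVec (cVec n c) := by
  rw [vVec, Matrix.inv_eq_right_inv (h.mul_adj x t)]

theorem frame_mulVec_vVec (h : IsCurveFlowWith n j Set.univ γ Y ζ) (x t : ℝ) :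
    (frame γ x t).mulVec (vVec γ c x t) = cVec n c := by
  rw [h.vVec_eq, Matrix.mulVec_mulVec, h.mul_adj, Matrix.one_mulVec]

theorem smoothFun_vVec (h : IsCurveFlowWith n j Set.univ γ Y ζ) (c : ℕ → ℝ) (p : Fin n) :
    SmoothFun Set.univ fun x t => vVec γ c x t p := by
  simp only [h.vVec_eq]
  exact h.smoothMat_frame.adjugate.mulVec (v := fun _ _ => cVec n c) (fun p => SmoothFun.const _) p

theorem vVec_x (h : IsCurveFlowWith n j Set.univ γ Y ζ) (x t : ℝ) (p : Fin n) :
    HasDerivAt (fun s => vVec γ c s t p)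
      ((-((b n ℝ + curvature γ x t).mulVec (vVec γ c x t))) p) x := by
  have h1 := (h.adj_x x t).mulVec (v := fun _ => cVec n c) (v' := 0)
    (fun p => hasDerivAt_const x (cVec n c p)) p
  simp only [h.vVec_eq, Matrix.mulVec_mulVec]
  simpa only [Matrix.mulVec_zero, add_zero, Matrix.neg_mulVec] using h1

theorem vVec_t (h : IsCurveFlowWith n j Set.univ γ Y ζ) (x t : ℝ) (p : Fin n) :
    HasDerivAt (fun s => vVec γ c x s p)
      ((-((Zzero j Y ζ x t).mulVec (vVec γ c x t))) p) t := by
  have h1 := (h.adj_t x t).mulVec (v := fun _ => cVec n c) (v' := 0)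
    (fun p => hasDerivAt_const t (cVec n c p)) p
  simp only [h.vVec_eq, Matrix.mulVec_mulVec]
  simpa only [Matrix.mulVec_zero, add_zero, Matrix.neg_mulVec] using h1

theorem smoothFun_coord_vVec (h : IsCurveFlowWith n j Set.univ γ Y ζ) (c : ℕ → ℝ) (i : ℕ) :
    SmoothFun Set.univ fun x t => coord (vVec γ c x t) i := by
  unfold coord
  split_ifs
  · exact h.smoothFun_vVec c _
  · exact SmoothFun.const 0

theorem isOpen_btDomain (h : IsCurveFlowWith n j Set.univ γ Y ζ) (c : ℕ → ℝ) :
    IsOpen (btDomain γ c) :=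
  isOpen_ne_fun (contDiffOn_univ.1 (h.smoothFun_coord_vVec c n)).continuous continuous_const

/-- On an open set where v_n = 0 the term uv vanishes, so v_x = -(b+u)v forces v_{n-1} = 0, then
v_{n-2} = 0, and so on. But gv has last entry -1. -/
theorem dense_btDomain (h : IsCurveFlowWith n j Set.univ γ Y ζ) (hn : 0 < n) (c : ℕ → ℝ) :
    Dense (btDomain γ c) := by
  rw [← compl_compl (btDomain γ c), ← interior_eq_empty_iff_dense_compl,
    Set.eq_empty_iff_forall_notMem]
  have hvan : ∀ p : Fin n, ∀ x t, (x, t) ∈ interior (btDomain γ c)ᶜ → vVec γ c x t p = 0 := by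
    intro p
    refine eq_zero_of_descending (P := fun p : Fin n =>
      ∀ x t, (x, t) ∈ interior (btDomain γ c)ᶜ → vVec γ c x t p = 0) ?_ ?_ p
    · intro p hp x t hm
      have h1 := interior_subset hm
      rw [btDomain, Set.mem_compl_iff, Set.mem_ofPred_eq, not_not, coord_of_le _ hn le_rfl] at h1
      rwa [show p = ⟨n - 1, by omega⟩ from Fin.ext (by simp; omega)]
    · intro p p' hp ih x t hm
      have hlt : p < p' := Fin.lt_def.2 (by omega)
      have h1 := (h.vVec_x (c := c) x t p').unique ((hasDerivAt_const x (0 : ℝ)).congr_of_eventuallyEq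
        ((eventually_fst_mem isOpen_interior hm).mono fun s hs => ih p' hlt s t hs))
      have h2 : (curvature γ x t).mulVec (vVec γ c x t) p' = 0 := by
        rw [Matrix.mulVec, dotProduct]
        refine Finset.sum_eq_zero fun k _ => ?_
        by_cases hk : k.val + 1 = n
        · rw [ih k (Fin.lt_def.2 (by have := p'.isLt; omega)) x t hm, mul_zero]
        · rw [curvature_inV γ x t p' k (Or.inl hk), zero_mul]
      rw [Pi.neg_apply, neg_eq_zero, Matrix.add_mulVec, Pi.add_apply, h2, add_zero, b_mulVec_apply,
        dif_pos (by omega)] at h1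
      rwa [show p = ⟨p'.val - 1, by omega⟩ from Fin.ext (by simp; omega)]
  rintro ⟨x, t⟩ hm
  have h1 := congrFun (h.frame_mulVec_vVec (c := c) x t) ⟨n - 1, by omega⟩
  rw [show vVec γ c x t = 0 from funext fun p => hvan p x t hm, Matrix.mulVec_zero, cVec,
    if_pos (by simp; omega)] at h1
  norm_num at h1

theorem vVec_last_ne_zero (hn : 0 < n) {x t : ℝ} (hm : (x, t) ∈ btDomain γ c) :
    vVec γ c x t ⟨n - 1, by omega⟩ ≠ 0 := by
  have h1 : coord (vVec γ c x t) n ≠ 0 := hm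
  rwa [coord_of_le _ hn le_rfl] at h1

theorem vVec_add_hFun_mul (hn : 2 ≤ n) {x t : ℝ} (hm : (x, t) ∈ btDomain γ c) :
    vVec γ c x t ⟨n - 2, by omega⟩ + hFun γ c x t * vVec γ c x t ⟨n - 1, by omega⟩ = 0 := by
  have h1 := vVec_last_ne_zero (by omega) hm
  rw [hFun, coord_of_le _ (by omega) le_rfl, coord_of_le _ (by omega) (by omega)]
  field_simp
  exact add_neg_cancel _

theorem smoothFun_hFun (h : IsCurveFlowWith n j Set.univ γ Y ζ) (c : ℕ → ℝ) :
    SmoothFun (btDomain γ c) (hFun γ c) :=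
  (((h.smoothFun_coord_vVec c (n - 1)).mono (Set.subset_univ _)).div
    ((h.smoothFun_coord_vVec c n).mono (Set.subset_univ _)) fun _ _ hm => hm).neg

theorem btMatrix_mulVec_vVec (h : IsCurveFlowWith n j Set.univ γ Y ζ) (hn : 2 ≤ n) {x t : ℝ}
    (hm : (x, t) ∈ btDomain γ c) :
    (btMatrix n (curvature γ) (hFun γ c) x t 0).mulVec (vVec γ c x t) = 0 ∧
      dx (fun x t => btMatrix n (curvature γ) (hFun γ c) x t 0) x t
        = btMatrix n (curvature γ) (hFun γ c) x t 0 * (b n ℝ + curvature γ x t)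
        - (b n ℝ + btCurvature n (curvature γ) (hFun γ c) x t)
          * btMatrix n (curvature γ) (hFun γ c) x t 0 :=
  btMatrix_mulVec_eq_zero_and_dx hn (h.isOpen_btDomain c)
    (h.smoothMat_curvature.mono (Set.subset_univ _)) (fun x t _ => curvature_inV γ x t)
    (h.smoothFun_hFun c) (fun x t _ p => h.vVec_x x t p)
    (fun _ _ hm => vVec_last_ne_zero (by omega) hm) (fun _ _ hm => vVec_add_hFun_mul hn hm) hm

theorem btMatrix_det (h : IsCurveFlowWith n j Set.univ γ Y ζ) (hn : 2 ≤ n) {x t : ℝ}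
    (hm : (x, t) ∈ btDomain γ c) : (btMatrix n (curvature γ) (hFun γ c) x t 0).det = 0 :=
  Matrix.exists_mulVec_eq_zero_iff.1 ⟨vVec γ c x t,
    fun h0 => vVec_last_ne_zero (n := n) (by omega) hm (congrFun h0 _),
    (h.btMatrix_mulVec_vVec hn hm).1⟩

theorem isDressing (h : IsCurveFlowWith n j Set.univ γ Y ζ) (hn : 2 ≤ n) (c : ℕ → ℝ) :
    IsDressing (btDomain γ c) (curvature γ) (btCurvature n (curvature γ) (hFun γ c))
      (fun x t => btMatrix n (curvature γ) (hFun γ c) x t 0)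
      (fun x t => (-1 : ℝ) ^ (n - 1) • (btMatrix n (curvature γ) (hFun γ c) x t 0).adjugate)
      (fun x t => (-1 : ℝ) ^ (n - 1) •
        ((btMatrix n (curvature γ) (hFun γ c) x t 0 + e n ℝ 1 n).adjugate
          - (btMatrix n (curvature γ) (hFun γ c) x t 0).adjugate)) := by
  have hf := smoothMat_btMatrix (h.isOpen_btDomain c)
    (h.smoothMat_curvature.mono (Set.subset_univ _)) (h.smoothFun_hFun c)
  have hinv := fun x t (hm : (x, t) ∈ btDomain γ c) =>
    dressInv_of_det_eq_zero (by omega) (btMatrix_lower x t) (h.btMatrix_det hn hm)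
  exact
  { isOpen := h.isOpen_btDomain c
    smooth := hf
    smoothF := hf.adjugate.const_smul _
    smoothB := ((hf.add (SmoothMat.const _)).adjugate.sub hf.adjugate).const_smul _
    inv := hinv
    lower := fun x t _ => btMatrix_lower x t
    upper := fun x t hm => (hinv x t hm).upper (by omega) (btMatrix_lower x t)
    eq_x := fun x t hm => (h.btMatrix_mulVec_vVec hn hm).2
    eq_e := fun x t _ => btMatrix_eq_e hn (curvature_inV γ x t) }

/-- The transformed curve in terms of the jet of the frame. -/
theorem btCurve_apply (hn : 0 < n) {x t : ℝ} {E₁ : Matrix (Fin n) (Fin n) ℝ}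
    (hE₁ : Eone E x t = E₁.map Complex.ofReal) (p : Fin n) :
    btCurve γ E c x t p = (((e n ℝ 1 n * frame γ x t + Amat n c * E₁)
      * (btMatrix n (curvature γ) (hFun γ c) x t 0).adjugate) p ⟨0, hn⟩ : ℝ) := by
  rw [btCurve, mulVec_e1_apply hn, hE₁, ← map_ofReal_mul, ← map_ofReal_add, ← map_ofReal_mul]
  rfl

/-- The Bäcklund transformation yields solutions of the flow. -/
theorem isCurveFlow_btCurve (h : IsCurveFlowWith n j Set.univ γ Y ζ) (hn : 2 ≤ n)
    (hO : IsOpen O) (h0 : (0 : ℂ) ∈ O) (hE : IsFrame n j (curvature γ) Y ζ O E)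
    (hol : IsHolo O E) (hi : E 0 0 0 = (frame γ 0 0).map Complex.ofReal)
    {γ' : ℝ → ℝ → Fin n → ℝ} (hγ' : ∀ x t, (x, t) ∈ btDomain γ c →
      ∀ p, btCurve γ E c x t p = ((γ' x t p : ℝ) : ℂ)) :
    IsCurveFlow n j (btDomain γ c) γ' := by
  have hn0 : 0 < n := by omega
  obtain ⟨E₁, hE₁, hE₁x, hE₁t⟩ := h.exists_jet hO h0 hE hol hi
  have hD := h.isOpen_btDomain c
  have hdr := h.isDressing hn c
  set D := btDomain γ c
  set f : ℝ → ℝ → Matrix (Fin n) (Fin n) ℝ :=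
    fun x t => btMatrix n (curvature γ) (hFun γ c) x t 0
  set F : ℝ → ℝ → Matrix (Fin n) (Fin n) ℝ := fun x t => (-1 : ℝ) ^ (n - 1) • (f x t).adjugate
  set B : ℝ → ℝ → Matrix (Fin n) (Fin n) ℝ := fun x t => (-1 : ℝ) ^ (n - 1) •
    ((f x t + e n ℝ 1 n).adjugate - (f x t).adjugate)
  set ut := btCurvature n (curvature γ) (hFun γ c) with hut
  have hker : ∀ x t, (x, t) ∈ D → ∀ C : Matrix (Fin n) (Fin n) ℝ,
      C.mulVec (vVec γ c x t) = 0 → C * F x t = 0 := fun x t hm C hC =>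
    mul_eq_zero_of_mulVec (btMatrix_lower x t) (h.btMatrix_mulVec_vVec hn hm).1
      (m := ⟨n - 1, by omega⟩) (by simp; omega) (vVec_last_ne_zero hn0 hm)
      (hdr.inv x t hm).fF hC
  have hAgF : ∀ x t, (x, t) ∈ D → Amat n c * frame γ x t * F x t = 0 := fun x t hm => by
    refine hker x t hm _ ?_
    rw [← Matrix.mulVec_mulVec, h.frame_mulVec_vVec, Amat_mulVec_cVec hn0]
  obtain ⟨Yt, ζt, hYt, hζt, hTt, hupper, hflow⟩ := hdr.exists_laxData
    (h.laxData.mono (Set.subset_univ D)) fun x t hm => by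
      refine hker x t hm _ ?_
      -- Differentiating f₀v = 0 in t shows that f₀Z_{j,0} - ∂_t f₀ kills v, so T has no pole.
      have h1 : (dt f x t).mulVec (vVec γ c x t)
          + (f x t).mulVec (-((Zzero j Y ζ x t).mulVec (vVec γ c x t))) = 0 := by
        funext p
        exact (((hdr.smooth.hasMatDeriv_dt hD hm).mulVec (fun p => h.vVec_t x t p) p).unique
          ((hasDerivAt_const t (0 : ℝ)).congr_of_eventuallyEq ((eventually_snd_mem hD hm).mono
            fun s hs => congrFun (h.btMatrix_mulVec_vVec hn hs).1 p)))
      rw [Matrix.sub_mulVec, ← Matrix.mulVec_mulVec]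
      rw [Matrix.mulVec_neg, ← sub_eq_add_neg] at h1
      rw [← neg_sub, h1, neg_zero]
  set T := Zzero j Yt ζt
  set gt : ℝ → ℝ → Matrix (Fin n) (Fin n) ℝ := fun x t =>
    (e n ℝ 1 n * frame γ x t + Amat n c * E₁ x t) * F x t + Amat n c * frame γ x t * B x t
  have hax : ∀ x t, HasMatDeriv (fun s => e n ℝ 1 n * frame γ s t + Amat n c * E₁ s t)
      ((e n ℝ 1 n * frame γ x t + Amat n c * E₁ x t) * (b n ℝ + curvature γ x t)
        + Amat n c * frame γ x t * e n ℝ 1 n) x := fun x t => by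
    have := ((h.frame_x x t).const_mul (e n ℝ 1 n)).add ((hE₁x x t).const_mul (Amat n c))
    convert this using 1
    noncomm_ring
  have hat : ∀ x t, HasMatDeriv (fun s => e n ℝ 1 n * frame γ x s + Amat n c * E₁ x s)
      ((e n ℝ 1 n * frame γ x t + Amat n c * E₁ x t) * Zzero j Y ζ x t
        + Amat n c * frame γ x t * lcoeff (Y x t ^ j) 1) t := fun x t => by
    have := ((h.frame_t x t).const_mul (e n ℝ 1 n)).add ((hE₁t x t).const_mul (Amat n c))
    convert this using 1
    noncomm_ring
  have hgx : ∀ x t, (x, t) ∈ D → HasMatDeriv (fun s => gt s t) (gt x t * (b n ℝ + ut x t)) x := by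
    intro x t hm
    have hf := hdr.smooth.hasMatDeriv_dx hD hm
    rw [hdr.eq_x x t hm] at hf
    refine HasMatDeriv.dressed ((eventually_fst_mem hD hm).mono fun s hs => hdr.inv s t hs) hf
      (hdr.smoothF.hasMatDeriv_dx hD hm) (hdr.smoothB.hasMatDeriv_dx hD hm)
      (hdr.eq_e x t hm) (hax x t) ?_ (hAgF x t hm)
    rw [mul_assoc]
    exact (h.frame_x x t).const_mul _
  have hgt : ∀ x t, (x, t) ∈ D → HasMatDeriv (fun s => gt x s) (gt x t * T x t) t := by
    intro x t hm
    obtain ⟨h1, T₁, h2⟩ := hflow x t hm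
    have hf := hdr.smooth.hasMatDeriv_dt hD hm
    rw [h1] at hf
    refine HasMatDeriv.dressed ((eventually_snd_mem hD hm).mono fun s hs => hdr.inv x s hs) hf
      (hdr.smoothF.hasMatDeriv_dt hD hm) (hdr.smoothB.hasMatDeriv_dt hD hm)
      h2 (hat x t) ?_ (hAgF x t hm)
    rw [mul_assoc]
    exact (h.frame_t x t).const_mul _
  have hdet : ∀ x t, (x, t) ∈ D → (gt x t).det = 1 := fun x t hm => by
    rw [← h.det_frame x t]
    exact det_dressed hn0 (btMatrix_lower x t) (h.btMatrix_det hn hm) (Amat_lower hn0 c)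
      (Amat_det hn0 c) (hdr.inv x t hm) (hAgF x t hm)
  have hgs : SmoothMat D gt := by
    have hg := h.smoothMat_frame.mono (Set.subset_univ D)
    have hE := (h.smoothMat_jet hE₁x hE₁t).mono (Set.subset_univ D)
    exact ((((SmoothMat.const _).mul hg).add ((SmoothMat.const _).mul hE)).mul hdr.smoothF).add
      (((SmoothMat.const _).mul hg).mul hdr.smoothB)
  -- F is (-1)^{n-1} times the adjugate in γ̃, and this factor undoes that sign. The determinant
  -- stays 1 because n(n-1) is even.
  set G : ℝ → ℝ → Matrix (Fin n) (Fin n) ℝ := fun x t => (-1 : ℝ) ^ (n - 1) • gt x t with hG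
  have hsmul : ∀ {M : ℝ → Matrix (Fin n) (Fin n) ℝ} {M' X : Matrix (Fin n) (Fin n) ℝ} {s : ℝ},
      HasMatDeriv M (M' * X) s → HasMatDeriv (fun r => (-1 : ℝ) ^ (n - 1) • M r)
        ((-1 : ℝ) ^ (n - 1) • M' * X) s := fun hM p q => by
    rw [smul_mul_assoc]
    exact (hM p q).const_mul _
  have hGx : ∀ x t, (x, t) ∈ D → HasMatDeriv (fun s => G s t) (G x t * (b n ℝ + ut x t)) x :=
    fun x t hm => hsmul (hgx x t hm)
  have hGt : ∀ x t, (x, t) ∈ D → HasMatDeriv (fun s => G x s) (G x t * T x t) t :=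
    fun x t hm => hsmul (hgt x t hm)
  have hGdet : ∀ x t, (x, t) ∈ D → (G x t).det = 1 := fun x t hm => by
    rw [hG, Matrix.det_smul, hdet x t hm, mul_one, Fintype.card_fin, ← pow_mul]
    refine Even.neg_one_pow ?_
    have := Nat.even_mul_succ_self (n - 1)
    rwa [Nat.sub_add_cancel hn0] at this
  have hGs : SmoothMat D G := hgs.const_smul _
  have hγ1 : ∀ x t, (x, t) ∈ D → ∀ p, γ' x t p = G x t p ⟨0, hn0⟩ := fun x t hm p => by
    have h1 := hγ' x t hm p
    rw [btCurve_apply hn0 (hE₁ x t), Complex.ofReal_inj] at h1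
    -- B is strictly upper triangular, so its first column is zero and only the E₁ term survives in
    -- γ̃.
    have h2 : (Amat n c * frame γ x t * B x t) p ⟨0, hn0⟩ = 0 := by
      rw [Matrix.mul_apply]
      exact Finset.sum_eq_zero fun k _ => by
        rw [hdr.upper x t hm k _ (Fin.le_def.2 (Nat.zero_le _)), mul_zero]
    have h3 : G x t = (-1 : ℝ) ^ (n - 1) • ((e n ℝ 1 n * frame γ x t + Amat n c * E₁ x t)
        * ((-1 : ℝ) ^ (n - 1) • (btMatrix n (curvature γ) (hFun γ c) x t 0).adjugate)
        + Amat n c * frame γ x t * B x t) := rfl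
    rw [← h1, h3, Matrix.smul_apply, Matrix.add_apply, h2, add_zero, mul_smul_comm,
      Matrix.smul_apply, smul_smul, neg_one_pow_mul_self, one_smul]
  have hγs : ContDiffOn ℝ ∞ (fun z : ℝ × ℝ => γ' z.1 z.2) D :=
    contDiffOn_pi.2 fun p => (hGs p ⟨0, hn0⟩).congr fun z hz => hγ1 z.1 z.2 hz p
  have hfc := fun x t (hm : (x, t) ∈ D) => frame_and_curvature_of_hasMatDeriv hn0 hD
    (fun x t _ => btCurvature_inV n _ _ x t) hGx hGdet hγs hγ1 hm
  have huts : SmoothMat D ut := smoothMat_btCurvature hD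
    (h.smoothMat_curvature.mono (Set.subset_univ _)) (h.smoothFun_hFun c)
  refine ⟨Yt, ζt, hγs, fun x t hm => ?_, ⟨hYt.congr fun x t hm => (hfc x t hm).2, hζt, hupper,
    fun x t hm => ?_⟩, fun x t hm => ?_⟩
  · rw [(hfc x t hm).1, hGdet x t hm]
  -- Zero curvature of G identifies the bracket with ∂_t(b+ũ) = ũ_t, which lies in V_n.
  · rw [(hfc x t hm).2, zero_curvature hD hGs ((SmoothMat.const (b n ℝ)).add huts) hTt
      (fun x t hm => by rw [hGdet x t hm]; exact isUnit_one) hGx hGt hm]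
    intro p q hpq
    have : (fun s => (b n ℝ + ut x s) p q) = fun _ => b n ℝ p q := by
      funext s
      rw [Matrix.add_apply, hut, btCurvature_inV n _ _ x s p q hpq, add_zero]
    rw [dt, Matrix.of_apply, this, deriv_const]
  · refine hasDerivAt_pi.2 fun p => ?_
    rw [(hfc x t hm).1, mulVec_e1_apply hn0]
    exact (hGt x t hm p ⟨0, hn0⟩).congr_of_eventuallyEq
      ((eventually_snd_mem hD hm).mono fun s hs => hγ1 x s hs p)

/-- The transformed curve is real valued. -/
theorem exists_real_btCurve (h : IsCurveFlowWith n j Set.univ γ Y ζ) (hn : 0 < n)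
    (hO : IsOpen O) (h0 : (0 : ℂ) ∈ O) (hE : IsFrame n j (curvature γ) Y ζ O E)
    (hol : IsHolo O E) (hi : E 0 0 0 = (frame γ 0 0).map Complex.ofReal) (c : ℕ → ℝ) :
    ∃ γ' : ℝ → ℝ → Fin n → ℝ, ∀ x t p, btCurve γ E c x t p = ((γ' x t p : ℝ) : ℂ) := by
  obtain ⟨E₁, hE₁, -⟩ := h.exists_jet hO h0 hE hol hi
  exact ⟨_, fun x t p => btCurve_apply hn (hE₁ x t) p⟩

end IsCurveFlowWith

end Baecklund

/-! ### Powers of J -/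

section PowJ

variable {n : ℕ}

/-- The matrix `e_{r+1,1} + ⋯ + e_{n,n-r}`. -/
def shiftLow (n r : ℕ) (R : Type*) [CommRing R] : Matrix (Fin n) (Fin n) R :=
  Matrix.of fun p q => if p.val = q.val + r then 1 else 0

/-- The matrix `e_{1,n-r+1} + ⋯ + e_{r,n}`. -/
def shiftUp (n r : ℕ) (R : Type*) [CommRing R] : Matrix (Fin n) (Fin n) R :=
  Matrix.of fun p q => if p.val + n = q.val + r then 1 else 0

theorem map_shiftLow {R S : Type*} [CommRing R] [CommRing S] (φ : R →+* S) (r : ℕ) :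
    (shiftLow n r R).map φ = shiftLow n r S := by
  ext p q
  simp [shiftLow, apply_ite φ]

theorem map_shiftUp {R S : Type*} [CommRing R] [CommRing S] (φ : R →+* S) (r : ℕ) :
    (shiftUp n r R).map φ = shiftUp n r S := by
  ext p q
  simp [shiftUp, apply_ite φ]

variable {R : Type*} [CommRing R]

theorem J_pow_of_le (hn : 0 < n) (l : R) {r : ℕ} (hr : r ≤ n) :
    J n l ^ r = shiftLow n r R + l • shiftUp n r R := by
  induction r with
  | zero =>
    ext p q
    simp [shiftLow, shiftUp, Matrix.one_apply, Fin.ext_iff]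
    omega
  | succ r ih =>
    ext p q
    have hp := p.isLt
    have hq := q.isLt
    rw [pow_succ, J, mul_add, mul_smul_comm, Matrix.add_apply, Matrix.smul_apply,
      mul_e_apply hn, mul_b_apply, ← J, ih (by omega)]
    simp only [shiftLow, shiftUp, Matrix.add_apply, Matrix.smul_apply, Matrix.of_apply, smul_eq_mul]
    by_cases h : q.val + 1 < n
    · rw [dif_pos h, if_neg (by omega), add_assoc q.val, add_comm 1 r]
      simp
    · rw [dif_neg h, if_pos (by omega), if_neg (show ¬ p.val + n = 0 + r by omega),
        if_neg (show ¬ p.val = q.val + (r + 1) by omega)]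
      simp only [show (p.val = 0 + r) ↔ (p.val + n = q.val + (r + 1)) by omega]
      simp

theorem J_pow (hn : 0 < n) (l : R) (j : ℕ) :
    J n l ^ j = l ^ (j / n) • (shiftLow n (j % n) R + l • shiftUp n (j % n) R) := by
  have h1 : J n l ^ n = l • 1 := by
    rw [J_pow_of_le hn l le_rfl]
    ext p q
    have hp := p.isLt
    simp only [shiftLow, shiftUp, Matrix.add_apply, Matrix.smul_apply, Matrix.of_apply]
    rw [if_neg (by omega), zero_add, Matrix.one_apply]
    simp [Fin.ext_iff]
  conv_lhs => rw [← Nat.div_add_mod j n]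
  rw [pow_add, pow_mul, h1, smul_pow, one_pow, smul_mul_assoc, one_mul,
    J_pow_of_le hn l (Nat.mod_lt j hn).le]

theorem J_pow_self (hn : 0 < n) (l : R) : J n l ^ n = l • 1 := by
  rw [J_pow hn, Nat.div_self hn, Nat.mod_self]
  ext p q
  have hp := p.isLt
  have hq := q.isLt
  simp only [shiftLow, shiftUp, Matrix.add_apply, Matrix.smul_apply, Matrix.of_apply]
  rw [if_neg (show ¬ p.val + n = q.val + 0 by omega), Matrix.one_apply]
  simp [Fin.ext_iff]

theorem J_zero : J n (0 : R) = b n R := by rw [J, zero_smul, zero_add]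

theorem lcoeff_J_pow (hn : 0 < n) (j : ℕ) (i : ℤ) : lcoeff (J n lam ^ j) i
    = (if i = (j / n : ℕ) then shiftLow n (j % n) ℝ else 0)
      + if i = (j / n : ℕ) + 1 then shiftUp n (j % n) ℝ else 0 := by
  rw [J_pow hn, lcoeff_lam_pow_smul, lcoeff_add, lcoeff_lam_smul,
    ← map_shiftLow (HahnSeries.C : ℝ →+* LaurentSeries ℝ),
    ← map_shiftUp (HahnSeries.C : ℝ →+* LaurentSeries ℝ)]
  change lcoeff (cmat _) _ + lcoeff (cmat _) _ = _
  rw [lcoeff_cmat, lcoeff_cmat]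
  simp only [sub_eq_iff_eq_add, zero_add, add_comm, add_zero]

theorem lcoeff_J_pow_zero (hn : 0 < n) (j : ℕ) : lcoeff (J n lam ^ j) 0 = b n ℝ ^ j := by
  rw [lcoeff_J_pow hn, ← J_zero, J_pow hn, zero_smul, add_zero,
    if_neg (show (0 : ℤ) < (j / n : ℕ) + 1 by positivity).ne, add_zero]
  rcases Nat.eq_zero_or_pos (j / n) with h | h
  · simp [h]
  · rw [if_neg (by exact_mod_cast h.ne), zero_pow h.ne', zero_smul]

/-- J^j is already polynomial in l, supported in the powers [j/n] and [j/n] + 1, which are the last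
two terms of the sum. -/
theorem Zeval_J (hn : 0 < n) (j : ℕ) (x t : ℝ) (l : ℂ) :
    Zeval j (fun _ _ => J n lam) (fun _ _ => 0) x t l = J n l ^ j := by
  rw [Zeval, J_pow hn l, Finset.sum_range_succ, Finset.sum_range_succ, Finset.sum_eq_zero]
  · rw [lcoeff_J_pow hn, lcoeff_J_pow hn, if_pos rfl, if_neg (by omega), if_neg (by omega),
      if_pos (by push_cast; rfl), add_zero, zero_add, smul_add, smul_smul, ← pow_succ,
      ← map_shiftLow Complex.ofRealHom, ← map_shiftUp Complex.ofRealHom]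
    simp
    rfl
  · intro i hi
    rw [Finset.mem_range] at hi
    rw [lcoeff_J_pow hn, if_neg (by omega), if_neg (by omega)]
    simp

theorem b_pow_self (hn : 0 < n) : b n R ^ n = 0 := by
  rw [← J_zero, J_pow_self hn, zero_smul]

end PowJ

/-! ### Matrix exponentials -/

section Exp

variable {n : ℕ} {𝕜 : Type*} [RCLike 𝕜]

open scoped Matrix.Norms.Operator in
theorem hasMatDeriv_of_hasDerivAt {M : ℝ → Matrix (Fin n) (Fin n) 𝕜}
    {M' : Matrix (Fin n) (Fin n) 𝕜} {s : ℝ} (h : HasDerivAt M M' s) : HasMatDeriv M M' s :=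
  fun p q => (LinearMap.toContinuousLinearMap
    (Matrix.entryLinearMap ℝ 𝕜 p q)).hasFDerivAt.comp_hasDerivAt s h

open scoped Matrix.Norms.Operator in
theorem hasMatDeriv_exp {M N : Matrix (Fin n) (Fin n) 𝕜} (h : Commute M N) (x t : ℝ) :
    HasMatDeriv (fun s => NormedSpace.exp (s • M + t • N))
      (NormedSpace.exp (x • M + t • N) * M) x := by
  have h1 : ∀ s : ℝ, NormedSpace.exp (s • M + t • N)
      = NormedSpace.exp (t • N) * NormedSpace.exp (s • M) := fun s => by
    rw [add_comm, Matrix.exp_add_of_commute _ _ ((h.symm.smul_left t).smul_right s)]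
  simp only [h1, mul_assoc]
  exact (hasMatDeriv_of_hasDerivAt (hasDerivAt_exp_smul_const (𝕂 := ℝ) M x)).const_mul _

open scoped Matrix.Norms.Operator in
theorem contDiff_exp_entry (M N : Matrix (Fin n) (Fin n) 𝕜) (p q : Fin n) :
    ContDiff ℝ ∞ fun z : ℝ × ℝ => NormedSpace.exp (z.1 • M + z.2 • N) p q := by
  have h1 : ContDiff ℝ ∞ (NormedSpace.exp : Matrix (Fin n) (Fin n) 𝕜 → _) :=
    contDiff_iff_contDiffAt.2 fun x => (NormedSpace.exp_analytic (𝕂 := ℝ) x).contDiffAt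
  have h2 : ContDiff ℝ ∞ fun z : ℝ × ℝ => z.1 • M + z.2 • N :=
    (contDiff_fst.smul contDiff_const).add (contDiff_snd.smul contDiff_const)
  exact (LinearMap.toContinuousLinearMap
    (Matrix.entryLinearMap ℝ 𝕜 p q)).contDiff.comp (h1.comp h2)

open scoped Matrix.Norms.Operator in
theorem differentiable_exp_J (x t : ℂ) (j : ℕ) (p q : Fin n) :
    Differentiable ℂ fun l : ℂ => NormedSpace.exp (x • J n l + t • J n l ^ j) p q := by
  have h1 : Differentiable ℂ (NormedSpace.exp : Matrix (Fin n) (Fin n) ℂ → _) :=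
    fun x => (NormedSpace.exp_analytic (𝕂 := ℂ) x).differentiableAt
  have h2 : Differentiable ℂ fun l : ℂ => J n l := by
    unfold J
    fun_prop
  have h3 : Differentiable ℂ fun l : ℂ => x • J n l + t • J n l ^ j :=
    (h2.const_smul x).add ((h2.pow j).const_smul t)
  exact (LinearMap.toContinuousLinearMap
    (Matrix.entryLinearMap ℂ ℂ p q)).differentiable.comp (h1.comp h3)

open scoped Matrix.Norms.Operator in
theorem map_conj_exp (M : Matrix (Fin n) (Fin n) ℂ) :
    (NormedSpace.exp M).map (starRingEnd ℂ) = NormedSpace.exp (M.map (starRingEnd ℂ)) := by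
  have hc : Continuous ((starRingEnd ℂ).mapMatrix : Matrix (Fin n) (Fin n) ℂ →+* _) :=
    Continuous.matrix_map continuous_id Complex.continuous_conj
  exact NormedSpace.map_exp (starRingEnd ℂ).mapMatrix hc M

theorem exp_eq_sum_of_pow_eq_zero {M : Matrix (Fin n) (Fin n) ℝ} {k : ℕ} (h : M ^ k = 0) :
    NormedSpace.exp M = ∑ i ∈ Finset.range k, ((i.factorial : ℝ)⁻¹) • M ^ i := by
  rw [NormedSpace.exp_eq_tsum ℝ]
  refine tsum_eq_sum fun i hi => ?_
  rw [Finset.mem_range, not_lt] at hi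
  rw [pow_eq_zero_of_le hi h, smul_zero]

end Exp

/-! ### Strictly lower triangular matrices and unipotent exponentials -/

section Triangular

variable {n : ℕ}

/-- Strictly lower triangular matrices. -/
def StrictLower (M : Matrix (Fin n) (Fin n) ℝ) : Prop := ∀ p q : Fin n, p ≤ q → M p q = 0

theorem StrictLower.add {M N : Matrix (Fin n) (Fin n) ℝ} (hM : StrictLower M)
    (hN : StrictLower N) : StrictLower (M + N) := fun p q h => by
  rw [Matrix.add_apply, hM p q h, hN p q h, add_zero]

theorem StrictLower.smul {M : Matrix (Fin n) (Fin n) ℝ} (hM : StrictLower M) (a : ℝ) :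
    StrictLower (a • M) := fun p q h => by
  rw [Matrix.smul_apply, hM p q h, smul_zero]

theorem StrictLower.mul {M N : Matrix (Fin n) (Fin n) ℝ} (hM : StrictLower M)
    (hN : StrictLower N) : StrictLower (M * N) := fun p q h => by
  rw [Matrix.mul_apply]
  refine Finset.sum_eq_zero fun k _ => ?_
  rcases le_total p k with hk | hk
  · rw [hM p k hk, zero_mul]
  · rw [hN k q (hk.trans h), mul_zero]

theorem StrictLower.pow {M : Matrix (Fin n) (Fin n) ℝ} (hM : StrictLower M) {k : ℕ} (hk : 0 < k) :
    StrictLower (M ^ k) := by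
  induction k, hk using Nat.le_induction with
  | base => simpa using hM
  | succ k _ ih =>
    rw [pow_succ]
    exact ih.mul hM

theorem strictLower_b : StrictLower (b n ℝ) := fun p q h => by
  rw [b_apply, if_neg (by rw [Fin.le_def] at h; omega)]

theorem StrictLower.det_exp {M : Matrix (Fin n) (Fin n) ℝ} (hM : StrictLower M) {k : ℕ}
    (hk : M ^ (k + 1) = 0) : (NormedSpace.exp M).det = 1 := by
  have h1 : NormedSpace.exp M = 1 + ∑ i ∈ Finset.range k,
      (((i + 1).factorial : ℝ)⁻¹) • M ^ (i + 1) := by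
    rw [exp_eq_sum_of_pow_eq_zero hk, Finset.sum_range_succ', add_comm]
    simp
  have h2 : ∀ p q : Fin n, p ≤ q →
      (∑ i ∈ Finset.range k, (((i + 1).factorial : ℝ)⁻¹) • M ^ (i + 1)) p q = 0 := by
    intro p q h
    rw [Matrix.sum_apply]
    exact Finset.sum_eq_zero fun i _ => (hM.pow i.succ_pos).smul _ p q h
  rw [h1, Matrix.det_of_isLowerTriangular]
  · refine Finset.prod_eq_one fun p _ => ?_
    rw [Matrix.add_apply, h2 p p le_rfl, Matrix.one_apply_eq, add_zero]
  · intro p q hpq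
    have hpq : p < q := hpq
    rw [Matrix.add_apply, h2 p q hpq.le, Matrix.one_apply_ne hpq.ne, add_zero]

end Triangular

/-! ### The vacuum solution and its frame -/

section Vacuum

variable {n j : ℕ}

/-- For j ≥ 1 a factor b splits off and commutes with the cofactor, so b^n = 0 suffices. This makes
the exponential series finite. -/
theorem vac_pow_eq_zero (hn : 0 < n) (hj : 0 < j) (x t : ℝ) :
    (x • b n ℝ + t • b n ℝ ^ j) ^ n = 0 := by
  have h1 : x • b n ℝ + t • b n ℝ ^ j = b n ℝ * (x • 1 + t • b n ℝ ^ (j - 1)) := by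
    rw [mul_add, mul_smul_comm, mul_smul_comm, mul_one, ← pow_succ', Nat.sub_add_cancel hj]
  have h2 : Commute (b n ℝ) (x • 1 + t • b n ℝ ^ (j - 1)) :=
    ((Commute.one_right _).smul_right x).add_right (((Commute.refl _).pow_right _).smul_right t)
  rw [h1, h2.mul_pow, b_pow_self hn, zero_mul]

theorem det_vac (hn : 0 < n) (hj : 0 < j) (x t : ℝ) :
    (NormedSpace.exp (x • b n ℝ + t • b n ℝ ^ j)).det = 1 :=
  ((strictLower_b.smul x).add ((strictLower_b.pow hj).smul t)).det_exp (k := n - 1)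
    (by rw [Nat.sub_add_cancel hn]; exact vac_pow_eq_zero hn hj x t)

theorem commute_b : Commute (b n ℝ) (b n ℝ ^ j) := (Commute.refl _).pow_right j

theorem vac_x (x t : ℝ) : HasMatDeriv (fun s => NormedSpace.exp (s • b n ℝ + t • b n ℝ ^ j))
    (NormedSpace.exp (x • b n ℝ + t • b n ℝ ^ j) * b n ℝ) x := hasMatDeriv_exp commute_b x t

theorem vac_t (x t : ℝ) : HasMatDeriv (fun s => NormedSpace.exp (x • b n ℝ + s • b n ℝ ^ j))
    (NormedSpace.exp (x • b n ℝ + t • b n ℝ ^ j) * b n ℝ ^ j) t := by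
  simp only [add_comm (x • b n ℝ)]
  exact hasMatDeriv_exp commute_b.symm t x

theorem contDiff_vacCurve (hn : 0 < n) :
    ContDiffOn ℝ ∞ (fun z : ℝ × ℝ => vacCurve n j z.1 z.2) Set.univ := by
  refine contDiffOn_pi.2 fun p => ?_
  simp only [vacCurve, mulVec_e1_apply hn]
  exact (contDiff_exp_entry _ _ p _).contDiffOn

theorem frame_and_curvature_vac (hn : 0 < n) (hj : 0 < j) (x t : ℝ) :
    frame (vacCurve n j) x t = NormedSpace.exp (x • b n ℝ + t • b n ℝ ^ j) ∧
      curvature (vacCurve n j) x t = 0 :=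
  frame_and_curvature_of_hasMatDeriv
    (g := fun x t => NormedSpace.exp (x • b n ℝ + t • b n ℝ ^ j)) (u := fun _ _ => 0) hn isOpen_univ
    (fun _ _ _ _ _ _ => rfl) (fun x t _ => by simpa using vac_x x t)
    (fun x t _ => det_vac hn hj x t) (contDiff_vacCurve hn)
    (fun x t _ p => mulVec_e1_apply hn _ p) (Set.mem_univ (x, t))

theorem Zzero_vac (hn : 0 < n) (x t : ℝ) :
    Zzero j (fun _ _ => J n lam) (fun _ _ => 0) x t = b n ℝ ^ j := by
  rw [Zzero, lcoeff_J_pow_zero hn, sub_zero]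

theorem dx_const (M : Matrix (Fin n) (Fin n) ℝ) (x t : ℝ) : dx (fun _ _ => M) x t = 0 :=
  dx_eq_of_hasMatDeriv (HasMatDeriv.const M x)

theorem isLaxData_vac (hn : 2 ≤ n) (hj : 0 < j) :
    IsLaxData n j Set.univ (curvature (vacCurve n j)) (fun _ _ => J n lam) fun _ _ => 0 where
  isY :=
    { smooth := fun i => SmoothMat.const _
      traceless := fun x t _ => by
        refine Finset.sum_eq_zero fun p _ => ?_
        rw [Matrix.diag_apply, J_apply, e_apply, b_apply, if_neg (by omega), if_neg (by omega),
          mul_zero, add_zero]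
      leading := fun _ _ _ _ _ _ _ => rfl
      lax := fun x t _ i => by
        rw [(frame_and_curvature_vac (by omega) hj x t).2, dx_const,
          Matrix.map_zero _ (map_zero _), add_zero, Ring.lie_def, sub_self, lcoeff_zero, zero_add]
      pow := fun _ _ _ => J_pow_self (by omega) lam }
  smooth := SmoothMat.const _
  upper := fun _ _ _ _ _ _ => rfl
  inV := fun x t _ => by
    have h1 : Zzero j (fun _ _ => J n lam) (fun _ _ => 0) = fun _ _ => b n ℝ ^ j :=
      funext fun x => funext fun t => Zzero_vac (by omega) x t
    rw [h1, dx_const, (frame_and_curvature_vac (by omega) hj x t).2, add_zero, Ring.lie_def,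
      commute_b.eq, sub_self, add_zero]
    exact fun _ _ _ => rfl

theorem isCurveFlowWith_vac (hn : 2 ≤ n) (hj : 0 < j) :
    IsCurveFlowWith n j Set.univ (vacCurve n j) (fun _ _ => J n lam) fun _ _ => 0 where
  smooth := contDiff_vacCurve (by omega)
  det_eq_one := fun x t _ => by
    rw [(frame_and_curvature_vac (by omega) hj x t).1, det_vac (by omega) hj]
  laxData := isLaxData_vac hn hj
  flow := fun x t _ => by
    have hn0 : 0 < n := by omega
    refine hasDerivAt_pi.2 fun p => ?_
    rw [Zzero_vac hn0, (frame_and_curvature_vac hn0 hj x t).1, mulVec_e1_apply hn0]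
    simp only [vacCurve, mulVec_e1_apply hn0]
    exact vac_t x t p _

theorem vacFrame_eq (x t : ℝ) (l : ℂ) :
    vacFrame n j x t l = NormedSpace.exp (x • J n l + t • J n l ^ j) := rfl

theorem commute_J (l : ℂ) : Commute (J n l) (J n l ^ j) := (Commute.refl _).pow_right j

theorem map_conj_J (l : ℂ) : (J n ((starRingEnd ℂ) l)).map (starRingEnd ℂ) = J n l := by
  ext p q
  rw [Matrix.map_apply, J_apply, J_apply, e_apply, b_apply]
  simp [apply_ite (starRingEnd ℂ)]

theorem map_conj_add_smul (M N : Matrix (Fin n) (Fin n) ℂ) (x t : ℝ) :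
    ((x : ℂ) • M + (t : ℂ) • N).map (starRingEnd ℂ)
      = (x : ℂ) • M.map (starRingEnd ℂ) + (t : ℂ) • N.map (starRingEnd ℂ) := by
  ext
  simp

theorem vacFrame_x (x t : ℝ) (l : ℂ) :
    HasMatDeriv (fun s => vacFrame n j s t l) (vacFrame n j x t l * J n l) x := by
  simp only [vacFrame_eq]
  exact hasMatDeriv_exp (commute_J l) x t

theorem vacFrame_t (x t : ℝ) (l : ℂ) :
    HasMatDeriv (fun s => vacFrame n j x s l) (vacFrame n j x t l * J n l ^ j) t := by
  simp only [vacFrame_eq, add_comm (x • J n l)]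
  exact hasMatDeriv_exp (commute_J l).symm t x

theorem contDiff_vacFrame (l : ℂ) (p q : Fin n) :
    ContDiff ℝ ∞ fun z : ℝ × ℝ => vacFrame n j z.1 z.2 l p q := by
  simp only [vacFrame_eq]
  exact contDiff_exp_entry (J n l) (J n l ^ j) p q

theorem vacFrame_conj (x t : ℝ) (l : ℂ) :
    (vacFrame n j x t ((starRingEnd ℂ) l)).map (starRingEnd ℂ) = vacFrame n j x t l := by
  have h1 : (J n ((starRingEnd ℂ) l) ^ j).map (starRingEnd ℂ) = J n l ^ j := by
    rw [Matrix.map_pow, map_conj_J]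
  rw [vacFrame, map_conj_exp, map_conj_add_smul, map_conj_J, h1, vacFrame]

theorem det_vacFrame_ne_zero (x t : ℝ) (l : ℂ) : (vacFrame n j x t l).det ≠ 0 := by
  rw [vacFrame]
  exact ((Matrix.isUnit_iff_isUnit_det
    (A := NormedSpace.exp ((x : ℂ) • J n l + (t : ℂ) • J n l ^ j))).1
    (Matrix.isUnit_exp ((x : ℂ) • J n l + (t : ℂ) • J n l ^ j))).ne_zero

theorem isFrame_vac (hn : 2 ≤ n) (hj : 0 < j) :
    IsFrame n j (curvature (vacCurve n j)) (fun _ _ => J n lam) (fun _ _ => 0) Set.univ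
      (vacFrame n j) where
  laxData := isLaxData_vac hn hj
  smooth := fun l _ p q => contDiff_vacFrame l p q
  det_ne_zero := fun x t l _ => det_vacFrame_ne_zero x t l
  eq_x := fun x t l _ p q => by
    rw [(frame_and_curvature_vac (by omega) hj x t).2, Matrix.map_zero _ Complex.ofReal_zero,
      add_zero]
    exact vacFrame_x x t l p q
  eq_t := fun x t l _ p q => by
    rw [Zeval_J (by omega)]
    exact vacFrame_t x t l p q
  real := fun x t l _ _ => vacFrame_conj x t l

theorem isHolo_vac : IsHolo Set.univ (vacFrame n j) := fun x t p q =>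
  (differentiable_exp_J (x : ℂ) (t : ℂ) j p q).differentiableOn

theorem vacFrame_zero (hn : 0 < n) (hj : 0 < j) :
    vacFrame n j 0 0 0 = (frame (vacCurve n j) 0 0).map Complex.ofReal := by
  rw [(frame_and_curvature_vac hn hj 0 0).1, vacFrame]
  simp

end Vacuum

/-! ### Matrices over an algebra of functions -/

section FunctionAlgebra

variable {n : ℕ} (S : Subalgebra ℝ (ℝ → ℝ → ℝ))

/-- Matrix valued functions with entries in an algebra of functions. -/
def MatMem (M : ℝ → ℝ → Matrix (Fin n) (Fin n) ℝ) : Prop :=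
  ∀ p q, (fun x t => M x t p q) ∈ S

variable {S}

theorem const_mem_subalgebra (a : ℝ) : (fun _ _ => a : ℝ → ℝ → ℝ) ∈ S := S.algebraMap_mem a

theorem sum_mem_subalgebra {ι : Type*} {s : Finset ι} {f : ι → ℝ → ℝ → ℝ}
    (h : ∀ i ∈ s, f i ∈ S) : (fun x t => ∑ i ∈ s, f i x t) ∈ S := by
  have := S.sum_mem h
  convert this using 1
  funext x t
  simp

theorem prod_mem_subalgebra {ι : Type*} {s : Finset ι} {f : ι → ℝ → ℝ → ℝ}
    (h : ∀ i ∈ s, f i ∈ S) : (fun x t => ∏ i ∈ s, f i x t) ∈ S := by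
  have := S.prod_mem h
  convert this using 1
  funext x t
  simp

variable {M N : ℝ → ℝ → Matrix (Fin n) (Fin n) ℝ}

theorem MatMem.const (C : Matrix (Fin n) (Fin n) ℝ) : MatMem S fun _ _ => C :=
  fun p q => const_mem_subalgebra (C p q)

theorem MatMem.add (hM : MatMem S M) (hN : MatMem S N) : MatMem S fun x t => M x t + N x t :=
  fun p q => S.add_mem (hM p q) (hN p q)

theorem MatMem.mul (hM : MatMem S M) (hN : MatMem S N) : MatMem S fun x t => M x t * N x t :=
  fun p q => by
  simp only [Matrix.mul_apply]
  exact sum_mem_subalgebra fun k _ => S.mul_mem (hM p k) (hN k q)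

theorem MatMem.pow (hM : MatMem S M) (k : ℕ) : MatMem S fun x t => M x t ^ k := by
  induction k with
  | zero => simpa using MatMem.const 1
  | succ k ih =>
    simp only [pow_succ]
    exact ih.mul hM

theorem MatMem.sum {ι : Type*} {s : Finset ι} {f : ι → ℝ → ℝ → Matrix (Fin n) (Fin n) ℝ}
    (hf : ∀ i ∈ s, MatMem S (f i)) : MatMem S fun x t => ∑ i ∈ s, f i x t := fun p q => by
  simp only [Matrix.sum_apply]
  exact sum_mem_subalgebra fun i hi => hf i hi p q

theorem MatMem.smul {a : ℝ → ℝ → ℝ} (ha : a ∈ S) (hM : MatMem S M) :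
    MatMem S fun x t => a x t • M x t := fun p q => S.mul_mem ha (hM p q)

theorem MatMem.det (hM : MatMem S M) : (fun x t => (M x t).det) ∈ S := by
  simp only [Matrix.det_apply']
  exact sum_mem_subalgebra fun σ _ => S.mul_mem (const_mem_subalgebra _)
    (prod_mem_subalgebra fun i _ => hM _ i)

theorem MatMem.adjugate (hM : MatMem S M) : MatMem S fun x t => (M x t).adjugate := fun p q => by
  simp only [Matrix.adjugate_apply]
  refine MatMem.det (M := fun x t => (M x t).updateRow q (Pi.single p 1)) fun i j => ?_
  by_cases h : i = q
  · subst h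
    simp only [Matrix.updateRow_self]
    exact const_mem_subalgebra _
  · simp only [Matrix.updateRow_ne h]
    exact hM i j

theorem MatMem.mono {T : Subalgebra ℝ (ℝ → ℝ → ℝ)} (hM : MatMem S M) (h : S ≤ T) : MatMem T M :=
  fun p q => h (hM p q)

theorem MatMem.mulVec (hM : MatMem S M) {v : ℝ → ℝ → Fin n → ℝ}
    (hv : ∀ p, (fun x t => v x t p) ∈ S) (p : Fin n) :
    (fun x t => (M x t).mulVec (v x t) p) ∈ S := by
  simp only [Matrix.mulVec, dotProduct]
  exact sum_mem_subalgebra fun k _ => S.mul_mem (hM p k) (hv k)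

end FunctionAlgebra

/-! ### Polynomial functions of (x, t) -/

section Polynomial

open MvPolynomial

/-- The algebra of polynomial functions of `(x, t)`. -/
def polyFun : Subalgebra ℝ (ℝ → ℝ → ℝ) where
  carrier := {f | ∃ P : MvPolynomial (Fin 2) ℝ, ∀ x t, f x t = eval ![x, t] P}
  mul_mem' := by
    rintro f g ⟨P, hP⟩ ⟨Q, hQ⟩
    exact ⟨P * Q, fun x t => by simp [hP, hQ]⟩
  add_mem' := by
    rintro f g ⟨P, hP⟩ ⟨Q, hQ⟩
    exact ⟨P + Q, fun x t => by simp [hP, hQ]⟩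
  algebraMap_mem' := fun r => ⟨C r, fun x t => by simp⟩

theorem fst_mem_polyFun : (fun x _ => x : ℝ → ℝ → ℝ) ∈ polyFun :=
  ⟨X 0, fun x t => by simp⟩

theorem snd_mem_polyFun : (fun _ t => t : ℝ → ℝ → ℝ) ∈ polyFun :=
  ⟨X 1, fun x t => by simp⟩

theorem comp_mem_polyFun {f g k : ℝ → ℝ → ℝ} (hf : f ∈ polyFun) (hg : g ∈ polyFun)
    (hk : k ∈ polyFun) : (fun x t => f (g x t) (k x t)) ∈ polyFun := by
  obtain ⟨P, hP⟩ := hf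
  obtain ⟨Q, hQ⟩ := hg
  obtain ⟨R, hR⟩ := hk
  refine ⟨bind₁ ![Q, R] P, fun x t => ?_⟩
  refine Eq.trans ?_ (eval₂Hom_bind₁ (RingHom.id ℝ) ![x, t] ![Q, R] P).symm
  refine (hP _ _).trans ?_
  rw [eval]
  congr 2
  funext i
  fin_cases i
  · exact hQ x t
  · exact hR x t

theorem hasDerivAt_eval_pderiv (P : MvPolynomial (Fin 2) ℝ) (x t : ℝ) :
    HasDerivAt (fun s => eval ![s, t] P) (eval ![x, t] (pderiv 0 P)) x := by
  induction P using MvPolynomial.induction_on with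
  | C a => simpa using hasDerivAt_const x a
  | add P Q hP hQ => simpa using hP.fun_add hQ
  | mul_X P i hP =>
    have hX : HasDerivAt (fun s => eval ![s, t] (X i : MvPolynomial (Fin 2) ℝ))
        (eval ![x, t] (pderiv 0 (X i : MvPolynomial (Fin 2) ℝ))) x := by
      fin_cases i
      · simpa using hasDerivAt_id' x
      · simpa using hasDerivAt_const x t
    simpa [Derivation.leibniz, add_comm, mul_comm] using hP.fun_mul hX

theorem exists_hasDerivAt_fst {f : ℝ → ℝ → ℝ} (hf : f ∈ polyFun) :
    ∃ f' ∈ polyFun, ∀ x t, HasDerivAt (fun s => f s t) (f' x t) x := by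
  obtain ⟨P, hP⟩ := hf
  refine ⟨_, ⟨pderiv 0 P, fun _ _ => rfl⟩, fun x t => ?_⟩
  simp only [hP]
  exact hasDerivAt_eval_pderiv P x t

theorem exists_antideriv_fst {f : ℝ → ℝ → ℝ} (hf : f ∈ polyFun) :
    ∃ F ∈ polyFun, ∀ x t, HasDerivAt (fun s => F s t) (f x t) x := by
  obtain ⟨P, hP⟩ := hf
  simp only [hP]
  clear hP
  induction P using MvPolynomial.induction_on' with
  | monomial u a =>
    refine ⟨fun x t => a / (u 0 + 1) * x ^ (u 0 + 1) * t ^ u 1,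
      polyFun.mul_mem (polyFun.mul_mem (const_mem_subalgebra (a / (u 0 + 1)))
        (polyFun.pow_mem fst_mem_polyFun (u 0 + 1))) (polyFun.pow_mem snd_mem_polyFun (u 1)),
      fun x t => ?_⟩
    refine (((hasDerivAt_pow (u 0 + 1) x).const_mul
      (a / (u 0 + 1))).mul_const (t ^ u 1)).congr_deriv ?_
    have h2 : ((u 0 : ℝ) + 1) ≠ 0 := by positivity
    rw [eval_monomial, Finsupp.prod_fintype _ _ (fun _ => pow_zero _), Fin.prod_univ_two]
    simp
    field_simp
  | add P Q hP hQ =>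
    obtain ⟨F, hF, hF'⟩ := hP
    obtain ⟨G, hG, hG'⟩ := hQ
    exact ⟨F + G, polyFun.add_mem hF hG, fun x t => by simpa using (hF' x t).fun_add (hG' x t)⟩

theorem swap_mem_polyFun {f : ℝ → ℝ → ℝ} (hf : f ∈ polyFun) : (fun x t => f t x) ∈ polyFun :=
  comp_mem_polyFun hf snd_mem_polyFun fst_mem_polyFun

/-- Integrate along the path (0,0), (0,t), (x,t): f is recovered from a polynomial primitive A of p
in x, a primitive B of t ↦ q(0,t), and a constant. -/
theorem mem_polyFun_of_partial {f p q : ℝ → ℝ → ℝ} (hp : p ∈ polyFun) (hq : q ∈ polyFun)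
    (hx : ∀ x t, HasDerivAt (fun s => f s t) (p x t) x)
    (ht : ∀ x t, HasDerivAt (fun s => f x s) (q x t) t) : f ∈ polyFun := by
  obtain ⟨A, hA, hA'⟩ := exists_antideriv_fst hp
  obtain ⟨B, hB, hB'⟩ := exists_antideriv_fst (swap_mem_polyFun hq)
  have h1 : ∀ x t, f x t - A x t = f 0 t - A 0 t := fun x t =>
    is_const_of_deriv_eq_zero (f := fun s => f s t - A s t)
      (fun s => ((hx s t).sub (hA' s t)).differentiableAt)
      (fun s => by rw [((hx s t).fun_sub (hA' s t)).deriv, sub_self]) x 0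
  have h2 : ∀ t, f 0 t - B t 0 = f 0 0 - B 0 0 := fun t =>
    is_const_of_deriv_eq_zero (f := fun s => f 0 s - B s 0)
      (fun s => ((ht 0 s).sub (hB' s 0)).differentiableAt)
      (fun s => by rw [((ht 0 s).fun_sub (hB' s 0)).deriv, sub_self]) t 0
  have h0 : (fun _ _ => 0 : ℝ → ℝ → ℝ) ∈ polyFun := const_mem_subalgebra 0
  have h3 : f = A - (fun _ t => A 0 t) + (fun _ t => B t 0) + fun _ _ => f 0 0 - B 0 0 := by
    funext x t
    simp only [Pi.add_apply, Pi.sub_apply]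
    linarith [h1 x t, h2 t]
  rw [h3]
  exact polyFun.add_mem (polyFun.add_mem (polyFun.sub_mem hA
    (comp_mem_polyFun hA h0 snd_mem_polyFun)) (comp_mem_polyFun hB snd_mem_polyFun h0))
    (const_mem_subalgebra _)

end Polynomial

/-! ### Rational functions with a prescribed denominator -/

section Rational

variable {D : Set (ℝ × ℝ)} {v : ℝ → ℝ → ℝ}

/-- The algebra of functions that are on `D` a polynomial divided by a power of `v`. -/
def ratFun (hv : v ∈ polyFun) (h0 : ∀ x t, (x, t) ∈ D → v x t ≠ 0) :
    Subalgebra ℝ (ℝ → ℝ → ℝ) where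
  carrier := {f | ∃ k : ℕ, ∃ p ∈ polyFun, ∀ x t, (x, t) ∈ D → f x t = p x t / v x t ^ k}
  mul_mem' := by
    rintro f g ⟨k, p, hp, hf⟩ ⟨m, q, hq, hg⟩
    refine ⟨k + m, p * q, polyFun.mul_mem hp hq, fun x t hm => ?_⟩
    simp only [Pi.mul_apply, hf x t hm, hg x t hm]
    rw [pow_add, div_mul_div_comm]
  add_mem' := by
    rintro f g ⟨k, p, hp, hf⟩ ⟨m, q, hq, hg⟩
    refine ⟨k + m, p * v ^ m + v ^ k * q, polyFun.add_mem (polyFun.mul_mem hp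
      (polyFun.pow_mem hv m)) (polyFun.mul_mem (polyFun.pow_mem hv k) hq), fun x t hm => ?_⟩
    simp only [Pi.mul_apply, Pi.add_apply, Pi.pow_apply, hf x t hm, hg x t hm]
    rw [div_add_div _ _ (pow_ne_zero k (h0 x t hm)) (pow_ne_zero m (h0 x t hm)), pow_add]
  algebraMap_mem' := fun r => ⟨0, _, polyFun.algebraMap_mem r, fun x t _ => by simp⟩

variable (hv : v ∈ polyFun) (h0 : ∀ x t, (x, t) ∈ D → v x t ≠ 0)

theorem polyFun_le_ratFun : polyFun ≤ ratFun hv h0 := fun f hf => ⟨0, f, hf, by simp⟩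

theorem div_mem_ratFun {f : ℝ → ℝ → ℝ} (hf : f ∈ polyFun) :
    (fun x t => f x t / v x t) ∈ ratFun hv h0 := ⟨1, f, hf, by simp⟩

theorem deriv_mem_ratFun (hD : IsOpen D) {f : ℝ → ℝ → ℝ} (hf : f ∈ ratFun hv h0) :
    (fun x t => deriv (fun s => f s t) x) ∈ ratFun hv h0 := by
  obtain ⟨k, p, hp, hf⟩ := hf
  obtain ⟨p', hp', hpd⟩ := exists_hasDerivAt_fst hp
  obtain ⟨v', hv', hvd⟩ := exists_hasDerivAt_fst hv
  -- Quotient rule, after cancelling v^{k-1}: (p/v^k)' = (p'v - k p v')/v^{k+1}. Membership only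
  -- constrains values on D, and D is open, so the derivative may be computed there.
  refine ⟨k + 1, p' * v - p * v' * fun _ _ => (k : ℝ), polyFun.sub_mem (polyFun.mul_mem hp' hv)
    (polyFun.mul_mem (polyFun.mul_mem hp hv') (const_mem_subalgebra _)), fun x t hm => ?_⟩
  have h1 := (hpd x t).fun_div ((hvd x t).fun_pow k) (pow_ne_zero k (h0 x t hm))
  change deriv (fun s => f s t) x = _
  rw [Filter.EventuallyEq.deriv_eq ((eventually_fst_mem hD hm).mono fun s hs => hf s t hs)]
  refine h1.deriv.trans ?_
  have hv0 := h0 x t hm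
  simp only [Pi.sub_apply, Pi.mul_apply]
  rcases k with _ | k
  · simp
    field_simp
  · simp only [Nat.add_sub_cancel]
    field_simp
    ring

theorem iteratedDeriv_mem_ratFun (hD : IsOpen D) {f : ℝ → ℝ → ℝ} (hf : f ∈ ratFun hv h0) (m : ℕ) :
    (fun x t => iteratedDeriv m (fun s => f s t) x) ∈ ratFun hv h0 := by
  induction m with
  | zero => simpa using hf
  | succ m ih =>
    simp only [iteratedDeriv_succ]
    exact deriv_mem_ratFun hv h0 hD ih

variable {n : ℕ} {u : ℝ → ℝ → Matrix (Fin n) (Fin n) ℝ} {h : ℝ → ℝ → ℝ}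

theorem btCurv_mem_ratFun (hD : IsOpen D) (hu : MatMem (ratFun hv h0) u) (hh : h ∈ ratFun hv h0)
    (k : ℕ) : btCurv n u h k ∈ ratFun hv h0 := by
  have hc : ∀ i, (fun x t => coef (u x t) i) ∈ ratFun hv h0 := fun i => by
    unfold coef
    split_ifs
    · exact hu _ _
    · exact const_mem_subalgebra 0
  have hd := iteratedDeriv_mem_ratFun hv h0 hD hh
  induction k with
  | zero => exact const_mem_subalgebra 0
  | succ k ih =>
    unfold btCurv
    refine Subalgebra.sub_mem _ (Subalgebra.sub_mem _ (Subalgebra.sub_mem _ (Subalgebra.add_mem _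
      (hc _) (sum_mem_subalgebra fun m _ => Subalgebra.mul_mem _ (Subalgebra.mul_mem _
        (const_mem_subalgebra _) (hc _)) (hd _))) (Subalgebra.mul_mem _
        (const_mem_subalgebra _) (hd _))) (deriv_mem_ratFun hv h0 hD ih))
        (Subalgebra.mul_mem _ ih hh)

theorem btMatrix_mem_ratFun (hD : IsOpen D) (hu : MatMem (ratFun hv h0) u)
    (hh : h ∈ ratFun hv h0) : MatMem (ratFun hv h0) fun x t => btMatrix n u h x t 0 := by
  intro p q
  rcases Nat.lt_or_ge q.val p.val with hqp | hpq
  · simp only [btMatrix_of_gt _ _ hqp]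
    exact const_mem_subalgebra _
  · simp only [btMatrix_of_le _ _ hpq]
    refine Subalgebra.add_mem _ (Subalgebra.mul_mem _ (const_mem_subalgebra _)
      (iteratedDeriv_mem_ratFun hv h0 hD hh _)) ?_
    split_ifs
    · exact btCurv_mem_ratFun hv h0 hD hu hh _
    · exact const_mem_subalgebra 0

/-- A common denominator. -/
theorem exists_common_denominator {γ : ℝ → ℝ → Fin n → ℝ}
    (hγ : ∀ p, (fun x t => γ x t p) ∈ ratFun hv h0) : ∃ K : ℕ, 0 < K ∧
      ∀ p, ∃ f ∈ polyFun, ∀ x t, (x, t) ∈ D → γ x t p = f x t / v x t ^ K := by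
  choose k f hf hfe using hγ
  -- The extra 1 keeps the exponent positive even if every entry is polynomial, so that the common
  -- denominator vanishes exactly where v does.
  refine ⟨∑ p, k p + 1, Nat.succ_pos _, fun p => ⟨f p * v ^ (∑ p, k p + 1 - k p),
    polyFun.mul_mem (hf p) (polyFun.pow_mem hv _), fun x t hm => ?_⟩⟩
  have hle : k p ≤ ∑ p, k p + 1 :=
    (Finset.single_le_sum (fun _ _ => Nat.zero_le _) (Finset.mem_univ p)).trans (Nat.le_succ _)
  have hv0 := h0 x t hm
  refine (hfe p x t hm).trans ?_
  rw [Pi.mul_apply, Pi.mul_apply, Pi.pow_apply, Pi.pow_apply,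
    div_eq_div_iff (pow_ne_zero _ hv0) (pow_ne_zero _ hv0), mul_assoc, ← pow_add,
    Nat.sub_add_cancel hle]

end Rational

/-! ### Rationality of the transformed vacuum -/

section VacuumTransform

variable {n j : ℕ}

theorem matMem_frame_vac (hn : 0 < n) (hj : 0 < j) : MatMem polyFun (frame (vacCurve n j)) := by
  have h1 : frame (vacCurve n j) = fun x t => ∑ i ∈ Finset.range n,
      ((i.factorial : ℝ)⁻¹) • (x • b n ℝ + t • b n ℝ ^ j) ^ i := by
    funext x t
    rw [(frame_and_curvature_vac hn hj x t).1,
      exp_eq_sum_of_pow_eq_zero (vac_pow_eq_zero hn hj x t)]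
  rw [h1]
  exact MatMem.sum fun i _ => MatMem.smul (const_mem_subalgebra _)
    (((MatMem.smul fst_mem_polyFun (MatMem.const (b n ℝ))).add
      (MatMem.smul snd_mem_polyFun (MatMem.const (b n ℝ ^ j)))).pow i)

theorem vVec_vac_mem_polyFun (hn : 2 ≤ n) (hj : 0 < j) (c : ℕ → ℝ) (p : Fin n) :
    (fun x t => vVec (vacCurve n j) c x t p) ∈ polyFun := by
  simp only [(isCurveFlowWith_vac hn hj).vVec_eq]
  exact (matMem_frame_vac (by omega) hj).adjugate.mulVec (v := fun _ _ => cVec n c)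
    (fun p => const_mem_subalgebra _) p

theorem coord_vVec_vac_mem_polyFun (hn : 2 ≤ n) (hj : 0 < j) (c : ℕ → ℝ) (i : ℕ) :
    (fun x t => coord (vVec (vacCurve n j) c x t) i) ∈ polyFun := by
  unfold coord
  split_ifs
  · exact vVec_vac_mem_polyFun hn hj c _
  · exact const_mem_subalgebra 0

/-- E₁ need not be computed: E₁g⁻¹ has polynomial partial derivatives, because g and its adjugate
are polynomial, and is therefore polynomial itself. -/
theorem matMem_jet_vac (hn : 2 ≤ n) (hj : 0 < j) {E₁ : ℝ → ℝ → Matrix (Fin n) (Fin n) ℝ}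
    (hx : ∀ x t, HasMatDeriv (fun s => E₁ s t)
      (E₁ x t * (b n ℝ + curvature (vacCurve n j) x t) + frame (vacCurve n j) x t * e n ℝ 1 n) x)
    (ht : ∀ x t, HasMatDeriv (fun s => E₁ x s)
      (E₁ x t * Zzero j (fun _ _ => J n lam) (fun _ _ => 0) x t
        + frame (vacCurve n j) x t * lcoeff (J n lam ^ j) 1) t) : MatMem polyFun E₁ := by
  have h := isCurveFlowWith_vac hn hj
  have hg := matMem_frame_vac (by omega) hj (n := n) (j := j)
  have h1 : MatMem polyFun fun x t => E₁ x t * (frame (vacCurve n j) x t).adjugate := fun p q =>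
    mem_polyFun_of_partial (((hg.mul (MatMem.const (e n ℝ 1 n))).mul hg.adjugate) p q)
      (((hg.mul (MatMem.const (lcoeff (J n lam ^ j) 1))).mul hg.adjugate) p q)
      (fun x t => h.jet_mul_adj_x hx x t p q) fun x t => h.jet_mul_adj_t ht x t p q
  have h2 : E₁ = fun x t =>
      E₁ x t * (frame (vacCurve n j) x t).adjugate * frame (vacCurve n j) x t := by
    funext x t
    rw [mul_assoc, h.adj_mul, mul_one]
  rw [h2]
  exact h1.mul hg

theorem exists_rational_btCurve_vac (hn : 2 ≤ n) (hj : 0 < j) (c : ℕ → ℝ) :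
    ∃ (P : Fin n → MvPolynomial (Fin 2) ℝ) (Q : MvPolynomial (Fin 2) ℝ),
      (∀ x t, (x, t) ∈ btDomain (vacCurve n j) c ↔ MvPolynomial.eval ![x, t] Q ≠ 0) ∧
      ∀ x t, (x, t) ∈ btDomain (vacCurve n j) c →
        ∀ p, btCurve (vacCurve n j) (vacFrame n j) c x t p
          = ((MvPolynomial.eval ![x, t] (P p) / MvPolynomial.eval ![x, t] Q : ℝ) : ℂ) := by
  have hn0 : 0 < n := by omega
  have h := isCurveFlowWith_vac hn hj
  obtain ⟨E₁, hE₁, hx, ht⟩ := h.exists_jet isOpen_univ (Set.mem_univ 0) (isFrame_vac hn hj)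
    isHolo_vac (vacFrame_zero hn0 hj)
  have hv := coord_vVec_vac_mem_polyFun hn hj c n
  have h0 : ∀ x t, (x, t) ∈ btDomain (vacCurve n j) c → coord (vVec (vacCurve n j) c x t) n ≠ 0 :=
    fun _ _ hm => hm
  have hle := polyFun_le_ratFun hv h0
  have hg := (matMem_frame_vac hn0 hj).mono hle
  have hh : hFun (vacCurve n j) c ∈ ratFun hv h0 :=
    Subalgebra.neg_mem _ (div_mem_ratFun hv h0 (coord_vVec_vac_mem_polyFun hn hj c (n - 1)))
  have hu : MatMem (ratFun hv h0) (curvature (vacCurve n j)) := by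
    have h1 : curvature (vacCurve n j) = fun _ _ => 0 :=
      funext fun x => funext fun t => (frame_and_curvature_vac hn0 hj x t).2
    rw [h1]
    exact MatMem.const 0
  have hγ : MatMem (ratFun hv h0) fun x t =>
      (e n ℝ 1 n * frame (vacCurve n j) x t + Amat n c * E₁ x t)
        * (btMatrix n (curvature (vacCurve n j)) (hFun (vacCurve n j) c) x t 0).adjugate :=
    (((MatMem.const _).mul hg).add
      ((MatMem.const _).mul ((matMem_jet_vac hn hj hx ht).mono hle))).mul
      (btMatrix_mem_ratFun hv h0 (h.isOpen_btDomain c) hu hh).adjugate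
  -- The denominator Q is a positive power of v_n, hence D is exactly where Q does not vanish.
  obtain ⟨K, hK, hKf⟩ := exists_common_denominator hv h0 (fun p => hγ p ⟨0, hn0⟩)
  choose f hf hfe using hKf
  choose P hP using hf
  obtain ⟨Q, hQ⟩ := polyFun.pow_mem hv K
  have hQ' : ∀ x t, MvPolynomial.eval ![x, t] Q = coord (vVec (vacCurve n j) c x t) n ^ K :=
    fun x t => (hQ x t).symm
  refine ⟨P, Q, fun x t => ?_, fun x t hm p => ?_⟩
  · rw [hQ', pow_ne_zero_iff hK.ne']
    rfl
  · rw [IsCurveFlowWith.btCurve_apply hn0 (hE₁ x t), hQ', ← hP]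
    exact congrArg Complex.ofReal (hfe p x t hm)

end VacuumTransform

end

end CentralAffine

theorem mainTheorem5 (n j : ℕ) (hn : 2 ≤ n) (hj : ¬ n ∣ j) :
    (∀ (γ : ℝ → ℝ → Fin n → ℝ)
      (Y : ℝ → ℝ → Matrix (Fin n) (Fin n) (LaurentSeries ℝ))
      (ζ : ℝ → ℝ → Matrix (Fin n) (Fin n) ℝ)
      (O : Set ℂ) (E : ℝ → ℝ → ℂ → Matrix (Fin n) (Fin n) ℂ) (c : ℕ → ℝ),
      IsCurveFlowWith n j Set.univ γ Y ζ →
      IsOpen O → (0 : ℂ) ∈ O →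
      IsFrame n j (curvature γ) Y ζ O E → IsHolo O E →
      E 0 0 0 = (frame γ 0 0).map Complex.ofReal →
      IsOpen (btDomain γ c) ∧ Dense (btDomain γ c) ∧
      ∃ γ' : ℝ → ℝ → Fin n → ℝ,
        (∀ x t, (x, t) ∈ btDomain γ c →
          ∀ p, btCurve γ E c x t p = ((γ' x t p : ℝ) : ℂ)) ∧
        IsCurveFlow n j (btDomain γ c) γ') ∧
    (IsCurveFlowWith n j Set.univ (vacCurve n j) (fun _ _ => J n lam) (fun _ _ => 0) ∧
      (∀ x t, curvature (vacCurve n j) x t = 0) ∧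
      IsFrame n j (curvature (vacCurve n j)) (fun _ _ => J n lam) (fun _ _ => 0) Set.univ
        (vacFrame n j) ∧
      IsHolo Set.univ (vacFrame n j) ∧
      vacFrame n j 0 0 0 = (frame (vacCurve n j) 0 0).map Complex.ofReal ∧
      ∀ c : ℕ → ℝ, (btDomain (vacCurve n j) c).Nonempty ∧
        ∃ (P : Fin n → MvPolynomial (Fin 2) ℝ) (Q : MvPolynomial (Fin 2) ℝ),
          (∀ x t, (x, t) ∈ btDomain (vacCurve n j) c ↔ MvPolynomial.eval ![x, t] Q ≠ 0) ∧
          (∀ x t, (x, t) ∈ btDomain (vacCurve n j) c →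
            ∀ p, btCurve (vacCurve n j) (vacFrame n j) c x t p
              = ((MvPolynomial.eval ![x, t] (P p) / MvPolynomial.eval ![x, t] Q : ℝ) : ℂ)) ∧
          IsCurveFlow n j (btDomain (vacCurve n j) c) fun x t p =>
            MvPolynomial.eval ![x, t] (P p) / MvPolynomial.eval ![x, t] Q) := by
  have hj0 : 0 < j := Nat.pos_of_ne_zero fun h => hj (h ▸ dvd_zero n)
  have hn0 : 0 < n := by omega
  refine ⟨fun γ Y ζ O E c h hO h0 hE hol hi => ⟨h.isOpen_btDomain c, h.dense_btDomain hn0 c, ?_⟩,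
    isCurveFlowWith_vac hn hj0, fun x t => (frame_and_curvature_vac hn0 hj0 x t).2,
    isFrame_vac hn hj0, isHolo_vac, vacFrame_zero hn0 hj0, fun c => ⟨?_, ?_⟩⟩
  · obtain ⟨γ', hγ'⟩ := IsCurveFlowWith.exists_real_btCurve h hn0 hO h0 hE hol hi c
    exact ⟨γ', fun x t _ => hγ' x t,
      h.isCurveFlow_btCurve hn hO h0 hE hol hi fun x t _ => hγ' x t⟩
  -- A dense subset of the plane is nonempty, so Q is never the zero polynomial.
  · exact ((isCurveFlowWith_vac hn hj0).dense_btDomain hn0 c).nonempty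
  · obtain ⟨P, Q, hQ, hP⟩ := exists_rational_btCurve_vac hn hj0 c
    exact ⟨P, Q, hQ, hP, (isCurveFlowWith_vac hn hj0).isCurveFlow_btCurve hn isOpen_univ
      (Set.mem_univ 0) (isFrame_vac hn hj0) isHolo_vac (vacFrame_zero hn0 hj0) hP⟩
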